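/- **Setting.** Let $n,H\ge 1$ and $T\ge 2$ be integers, let $K\subset\mathbb{R}^n$ be convex, closed and bounded with non-empty interior and $\mathrm{diam}(K)\le D$, and let $R$ be a $\nu$-self-concordant barrier of $K$: $R$ is $C^3$ on $\mathrm{int}(K)$, $R(x)\to\infty$ as $x$ tends to $\partial K$ from $\mathrm{int}(K)$ (so $R=+\infty$ on $\partial K$), and $|\nabla^3R(x)[h,h,h]|\le 2|\nabla^2R(x)[h,h]|^{3/2}$, $|\langle\nabla R(x),h\rangle|\le\sqrt{\nu}\,|\nabla^2R(x)[h,h]|^{1/2}$ for all $x\in\mathrm{int}(K)$, $h\in\mathbb{R}^n$. Let $u_1,u_2,\dots$ be i.i.d. uniform on the unit sphere $S^{n-1}$, and let $F_H,\dots,F_T$ be random loss functions on $K^H$. The algorithm EBCO-M with parameters $\sigma>0$ and $\eta>0$ sets $x_1=\dots=x_H=\arg\min_{x\in K}R(x)$, $A_t=(\nabla^2R(x_t)+\eta\sigma tI)^{-1/2}$ and $y_t=x_t+A_tu_t$ for $1\le t\le T$, $g_t=0$ for $t<H$, and, for $t=H,\dots,T$, plays $y_t$, observes only the number $F_t(y_{t-H+1},\dots,y_t)$,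 and sets $$g_t=n\,F_t(y_{t-H+1},\dots,y_t)\sum_{i=0}^{H-1}A_{t-i}^{-1}u_{t-i},\qquad x_{t+1}=\arg\min_{x\in K}\ \sum_{s=H}^t\Big(g_{s-H+1}^\top x+\frac{\sigma}{2}\|x-x_{s-H+1}\|^2\Big)+\frac1\eta R(x).$$ **Assumptions.** Let $B,L,\beta>0$. 1. Each $F_t:K^H\to[0,B]$ is convex and quadratic, $F_t(w)=w^\top W_tw+b_t^\top w+c_t$ (with $W_t,b_t,c_t$ possibly random), $\beta$-smooth in the sense that $W_t\preceq\beta I$, and $\|\nabla F_t(w)\|_2\le L$ on $K^H$. 2. (Adversary.) For every $H\le t\le T$, the $H$ most recent noises $u_{t-H+1},\dots,u_t$ are independent of $(F_t,\,u_1,\dots,u_{t-H},\,F_H,\dots,F_{t-H})$; apart from this $F_t$ may depend on earlier noises and losses. 3. (Conditional strong convexity.) For every $H\le t\le T$, with $f_t(z)=F_t(z,\dots,z)$, the function $z\mapsto\bar f_t(z)=\mathbb{E}[f_t(z)\mid u_1,\dots,u_{t-H},F_H,\dots,F_{t-H}]$ is almost surely $\sigma$-strongly convex on $K$. 4. $H\le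 c_H(\log T)^p$, where $c_H>0$ and $p\in\mathbb{N}$. **Conclusion.** For each $p$ there is an exponent $q$ such that for all $B,D,L,c_H>0$ and every step-size constant $\kappa>0$ there is a constant $C=C(p,B,D,L,c_H,\kappa)>0$, independent of $n,H,T,\sigma,\beta,\nu,K,R$ and the adversary, such that EBCO-M run with $$\eta=\frac{\kappa}{nBH(1+\log H)\sqrt T}$$ has finite expected losses and satisfies $$\sum_{t=H}^T\mathbb{E}[F_t(y_{t-H+1},\dots,y_t)]-\min_{x\in K}\sum_{t=H}^T\mathbb{E}[f_t(x)]\ \le\ C\,(1+\nu)\,(\log T)^q\,\frac{\beta n}{\sigma}\sqrt T ,$$ i.e. the expected regret is $\tilde{\mathcal O}\big(\frac{\beta n}{\sigma}\sqrt T\big)$, with $\tilde{\mathcal O}$ hiding powers of $\log T$, the natural parameters $B,D,L$ and the barrier parameter $\nu$. -/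

import Mathlib

open MeasureTheory ProbabilityTheory Set Filter Topology
open scoped ENNReal

noncomputable section

namespace EBCO

/-- The Euclidean space `ℝⁿ`. -/
abbrev E (n : ℕ) : Type := EuclideanSpace ℝ (Fin n)

/-- The Euclidean space `ℝ^{nH} = (ℝⁿ)^H` of histories `(w_0, …, w_{H-1})`, with the `ℓ₂` norm. -/
abbrev Hist (n H : ℕ) : Type := PiLp 2 (fun _ : Fin H => E n)

/-- The product `K^H` inside `(ℝⁿ)^H`. -/
def histSet {n : ℕ} (K : Set (E n)) (H : ℕ) : Set (Hist n H) := {w | ∀ j, w j ∈ K}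

/-- The constant history `(z, …, z)`. -/
def diag {n : ℕ} (H : ℕ) (z : E n) : Hist n H := WithLp.toLp 2 (fun _ => z)

/-- The window `(y_{t-H+1}, …, y_t)` of the last `H` plays (used for `t ≥ H`). -/
def window {n : ℕ} (H : ℕ) (y : ℕ → E n) (t : ℕ) : Hist n H :=
  WithLp.toLp 2 (fun j => y (t + 1 - H + (j : ℕ)))

/-- The unit sphere `S^{n-1}` of `ℝⁿ`. -/
abbrev UnitSphere (n : ℕ) : Type := Metric.sphere (0 : E n) 1

/-- The uniform probability distribution on `S^{n-1}`: normalized surface measure. -/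
def uniformSphere (n : ℕ) : Measure (UnitSphere n) :=
  ((volume : Measure (E n)).toSphere univ)⁻¹ • (volume : Measure (E n)).toSphere

/-- The Hessian `∇²R(x)`, as a linear operator: the derivative of the gradient. -/
def hess {n : ℕ} (R : E n → ℝ) (x : E n) : E n →L[ℝ] E n := fderiv ℝ (gradient R) x

/-- `R` is a `ν`-self-concordant barrier of the closed convex set `K`. Only the values of `R` on
`interior K` matter; on the boundary of `K` the barrier is understood to be `+∞`. -/
structure IsSelfConcordantBarrier {n : ℕ} (K : Set (E n)) (ν : ℝ) (R : E n → ℝ) : Prop where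
  contDiffOn : ContDiffOn ℝ 3 R (interior K)
  tendsto_boundary : ∀ x ∈ frontier K, Tendsto R (𝓝[interior K] x) atTop
  third_le : ∀ x ∈ interior K, ∀ h : E n,
    |iteratedFDeriv ℝ 3 R x (fun _ => h)| ≤ 2 * |inner ℝ (hess R x h) h| ^ (3 / 2 : ℝ)
  first_le : ∀ x ∈ interior K, ∀ h : E n,
    |inner ℝ (gradient R x) h| ≤ Real.sqrt ν * |inner ℝ (hess R x h) h| ^ (1 / 2 : ℝ)

/-- The quadratic function `w ↦ wᵀ W w + bᵀ w + c` on `(ℝⁿ)^H`. -/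
def quad {n H : ℕ} (W : Hist n H →L[ℝ] Hist n H) (b : Hist n H) (c : ℝ) (w : Hist n H) : ℝ :=
  inner ℝ w (W w) + inner ℝ b w + c

/-- A loss function `F : K^H → [0, B]` which is convex, quadratic, `β`-smooth (`W ≼ β I`), and whose
gradient is bounded by `L` on `K^H`. Only the values of `F` on `K^H` matter. -/
structure IsAdmissibleLoss {n H : ℕ} (K : Set (E n)) (B L β : ℝ) (F : Hist n H → ℝ) : Prop where
  nonneg : ∀ w ∈ histSet K H, 0 ≤ F w
  le_bound : ∀ w ∈ histSet K H, F w ≤ B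
  convexOn : ConvexOn ℝ (histSet K H) F
  quadratic : ∃ (W : Hist n H →L[ℝ] Hist n H) (b : Hist n H) (c : ℝ),
    EqOn F (quad W b c) (histSet K H) ∧
    (∀ v, inner ℝ v (W v) ≤ β * ‖v‖ ^ 2) ∧
    (∀ w ∈ histSet K H, ‖gradient (quad W b c) w‖ ≤ L)

/-- The operator `A` is `M^{-1/2}`: the positive operator whose square is inverse to `M`. -/
def IsInvSqrt {n : ℕ} (A M : E n →L[ℝ] E n) : Prop :=
  A.IsPositive ∧ (A ∘L A) ∘L M = ContinuousLinearMap.id ℝ (E n)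

/-- `(x, A, y, g)` is the trajectory, up to the horizon `T`, of the algorithm EBCO-M run on `K` with
barrier `R`, strong convexity parameter `σ`, step size `η` and memory length `H`, when the losses
are `F_t` and the sampled directions are `u_t`. Here `x_t` are the iterates, `A_t` the exploration
matrices, `y_t` the plays and `g_t` the gradient estimators. -/
structure IsRun {n : ℕ} (K : Set (E n)) (R : E n → ℝ) (σ η : ℝ) (H T : ℕ)
    (F : ℕ → Hist n H → ℝ) (u : ℕ → UnitSphere n)
    (x : ℕ → E n) (A : ℕ → E n →L[ℝ] E n) (y g : ℕ → E n) : Prop where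
  /-- `x_1 = ⋯ = x_H = argmin_K R` -/
  init : ∀ t ∈ Finset.Icc 1 H, x t ∈ interior K ∧ IsMinOn R (interior K) (x t)
  /-- `A_t = (∇²R(x_t) + η σ t I)^{-1/2}` -/
  explore : ∀ t ∈ Finset.Icc 1 (max H T),
    IsInvSqrt (A t) (hess R (x t) + (η * σ * t) • ContinuousLinearMap.id ℝ (E n))
  /-- `y_t = x_t + A_t u_t` -/
  play : ∀ t ∈ Finset.Icc 1 (max H T), y t = x t + A t (u t : E n)
  /-- `g_t = 0` for `1 ≤ t ≤ H - 1` -/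
  grad_init : ∀ t ∈ Finset.Icc 1 (H - 1), g t = 0
  /-- `g_t = n F_t(y_{t-H+1}, …, y_t) ∑_{i=0}^{H-1} A_{t-i}^{-1} u_{t-i}` for `H ≤ t ≤ T` -/
  grad : ∀ t ∈ Finset.Icc H T,
    g t = ((n : ℝ) * F t (window H y t)) •
      ∑ i ∈ Finset.range H, (A (t - i)).inverse (u (t - i) : E n)
  /-- `x_{t+1} = argmin_{x ∈ K} ∑_{s=H}^t (g_{s-H+1}ᵀ x + (σ/2)‖x - x_{s-H+1}‖²) + R(x)/η` -/
  update : ∀ t ∈ Finset.Ico H T, x (t + 1) ∈ interior K ∧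
    IsMinOn (fun z => ∑ s ∈ Finset.Icc H t,
        (inner ℝ (g (s + 1 - H)) z + σ / 2 * ‖z - x (s + 1 - H)‖ ^ 2) + 1 / η * R z)
      (interior K) (x (t + 1))

variable {Ω : Type*}

/-- The σ-algebra generated by the noises `u_s`, `a ≤ s ≤ b`. -/
@[reducible] def noiseSigma {n : ℕ} (u : ℕ → Ω → UnitSphere n) (a b : ℕ) : MeasurableSpace Ω :=
  ⨆ s ∈ Finset.Icc a b, MeasurableSpace.comap (u s) inferInstance

/-- The σ-algebra generated by one random loss function on `K^H`, i.e. by all of its values. -/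
@[reducible] def lossSigma {n H : ℕ} (K : Set (E n)) (F : Ω → Hist n H → ℝ) : MeasurableSpace Ω :=
  ⨆ w ∈ histSet K H, MeasurableSpace.comap (fun ω => F ω w) inferInstance

/-- The σ-algebra generated by the noises `u_1, …, u_{t-H}` and the losses `F_H, …, F_{t-H}`
(used for `t ≥ H`). -/
@[reducible] def pastSigma {n H : ℕ} (K : Set (E n)) (u : ℕ → Ω → UnitSphere n)
    (F : ℕ → Ω → Hist n H → ℝ) (t : ℕ) : MeasurableSpace Ω :=
  noiseSigma u 1 (t - H) ⊔ ⨆ s ∈ Finset.Icc H (t - H), lossSigma K (F s)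

variable [MeasurableSpace Ω]

/-- The exploration noises `u_1, …, u_N` are i.i.d. uniform on the sphere. -/
structure IsUniformNoise {n : ℕ} (P : Measure Ω) (N : ℕ) (u : ℕ → Ω → UnitSphere n) : Prop where
  measurable : ∀ t ∈ Finset.Icc 1 N, Measurable (u t)
  law : ∀ t ∈ Finset.Icc 1 N, P.map (u t) = uniformSphere n
  indep : iIndepFun (fun (t : Finset.Icc 1 N) => u t) P

/-- Adaptivity of the adversary: for each `t`, the `H` most recent noises `u_{t-H+1}, …, u_t` are
independent of the loss `F_t` together with the noises and losses up to time `t - H`, on which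
`F_t` may depend arbitrarily. -/
def IsDelayedAdversary {n H : ℕ} (P : Measure Ω) (K : Set (E n)) (T : ℕ)
    (u : ℕ → Ω → UnitSphere n) (F : ℕ → Ω → Hist n H → ℝ) : Prop :=
  ∀ t ∈ Finset.Icc H T,
    Indep (noiseSigma u (t + 1 - H) t) (pastSigma K u F t ⊔ lossSigma K (F t)) P

/-- Conditional strong convexity of the unary form `f_t(z) = F_t(z, …, z)`: the random function
`z ↦ 𝔼[f_t(z) ∣ u_{1:t-H}, F_{H:t-H}]` on `K` has a version that is almost surely `σ`-strongly
convex. -/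
def IsCondStronglyConvex {n H : ℕ} (P : Measure Ω) (K : Set (E n)) (σ : ℝ)
    (u : ℕ → Ω → UnitSphere n) (F : ℕ → Ω → Hist n H → ℝ) (t : ℕ) : Prop :=
  ∃ fbar : Ω → E n → ℝ,
    (∀ z ∈ K, (fun ω => fbar ω z) =ᵐ[P] P[fun ω => F t ω (diag H z) | pastSigma K u F t]) ∧
    ∀ᵐ ω ∂P, StrongConvexOn K σ (fbar ω)

/-- The expected regret against the fixed decision `z`:
`∑_{t=H}^T 𝔼[F_t(y_{t-H+1}, …, y_t)] - ∑_{t=H}^T 𝔼[f_t(z)]`. -/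
def expectedRegret {n H : ℕ} (P : Measure Ω) (T : ℕ) (F : ℕ → Ω → Hist n H → ℝ)
    (y : ℕ → Ω → E n) (z : E n) : ℝ :=
  ∑ t ∈ Finset.Icc H T, ∫ ω, F t ω (window H (fun s => y s ω) t) ∂P -
    ∑ t ∈ Finset.Icc H T, ∫ ω, F t ω (diag H z) ∂P

end EBCO

end

noncomputable section

namespace EBCO

/-! ### Derivative forms of a barrier and positivity of its Hessian. -/

section Barrier

variable {n : ℕ} {K : Set (E n)} {ν : ℝ} {R : E n → ℝ}

/-! The algorithm is follow-the-regularized-leader fed with delayed one-point gradient estimates.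
The regret splits into a probabilistic part, one round at a time, and a pathwise part, valid on
every trajectory.

Probabilistic part. The iterate x_t only uses g_1, …, g_{t-H}, so x_{t-H+1}, …, x_t and their
exploration matrices are determined by the past up to t-H (`RandomRun.measurable_iterate`), while
the last H noises are independent of that past and of F_t. For a quadratic loss, averaging over u ↦
-u removes all but the linear term of F_t(w + Au) from its product with the sum of the A_j⁻¹u_j.
Since n times the covariance of a uniform direction is the identity, g_t is exactly unbiased for the
gradient at the window of iterates, summed over its H blocks (`integral_estimator`). Exploring costs
at most βH/(ησ(t+1-H)) in round t, because ησt‖A_t u_t‖² ≤ 1; these costs sum to a logarithm divided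
by η. Strong convexity is available only for the conditional mean of the unary loss. For quadratics
it is a lower bound on the curvature of F_t averaged over past events, in each fixed direction.
Approximation by simple functions extends it to the random but past-measurable direction x_t - z
(`IsCondStronglyConvex.integral_norm_sq_le`). The resulting -σ/2‖x_t - z‖² cancels the proximal
terms of the regularized leader.

Pathwise part. The be-the-leader inequality pairs g_t with x_{t+H}, the first iterate whose
objective contains g_t. Going back to x_t, and from the window of iterates to the diagonal, is paid
for by the movement of the iterates. Subtracting consecutive optimality conditions and using strong
monotonicity of the gradient of the barrier bounds a step in the local norm by a multiple of ηnBH +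
√(Bη/(t+1-H)) (`BoundedRun.sqrt_proxForm_step_le`), so the total movement is O(√T). This requires
the Hessians at iterates up to 2H rounds apart to be comparable, which holds inductively as long as
the step bound is at most 1/(24H). Otherwise T is at most a constant times H²√T, and the trivial
bound BT suffices.

Two consequences of bounded, smooth losses shape the final constant: σ‖a - b‖² ≤ 8B on K and σ ≤
2βH. The first turns products of two distances with β into β/σ; the second lets every term without
this ratio be absorbed into it. A comparator on the boundary, where the barrier is infinite, is
moved by a fraction 1/T towards x_H, which costs ν log T/η and at most B in total.

Convexity of the barrier is not assumed. It follows from boundedness of K in `hessForm_pos`, on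
which the rest of the self-concordant calculus rests. -/

theorem IsSelfConcordantBarrier.contDiffAt (hR : IsSelfConcordantBarrier K ν R) {x : E n}
    (hx : x ∈ interior K) : ContDiffAt ℝ 3 R x :=
  hR.contDiffOn.contDiffAt (isOpen_interior.mem_nhds hx)

theorem contDiffAt_gradient {x : E n} (h : ContDiffAt ℝ 3 R x) :
    ContDiffAt ℝ 2 (gradient R) x := by
  rw [contDiffAt_euclidean]
  intro i
  have h1 : (fun y => gradient R y i) = fun y => fderiv ℝ R y (EuclideanSpace.single i 1) := by
    funext y
    rw [← inner_gradient_left, EuclideanSpace.inner_single_right]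
    simp
  rw [h1]
  exact (h.fderiv_right (by norm_num)).clm_apply contDiffAt_const

theorem IsSelfConcordantBarrier.contDiffAt_hess (hR : IsSelfConcordantBarrier K ν R) {x : E n}
    (hx : x ∈ interior K) : ContDiffAt ℝ 1 (hess R) x :=
  (contDiffAt_gradient (hR.contDiffAt hx)).fderiv_right (by norm_num)

/-- The third derivative of `R`, as a trilinear form. -/
def third (R : E n → ℝ) (x h v w : E n) : ℝ := inner ℝ (fderiv ℝ (hess R) x h v) w

theorem inner_hess_eq {x : E n} (h : ContDiffAt ℝ 3 R x) (v w : E n) :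
    inner ℝ (hess R x v) w = fderiv ℝ (fderiv ℝ R) x v w := by
  have h1 : HasFDerivAt (gradient R) (hess R x) x :=
    ((contDiffAt_gradient h).differentiableAt (by norm_num)).hasFDerivAt
  have h2 : HasFDerivAt (fderiv ℝ R) (fderiv ℝ (fderiv ℝ R) x) x :=
    ((h.fderiv_right (m := 2) (by norm_num)).differentiableAt (by norm_num)).hasFDerivAt
  have h3 := h1.inner ℝ (hasFDerivAt_const w x)
  have h4 := h2.clm_apply (hasFDerivAt_const w x)
  have h5 : (fun y => inner ℝ (gradient R y) w) = fun y => fderiv ℝ R y w := by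
    funext y; exact inner_gradient_left
  rw [h5] at h3
  have := congrArg (fun L => L v) (h3.unique h4)
  simpa [fderivInnerCLM_apply] using this

theorem inner_hess_comm {x : E n} (h : ContDiffAt ℝ 3 R x) (v w : E n) :
    inner ℝ (hess R x v) w = inner ℝ (hess R x w) v := by
  rw [inner_hess_eq h, inner_hess_eq h]
  exact (h.isSymmSndFDerivAt (by simp; norm_num)).eq v w

theorem hasFDerivAt_inner_hess (hR : IsSelfConcordantBarrier K ν R) {x : E n}
    (hx : x ∈ interior K) (v w : E n) :
    ∃ L : E n →L[ℝ] ℝ, HasFDerivAt (fun y => inner ℝ (hess R y v) w) L x ∧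
      ∀ h, L h = third R x h v w := by
  have h1 := ((hR.contDiffAt_hess hx).differentiableAt (by norm_num)).hasFDerivAt
  refine ⟨_, (h1.clm_apply (hasFDerivAt_const v x)).inner ℝ (hasFDerivAt_const w x), fun h => ?_⟩
  simp [fderivInnerCLM_apply, third]

theorem third_comm_left (hR : IsSelfConcordantBarrier K ν R) {x : E n}
    (hx : x ∈ interior K) (h v w : E n) : third R x h v w = third R x v h w := by
  have := (contDiffAt_gradient (hR.contDiffAt hx)).isSymmSndFDerivAt (by simp)
  unfold third
  have h2 := this.eq h v
  unfold hess
  rw [h2]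

/-- Differentiates the symmetry of the Hessian, which holds on a whole neighbourhood. Together with
`third_comm_left` this makes the trilinear form fully symmetric, as polarization requires. -/
theorem third_comm_right (hR : IsSelfConcordantBarrier K ν R) {x : E n}
    (hx : x ∈ interior K) (h v w : E n) : third R x h v w = third R x h w v := by
  obtain ⟨L₁, hL₁, h₁⟩ := hasFDerivAt_inner_hess hR hx v w
  obtain ⟨L₂, hL₂, h₂⟩ := hasFDerivAt_inner_hess hR hx w v
  rw [← h₁, ← h₂]
  have : (fun y => inner ℝ (hess R y v) w) =ᶠ[𝓝 x] fun y => inner ℝ (hess R y w) v := by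
    filter_upwards [isOpen_interior.mem_nhds hx] with y hy
    exact inner_hess_comm (hR.contDiffAt hy) v w
  rw [(this.hasFDerivAt_iff.1 hL₁).unique hL₂]

theorem third_eq_iteratedFDeriv (hR : IsSelfConcordantBarrier K ν R) {x : E n}
    (hx : x ∈ interior K) (h : E n) :
    third R x h h h = iteratedFDeriv ℝ 3 R x (fun _ => h) := by
  obtain ⟨L, hL, h1⟩ := hasFDerivAt_inner_hess hR hx h h
  rw [← h1]
  have h2 : (fun y => inner ℝ (hess R y h) h) =ᶠ[𝓝 x]
      fun y => iteratedFDeriv ℝ 2 R y (fun _ => h) := by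
    filter_upwards [isOpen_interior.mem_nhds hx] with y hy
    rw [inner_hess_eq (hR.contDiffAt hy), iteratedFDeriv_two_apply]
  have h3 : HasFDerivAt (iteratedFDeriv ℝ 2 R) (fderiv ℝ (iteratedFDeriv ℝ 2 R) x) x :=
    ((hR.contDiffAt hx).differentiableAt_iteratedFDeriv (by norm_num)).hasFDerivAt
  have h4 := (h3.continuousMultilinear_apply_const (fun _ => h)).unique (h2.hasFDerivAt_iff.1 hL)
  rw [← h4, iteratedFDeriv_succ_apply_left]
  rfl

theorem abs_third_self_le (hR : IsSelfConcordantBarrier K ν R) {x : E n}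
    (hx : x ∈ interior K) (h : E n) :
    |third R x h h h| ≤ 2 * |inner ℝ (hess R x h) h| ^ (3 / 2 : ℝ) := by
  rw [third_eq_iteratedFDeriv hR hx]
  exact hR.third_le x hx h

theorem hasDerivAt_line (x h : E n) (s : ℝ) : HasDerivAt (fun s : ℝ => x + s • h) h s := by
  simpa using ((hasDerivAt_id s).smul_const h).const_add x

theorem hasDerivAt_comp_line (hR : IsSelfConcordantBarrier K ν R) {x h : E n} {s : ℝ}
    (hx : x + s • h ∈ interior K) :
    HasDerivAt (fun s : ℝ => R (x + s • h)) (inner ℝ (gradient R (x + s • h)) h) s := by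
  have h1 := ((hR.contDiffAt hx).differentiableAt (by norm_num)).hasFDerivAt
  have := h1.comp_hasDerivAt s (hasDerivAt_line x h s)
  rwa [← inner_gradient_left] at this

theorem hasDerivAt_gradient_line (hR : IsSelfConcordantBarrier K ν R) {x h : E n} {s : ℝ}
    (hx : x + s • h ∈ interior K) (v : E n) :
    HasDerivAt (fun s : ℝ => inner ℝ (gradient R (x + s • h)) v)
      (inner ℝ (hess R (x + s • h) h) v) s := by
  have h1 := ((contDiffAt_gradient (hR.contDiffAt hx)).differentiableAt (by norm_num)).hasFDerivAt
  have h2 := h1.comp_hasDerivAt s (hasDerivAt_line x h s)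
  have h3 := h2.inner ℝ (hasDerivAt_const s v)
  simp only [inner_zero_right, zero_add] at h3
  exact h3

theorem hasDerivAt_hess_line (hR : IsSelfConcordantBarrier K ν R) {x h : E n} {s : ℝ}
    (hx : x + s • h ∈ interior K) (v w : E n) :
    HasDerivAt (fun s : ℝ => inner ℝ (hess R (x + s • h) v) w) (third R (x + s • h) h v w) s := by
  obtain ⟨L, hL, h1⟩ := hasFDerivAt_inner_hess hR hx v w
  rw [← h1]
  exact hL.comp_hasDerivAt s (hasDerivAt_line x h s)

theorem add_smul_mem_interior (hK : Convex ℝ K) {x h : E n} (hx : x ∈ interior K)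
    (hxh : x + h ∈ interior K) {s : ℝ} (hs : s ∈ Icc (0 : ℝ) 1) : x + s • h ∈ interior K := by
  have := hK.interior.add_smul_sub_mem hx hxh hs
  simpa using this

/-- The barrier property along a segment: a segment which starts in the interior of `K` and along
which `R` stays bounded cannot leave the interior. -/
theorem mem_interior_of_bounded (hR : IsSelfConcordantBarrier K ν R) (hK : Convex ℝ K)
    {x h : E n} (hx : x ∈ interior K) (C : ℝ)
    (hC : ∀ s ∈ Icc (0 : ℝ) 1, x + s • h ∈ interior K → R (x + s • h) ≤ C) :
    x + h ∈ interior K := by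
  by_contra hxh
  -- If the endpoint were outside, connectedness would give a boundary point x + s h of the
  -- interior. Convexity keeps x + (rs)h interior for r < 1, and R blows up along these points as r
  -- → 1.
  have hconn : IsPreconnected (segment ℝ x (x + h)) := (convex_segment x (x + h)).isPreconnected
  obtain ⟨p, hp, hpf⟩ : ((segment ℝ x (x + h)) ∩ frontier (interior K)).Nonempty :=
    by
    by_contra hemp
    have hcov : segment ℝ x (x + h) ⊆ interior K ∪ (closure (interior K))ᶜ := by
      intro q hq
      by_contra hq'
      simp only [mem_union, mem_compl_iff, not_or, not_not] at hq'
      exact hemp ⟨q, hq, hq'.2, by rw [interior_interior]; exact hq'.1⟩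
    obtain ⟨q, -, hq1, hq2⟩ := hconn _ _ isOpen_interior isClosed_closure.isOpen_compl hcov
      ⟨x, left_mem_segment ℝ x _, hx⟩
      ⟨x + h, right_mem_segment ℝ x _, (hcov (right_mem_segment ℝ x _)).resolve_left hxh⟩
    exact hq2 (subset_closure hq1)
  rw [segment_eq_image'] at hp
  obtain ⟨s, hs, rfl⟩ := hp
  simp only [add_sub_cancel_left] at hpf
  rw [frontier, interior_interior] at hpf
  have hcl : x + s • h ∈ closure K := closure_mono interior_subset hpf.1
  have hfr : x + s • h ∈ frontier K := ⟨hcl, hpf.2⟩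
  have hin : ∀ r ∈ Ico (0 : ℝ) 1, x + (r * s) • h ∈ interior K := by
    intro r hr
    rcases eq_or_lt_of_le hr.1 with h0 | h0
    · simpa [← h0] using hx
    · apply hK.openSegment_interior_closure_subset_interior hx hcl
      refine ⟨1 - r, r, by linarith [hr.2], h0, by ring, ?_⟩
      rw [smul_add, smul_smul, ← add_assoc, ← add_smul]
      simp
  have hlim : Tendsto (fun r : ℝ => x + (r * s) • h) (𝓝[<] 1) (𝓝[interior K] (x + s • h)) := by
    refine tendsto_nhdsWithin_iff.2 ⟨?_, ?_⟩
    · have : Continuous (fun r : ℝ => x + (r * s) • h) := by fun_prop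
      have h2 := this.tendsto 1
      simp only [one_mul] at h2
      exact h2.mono_left nhdsWithin_le_nhds
    · filter_upwards [Ico_mem_nhdsLT (zero_lt_one : (0 : ℝ) < 1)] with r hr using hin r hr
  have hR' := (hR.tendsto_boundary _ hfr).comp hlim
  have hev := hR'.eventually (eventually_gt_atTop C)
  obtain ⟨r, hr1, hr2⟩ := (hev.and (Ico_mem_nhdsLT (zero_lt_one : (0 : ℝ) < 1))).exists
  have : R (x + (r * s) • h) ≤ C := hC (r * s)
    ⟨mul_nonneg hr2.1 hs.1, by nlinarith [hr2.1, hr2.2, hs.1, hs.2]⟩ (hin r hr2)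
  simp only [Function.comp] at hr1
  linarith

/-- The quadratic form of the Hessian of `R` at `x`. -/
def hessForm (R : E n → ℝ) (x v : E n) : ℝ := inner ℝ (hess R x v) v

theorem hessForm_smul (x v : E n) (c : ℝ) : hessForm R x (c • v) = c ^ 2 * hessForm R x v := by
  simp [hessForm, inner_smul_left, inner_smul_right]; ring

theorem hessForm_neg (x v : E n) : hessForm R x (-v) = hessForm R x v := by
  simp [hessForm]

theorem continuousOn_hessForm_line (hR : IsSelfConcordantBarrier K ν R) (hK : Convex ℝ K)
    {x h : E n} (hx : x ∈ interior K) (hxh : x + h ∈ interior K) (v : E n) :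
    ContinuousOn (fun s : ℝ => hessForm R (x + s • h) v) (Icc 0 1) := fun _ hs =>
  (hasDerivAt_hess_line hR (add_smul_mem_interior hK hx hxh hs) v v).continuousAt.continuousWithinAt

/-- A vanishing second derivative in the direction of a chord propagates along the chord. -/
theorem hessForm_eq_zero_of_eq_zero (hR : IsSelfConcordantBarrier K ν R) (hK : Convex ℝ K)
    {x h : E n} (hx : x ∈ interior K) (hxh : x + h ∈ interior K) (h0 : hessForm R x h = 0) :
    hessForm R (x + h) h = 0 := by
  have hcont := continuousOn_hessForm_line hR hK hx hxh h
  obtain ⟨M, hM⟩ := isCompact_Icc.exists_bound_of_continuousOn hcont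
  have hM0 : 0 ≤ M := (norm_nonneg _).trans (hM 0 ⟨le_rfl, zero_le_one⟩)
  -- With q the second derivative along the chord, |q'| ≤ 2|q|^{3/2} ≤ 2√M |q|, so Grönwall applies.
  -- The sign of q is not known at this stage, hence the absolute values.
  have key := norm_le_gronwallBound_of_norm_deriv_right_le
    (f := fun s : ℝ => hessForm R (x + s • h) h)
    (f' := fun s => third R (x + s • h) h h h) (δ := 0) (K := 2 * M ^ (1 / 2 : ℝ)) (ε := 0)
    (a := 0) (b := 1) hcont
    (fun s hs => (hasDerivAt_hess_line hR
      (add_smul_mem_interior hK hx hxh ⟨hs.1, hs.2.le⟩) h h).hasDerivWithinAt)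
    (by simp [h0]) ?_ 1 ⟨zero_le_one, le_rfl⟩
  · rw [gronwallBound_ε0_δ0] at key
    simpa using key
  · intro s hs
    have hs' : s ∈ Icc (0 : ℝ) 1 := ⟨hs.1, hs.2.le⟩
    have h1 := abs_third_self_le hR (add_smul_mem_interior hK hx hxh hs') h
    have h2 := hM s hs'
    rw [Real.norm_eq_abs] at h2 ⊢
    rw [Real.norm_eq_abs, add_zero]
    refine h1.trans ?_
    have h3 : |inner ℝ (hess R (x + s • h) h) h| ^ (3 / 2 : ℝ) =
        |hessForm R (x + s • h) h| ^ (1 / 2 : ℝ) * |hessForm R (x + s • h) h| := by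
      rcases eq_or_lt_of_le (abs_nonneg (hessForm R (x + s • h) h)) with h4 | h4
      · rw [← h4, mul_zero]
        have : |inner ℝ (hess R (x + s • h) h) h| = 0 := h4.symm
        rw [this, Real.zero_rpow (by norm_num)]
      · have : (3 / 2 : ℝ) = 1 / 2 + 1 := by norm_num
        change |hessForm R (x + s • h) h| ^ (3 / 2 : ℝ) = _
        rw [this, Real.rpow_add h4, Real.rpow_one]
    rw [h3, ← mul_assoc]
    gcongr

/-- A self-concordant barrier of a bounded set has a positive definite Hessian. -/
theorem hessForm_pos (hR : IsSelfConcordantBarrier K ν R) (hK : Convex ℝ K)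
    (hKb : Bornology.IsBounded K) {x v : E n} (hx : x ∈ interior K) (hv : v ≠ 0) :
    0 < hessForm R x v := by
  by_contra hneg
  push Not at hneg
  -- The form is even in v, so v may be reversed to make R nonincreasing to first order.
  wlog hg : inner ℝ (gradient R x) v ≤ 0 generalizing v
  · refine this (neg_ne_zero.2 hv) (by rwa [hessForm_neg]) ?_
    rw [inner_neg_right]; linarith
  -- the second derivative stays nonpositive along the ray
  have hray : ∀ s : ℝ, 0 ≤ s → x + s • v ∈ interior K → hessForm R (x + s • v) v ≤ 0 := by
    intro s hs hxs
    by_contra hpos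
    push Not at hpos
    have hs0 : 0 < s := by
      rcases eq_or_lt_of_le hs with h0 | h0
      · rw [← h0, zero_smul, add_zero] at hpos; linarith
      · exact h0
    have hcont := continuousOn_hessForm_line hR hK hx hxs v
    -- A change of sign produces a zero at parameter r. That zero propagates over the remaining
    -- chord ((1 - r)s)v to the endpoint, where the form was assumed positive.
    obtain ⟨r, hr, hr0⟩ := intermediate_value_Icc (zero_le_one) hcont
      (show (0 : ℝ) ∈ Icc _ _ from ⟨by simpa using hneg, by simpa using hpos.le⟩)
    simp only at hr0
    have hxr := add_smul_mem_interior hK hx hxs hr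
    have h1 : x + r • s • v + ((1 - r) * s) • v = x + s • v := by
      rw [smul_smul, add_assoc, ← add_smul]; congr 2; ring
    have := hessForm_eq_zero_of_eq_zero hR hK hxr (h := ((1 - r) * s) • v) (by rwa [h1])
      (by rw [hessForm_smul, hr0, mul_zero])
    rw [h1, hessForm_smul] at this
    rcases mul_eq_zero.1 this with h2 | h2
    · have h3 : (1 - r) * s = 0 := by simpa using h2
      rcases mul_eq_zero.1 h3 with h4 | h4
      · have : r = 1 := by linarith
        rw [this, one_smul] at hr0; linarith
      · linarith
    · linarith
  -- hence `R` does not increase along the ray, which therefore stays in `K`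
  have hstay : ∀ s : ℝ, 0 ≤ s → x + s • v ∈ interior K := by
    intro s hs
    refine mem_interior_of_bounded hR hK hx (R x) (h := s • v) ?_
    intro r hr hxr
    set w := r • s • v with hw
    have hw' : w = (r * s) • v := by rw [hw, smul_smul]
    have hrs : 0 ≤ r * s := mul_nonneg hr.1 hs
    have hmem : ∀ t ∈ Icc (0 : ℝ) 1, x + t • w ∈ interior K :=
      fun t ht => add_smul_mem_interior hK hx hxr ht
    have hanti : AntitoneOn (fun t : ℝ => inner ℝ (gradient R (x + t • w)) w) (Icc 0 1) := by
      refine antitoneOn_of_hasDerivWithinAt_nonpos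
        (f' := fun t => inner ℝ (hess R (x + t • w) w) w) (convex_Icc 0 1) ?_ ?_ ?_
      · exact fun t ht => (hasDerivAt_gradient_line hR
          (hmem t ht) w).continuousAt.continuousWithinAt
      · exact fun t ht => (hasDerivAt_gradient_line hR
          (hmem t (interior_subset ht)) w).hasDerivWithinAt
      · intro t ht
        have h1 := hmem t (interior_subset ht)
        have h2 : 0 ≤ t := (interior_subset ht : t ∈ Icc (0 : ℝ) 1).1
        have h3 := hray (t * (r * s)) (by positivity) (by rwa [hw', smul_smul] at h1)
        change hessForm R (x + t • w) w ≤ 0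
        have h4 : x + t • w = x + (t * (r * s)) • v := by rw [hw', smul_smul]
        rw [h4, hw', hessForm_smul]
        exact mul_nonpos_of_nonneg_of_nonpos (sq_nonneg _) h3
    have hanti2 : AntitoneOn (fun t : ℝ => R (x + t • w)) (Icc 0 1) := by
      refine antitoneOn_of_hasDerivWithinAt_nonpos
        (f' := fun t => inner ℝ (gradient R (x + t • w)) w) (convex_Icc 0 1) ?_ ?_ ?_
      · exact fun t ht => (hasDerivAt_comp_line hR (hmem t ht)).continuousAt.continuousWithinAt
      · exact fun t ht => (hasDerivAt_comp_line hR (hmem t (interior_subset ht))).hasDerivWithinAt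
      · intro t ht
        have h1 := hanti ⟨le_rfl, zero_le_one⟩ (interior_subset ht)
          (interior_subset ht : t ∈ Icc (0 : ℝ) 1).1
        refine h1.trans ?_
        simp only [zero_smul, add_zero]
        rw [hw', inner_smul_right]
        exact mul_nonpos_of_nonneg_of_nonpos hrs hg
    have := hanti2 ⟨le_rfl, zero_le_one⟩ ⟨zero_le_one, le_rfl⟩ zero_le_one
    simpa using this
  obtain ⟨C, hC⟩ := hKb.exists_norm_le
  have hvn : 0 < ‖v‖ := norm_pos_iff.2 hv
  have hCx := hC x (interior_subset hx)
  have h1 := hC _ (interior_subset (hstay ((2 * C + 1) / ‖v‖) (by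
    have := (norm_nonneg _).trans hCx; positivity)))
  have h2 : ‖((2 * C + 1) / ‖v‖) • v‖ ≤ ‖x + ((2 * C + 1) / ‖v‖) • v‖ + ‖x‖ := by
    have := norm_sub_le (x + ((2 * C + 1) / ‖v‖) • v) x
    simpa using this
  rw [norm_smul, Real.norm_eq_abs, abs_of_nonneg (by
    have := (norm_nonneg _).trans hCx; positivity), div_mul_cancel₀ _ hvn.ne'] at h2
  linarith

end Barrier

/-- Comparison of increments from a comparison of derivatives on `[0, 1]`. -/
theorem sub_le_sub_of_hasDerivAt_le {f g f' g' : ℝ → ℝ}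
    (hf : ∀ s ∈ Icc (0 : ℝ) 1, HasDerivAt f (f' s) s)
    (hg : ∀ s ∈ Icc (0 : ℝ) 1, HasDerivAt g (g' s) s)
    (h : ∀ s ∈ Icc (0 : ℝ) 1, f' s ≤ g' s) : f 1 - f 0 ≤ g 1 - g 0 := by
  have hmono : MonotoneOn (fun s => g s - f s) (Icc 0 1) := by
    refine monotoneOn_of_hasDerivWithinAt_nonneg (f' := fun s => g' s - f' s) (convex_Icc 0 1)
      ?_ ?_ ?_
    · exact fun s hs => ((hg s hs).sub (hf s hs)).continuousAt.continuousWithinAt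
    · exact fun s hs =>
        ((hg s (interior_subset hs)).sub (hf s (interior_subset hs))).hasDerivWithinAt
    · exact fun s hs => sub_nonneg.2 (h s (interior_subset hs))
  have := hmono ⟨le_rfl, zero_le_one⟩ ⟨zero_le_one, le_rfl⟩ zero_le_one
  simp only at this
  linarith

/-! ### Local norms, the Dikin ellipsoid and strong monotonicity of the gradient. -/

section Barrier

variable {n : ℕ} {K : Set (E n)} {ν : ℝ} {R : E n → ℝ}

theorem hessForm_nonneg (hR : IsSelfConcordantBarrier K ν R) (hK : Convex ℝ K)
    (hKb : Bornology.IsBounded K) {x : E n} (hx : x ∈ interior K) (v : E n) :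
    0 ≤ hessForm R x v := by
  rcases eq_or_ne v 0 with rfl | hv
  · simp [hessForm]
  · exact (hessForm_pos hR hK hKb hx hv).le

/-- The local norm `‖v‖_x` induced by the Hessian of `R` at `x`. -/
def locNorm (R : E n → ℝ) (x v : E n) : ℝ := Real.sqrt (hessForm R x v)

theorem locNorm_nonneg (x v : E n) : 0 ≤ locNorm R x v := Real.sqrt_nonneg _

theorem locNorm_pos (hR : IsSelfConcordantBarrier K ν R) (hK : Convex ℝ K)
    (hKb : Bornology.IsBounded K) {x v : E n} (hx : x ∈ interior K) (hv : v ≠ 0) :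
    0 < locNorm R x v := Real.sqrt_pos.2 (hessForm_pos hR hK hKb hx hv)

theorem sq_locNorm (hR : IsSelfConcordantBarrier K ν R) (hK : Convex ℝ K)
    (hKb : Bornology.IsBounded K) {x : E n} (hx : x ∈ interior K) (v : E n) :
    locNorm R x v ^ 2 = hessForm R x v := Real.sq_sqrt (hessForm_nonneg hR hK hKb hx v)

theorem locNorm_smul (x v : E n) {c : ℝ} (hc : 0 ≤ c) :
    locNorm R x (c • v) = c * locNorm R x v := by
  rw [locNorm, hessForm_smul, Real.sqrt_mul (sq_nonneg c), Real.sqrt_sq hc, locNorm]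

theorem abs_third_self_le_locNorm (hR : IsSelfConcordantBarrier K ν R) (hK : Convex ℝ K)
    (hKb : Bornology.IsBounded K) {x : E n} (hx : x ∈ interior K) (h : E n) :
    |third R x h h h| ≤ 2 * locNorm R x h ^ 3 := by
  refine (abs_third_self_le hR hx h).trans (le_of_eq ?_)
  change 2 * |hessForm R x h| ^ (3 / 2 : ℝ) = _
  rw [abs_of_nonneg (hessForm_nonneg hR hK hKb hx h), locNorm, Real.sqrt_eq_rpow,
    ← Real.rpow_natCast, ← Real.rpow_mul (hessForm_nonneg hR hK hKb hx h)]
  norm_num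

/-- Along a chord with direction `h`, the inverse of the local norm of `h` is `1`-Lipschitz. -/
theorem abs_inv_locNorm_sub_le (hR : IsSelfConcordantBarrier K ν R) (hK : Convex ℝ K)
    (hKb : Bornology.IsBounded K) {x h : E n} (hx : x ∈ interior K) (hxh : x + h ∈ interior K)
    (hh : h ≠ 0) : |(locNorm R (x + h) h)⁻¹ - (locNorm R x h)⁻¹| ≤ 1 := by
  have hmem : ∀ s ∈ Icc (0 : ℝ) 1, x + s • h ∈ interior K :=
    fun s hs => add_smul_mem_interior hK hx hxh hs
  have hd : ∀ s ∈ Icc (0 : ℝ) 1, HasDerivAt (fun s : ℝ => (locNorm R (x + s • h) h)⁻¹)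
      (-(third R (x + s • h) h h h / (2 * locNorm R (x + s • h) h)) /
        locNorm R (x + s • h) h ^ 2) s := fun s hs =>
    ((hasDerivAt_hess_line hR (hmem s hs) h h).sqrt
      (hessForm_pos hR hK hKb (hmem s hs) hh).ne').inv (locNorm_pos hR hK hKb (hmem s hs) hh).ne'
  -- The derivative is -∇³R[h,h,h]/(2‖h‖³) in the local norm, and self-concordance bounds the cubic
  -- form by 2‖h‖³, so the constants cancel.
  have hb : ∀ s ∈ Icc (0 : ℝ) 1, |-(third R (x + s • h) h h h / (2 * locNorm R (x + s • h) h)) /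
        locNorm R (x + s • h) h ^ 2| ≤ 1 := by
    intro s hs
    have hp := locNorm_pos hR hK hKb (hmem s hs) hh
    rw [abs_div, abs_neg, abs_div, abs_of_pos (by positivity : 0 < 2 * locNorm R (x + s • h) h),
      abs_of_pos (by positivity : 0 < locNorm R (x + s • h) h ^ 2), div_div,
      div_le_one (by positivity)]
    exact (abs_third_self_le_locNorm hR hK hKb (hmem s hs) h).trans (le_of_eq (by ring))
  have h1 := sub_le_sub_of_hasDerivAt_le hd (fun s _ => hasDerivAt_id s)
    (fun s hs => (abs_le.1 (hb s hs)).2)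
  have h2 := sub_le_sub_of_hasDerivAt_le (fun s _ => (hasDerivAt_id s).neg) hd
    (fun s hs => (abs_le.1 (hb s hs)).1)
  simp only [one_smul, zero_smul, add_zero, id] at h1 h2
  rw [abs_le]
  constructor <;> simp at h1 h2 <;> linarith

/-- Along the chord 1/‖h‖ loses at most 1, which is informative only while the initial norm is below
1. -/
theorem locNorm_add_le (hR : IsSelfConcordantBarrier K ν R) (hK : Convex ℝ K)
    (hKb : Bornology.IsBounded K) {x h : E n} (hx : x ∈ interior K) (hxh : x + h ∈ interior K)
    (h1 : locNorm R x h < 1) :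
    locNorm R (x + h) h ≤ locNorm R x h / (1 - locNorm R x h) := by
  rcases eq_or_ne h 0 with rfl | hh
  · simp [locNorm, hessForm]
  have hp := locNorm_pos hR hK hKb hx hh
  have hp' := locNorm_pos hR hK hKb hxh hh
  have h2 := (abs_le.1 (abs_inv_locNorm_sub_le hR hK hKb hx hxh hh)).1
  rw [le_div_iff₀ (by linarith)]
  have h3 : (locNorm R x h)⁻¹ - 1 ≤ (locNorm R (x + h) h)⁻¹ := by linarith
  have h4 := mul_le_mul_of_nonneg_left h3 (mul_pos hp hp').le
  field_simp at h4
  linarith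

theorem le_locNorm_add (hR : IsSelfConcordantBarrier K ν R) (hK : Convex ℝ K)
    (hKb : Bornology.IsBounded K) {x h : E n} (hx : x ∈ interior K) (hxh : x + h ∈ interior K) :
    locNorm R x h / (1 + locNorm R x h) ≤ locNorm R (x + h) h := by
  rcases eq_or_ne h 0 with rfl | hh
  · simp [locNorm, hessForm]
  have hp := locNorm_pos hR hK hKb hx hh
  have hp' := locNorm_pos hR hK hKb hxh hh
  have h2 := (abs_le.1 (abs_inv_locNorm_sub_le hR hK hKb hx hxh hh)).2
  rw [div_le_iff₀ (by linarith)]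
  have h3 : (locNorm R (x + h) h)⁻¹ ≤ (locNorm R x h)⁻¹ + 1 := by linarith
  have h4 := mul_le_mul_of_nonneg_left h3 (mul_pos hp hp').le
  field_simp at h4
  linarith

theorem locNorm_line_le (hR : IsSelfConcordantBarrier K ν R) (hK : Convex ℝ K)
    (hKb : Bornology.IsBounded K) {x h : E n} (hx : x ∈ interior K) {s : ℝ}
    (hs : s ∈ Icc (0 : ℝ) 1) (hxs : x + s • h ∈ interior K) (h1 : locNorm R x h < 1) :
    locNorm R (x + s • h) h ≤ locNorm R x h / (1 - locNorm R x h) := by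
  have hn := locNorm_nonneg (R := R) x h
  rcases eq_or_lt_of_le hs.1 with h0 | h0
  · rw [← h0, zero_smul, add_zero, le_div_iff₀ (by linarith)]
    nlinarith
  have h2 := locNorm_add_le hR hK hKb hx hxs (by
    rw [locNorm_smul _ _ hs.1]; nlinarith [hs.2])
  rw [locNorm_smul _ _ hs.1, locNorm_smul _ _ hs.1, mul_div_assoc] at h2
  have h3 := le_of_mul_le_mul_left h2 h0
  refine h3.trans ?_
  have : s * locNorm R x h ≤ locNorm R x h := by nlinarith [hs.2]
  gcongr

/-- The open Dikin ellipsoid is contained in the interior of `K`. -/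
theorem add_mem_interior_of_locNorm_lt_one (hR : IsSelfConcordantBarrier K ν R) (hK : Convex ℝ K)
    (hKb : Bornology.IsBounded K) {x h : E n} (hx : x ∈ interior K) (h1 : locNorm R x h < 1) :
    x + h ∈ interior K := by
  set c := locNorm R x h / (1 - locNorm R x h) with hc
  have hc0 : 0 ≤ c := div_nonneg (locNorm_nonneg _ _) (by linarith)
  -- Any finite bound on R along the chord would do. This one comes from integrating twice a second
  -- derivative that is at most c².
  refine mem_interior_of_bounded hR hK hx (R x + |inner ℝ (gradient R x) h| + c ^ 2) ?_
  intro s hs hxs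
  have hmem : ∀ t ∈ Icc (0 : ℝ) 1, x + t • s • h ∈ interior K :=
    fun t ht => add_smul_mem_interior hK hx hxs ht
  have hq : ∀ t ∈ Icc (0 : ℝ) 1, hessForm R (x + t • s • h) (s • h) ≤ c ^ 2 := by
    intro t ht
    rw [hessForm_smul, ← sq_locNorm hR hK hKb (hmem t ht)]
    have hts : t * s ∈ Icc (0 : ℝ) 1 := ⟨mul_nonneg ht.1 hs.1, mul_le_one₀ ht.2 hs.1 hs.2⟩
    have h2 := hmem t ht
    rw [smul_smul] at h2 ⊢
    have h3 := locNorm_line_le hR hK hKb hx hts h2 h1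
    rw [← mul_pow]
    have h4 := locNorm_nonneg (R := R) (x + (t * s) • h) h
    have h5 : s * locNorm R (x + (t * s) • h) h ≤ c := by nlinarith [hs.1, hs.2]
    exact pow_le_pow_left₀ (mul_nonneg hs.1 h4) h5 2
  have hg : ∀ t ∈ Icc (0 : ℝ) 1, inner ℝ (gradient R (x + t • s • h)) (s • h) ≤
      inner ℝ (gradient R x) (s • h) + c ^ 2 := by
    intro t ht
    have hd : ∀ r ∈ Icc (0 : ℝ) 1, HasDerivAt
        (fun r : ℝ => inner ℝ (gradient R (x + r • t • s • h)) (s • h))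
        (inner ℝ (hess R (x + r • t • s • h) (t • s • h)) (s • h)) r := fun r hr =>
      hasDerivAt_gradient_line hR (add_smul_mem_interior hK hx (hmem t ht) hr) _
    have h2 := sub_le_sub_of_hasDerivAt_le hd
      (fun r _ => (hasDerivAt_id r).const_mul (c ^ 2)) (fun r hr => by
        have hrt : r * t ∈ Icc (0 : ℝ) 1 := ⟨mul_nonneg hr.1 ht.1, mul_le_one₀ hr.2 ht.1 ht.2⟩
        have h3 := hq _ hrt
        have h4 : 0 ≤ hessForm R (x + (r * t) • s • h) (s • h) :=
          hessForm_nonneg hR hK hKb (hmem _ hrt) _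
        rw [hessForm, ← smul_smul] at h3 h4
        rw [map_smul, inner_smul_left, mul_one]
        simp only [conj_trivial]
        nlinarith [ht.1, ht.2])
    simp only [one_smul, zero_smul, add_zero, id, mul_one, mul_zero, sub_zero] at h2
    linarith
  have h2 := sub_le_sub_of_hasDerivAt_le
    (fun t ht => hasDerivAt_comp_line hR (hmem t ht))
    (fun t _ => (hasDerivAt_id t).const_mul (inner ℝ (gradient R x) (s • h) + c ^ 2))
    (fun t ht => (hg t ht).trans_eq (mul_one _).symm)
  simp only [one_smul, zero_smul, add_zero, id, mul_one, mul_zero, sub_zero] at h2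
  have h3 : inner ℝ (gradient R x) (s • h) ≤ |inner ℝ (gradient R x) h| := by
    rw [inner_smul_right]
    have h4 := le_abs_self (inner ℝ (gradient R x) h)
    have h5 := abs_nonneg (inner ℝ (gradient R x) h)
    nlinarith [hs.1, hs.2]
  linarith

/-- The closed Dikin ellipsoid is contained in `K`. -/
theorem add_mem_of_locNorm_le_one (hR : IsSelfConcordantBarrier K ν R) (hK : Convex ℝ K)
    (hKc : IsClosed K) (hKb : Bornology.IsBounded K) {x h : E n} (hx : x ∈ interior K)
    (h1 : locNorm R x h ≤ 1) : x + h ∈ K := by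
  have hlim : Tendsto (fun s : ℝ => x + s • h) (𝓝[<] 1) (𝓝 (x + (1 : ℝ) • h)) := by
    have : Continuous (fun s : ℝ => x + s • h) := by fun_prop
    exact (this.tendsto 1).mono_left nhdsWithin_le_nhds
  rw [one_smul] at hlim
  refine hKc.mem_of_tendsto hlim ?_
  filter_upwards [Ico_mem_nhdsLT (zero_lt_one : (0 : ℝ) < 1)] with s hs
  refine interior_subset (add_mem_interior_of_locNorm_lt_one hR hK hKb hx ?_)
  rw [locNorm_smul _ _ hs.1]
  have := locNorm_nonneg (R := R) x h
  nlinarith [hs.1, hs.2]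

/-- The local norm dominates the Euclidean norm divided by the diameter. -/
theorem norm_le_mul_locNorm (hR : IsSelfConcordantBarrier K ν R) (hK : Convex ℝ K)
    (hKc : IsClosed K) (hKb : Bornology.IsBounded K) {x : E n} (hx : x ∈ interior K) {d : ℝ}
    (hd : ∀ a ∈ K, ∀ b ∈ K, ‖a - b‖ ≤ d) (v : E n) : ‖v‖ ≤ d * locNorm R x v := by
  rcases eq_or_ne v 0 with rfl | hv
  · simp [locNorm, hessForm]
  have hp := locNorm_pos hR hK hKb hx hv
  have h1 := add_mem_of_locNorm_le_one hR hK hKc hKb hx (h := (locNorm R x v)⁻¹ • v) (by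
    rw [locNorm_smul _ _ (by positivity), inv_mul_cancel₀ hp.ne'])
  have h2 := hd _ h1 _ (interior_subset hx)
  rw [add_sub_cancel_left, norm_smul, norm_inv, Real.norm_eq_abs, abs_of_pos hp,
    inv_mul_le_iff₀ hp] at h2
  linarith

/-- Strong monotonicity of the gradient of a self-concordant function. -/
theorem le_inner_gradient_sub (hR : IsSelfConcordantBarrier K ν R) (hK : Convex ℝ K)
    (hKb : Bornology.IsBounded K) {x h : E n} (hx : x ∈ interior K) (hxh : x + h ∈ interior K) :
    locNorm R x h ^ 2 / (1 + locNorm R x h) ≤ inner ℝ (gradient R (x + h) - gradient R x) h := by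
  have hmem : ∀ t ∈ Icc (0 : ℝ) 1, x + t • h ∈ interior K :=
    fun t ht => add_smul_mem_interior hK hx hxh ht
  set r := locNorm R x h with hr
  have hr0 : 0 ≤ r := locNorm_nonneg _ _
  have hpos : ∀ s ∈ Icc (0 : ℝ) 1, 0 < 1 + s * r := fun s hs => by
    have := mul_nonneg hs.1 hr0; linarith
  -- The second derivative along the chord is at least r²/(1 + sr)², of which this function is an
  -- antiderivative.
  have h1 := sub_le_sub_of_hasDerivAt_le (f := fun s : ℝ => -r * (1 + s * r)⁻¹)
    (f' := fun s => r ^ 2 / (1 + s * r) ^ 2)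
    (fun s hs => by
      have := ((((hasDerivAt_id s).mul_const r).const_add 1).inv (hpos s hs).ne').const_mul (-r)
      refine this.congr_deriv ?_
      simp only [id]; ring)
    (fun s hs => hasDerivAt_gradient_line hR (hmem s hs) h) (fun s hs => by
      change _ ≤ hessForm R (x + s • h) h
      rw [← sq_locNorm hR hK hKb (hmem s hs), ← div_pow]
      refine pow_le_pow_left₀ (div_nonneg hr0 (hpos s hs).le) ?_ 2
      rcases eq_or_lt_of_le hs.1 with h0 | h0
      · rw [← h0]; simp [hr]
      have h2 := le_locNorm_add hR hK hKb hx (hmem s hs)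
      rw [locNorm_smul _ _ hs.1, locNorm_smul _ _ hs.1, mul_div_assoc] at h2
      exact le_of_mul_le_mul_left h2 h0)
  simp only [one_smul, zero_smul, add_zero, one_mul, zero_mul] at h1
  rw [inner_sub_left]
  refine le_trans (le_of_eq ?_) h1
  have : 1 + r ≠ 0 := by positivity
  field_simp
  ring

end Barrier

/-! ### Comparison of Hessians and growth of the barrier. -/

section Barrier

variable {n : ℕ} {K : Set (E n)} {ν : ℝ} {R : E n → ℝ}

/-- By the parallelogram identity the two squared norms are nonnegative and add up to 4. -/
theorem locNorm_le_two (hR : IsSelfConcordantBarrier K ν R) (hK : Convex ℝ K)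
    (hKb : Bornology.IsBounded K) {x : E n} (hx : x ∈ interior K) {v h : E n}
    (hv : locNorm R x v = 1) (hh : locNorm R x h = 1) :
    locNorm R x (v + h) ≤ 2 ∧ locNorm R x (v - h) ≤ 2 := by
  have h1 : hessForm R x (v + h) + hessForm R x (v - h) = 4 := by
    have hv2 := sq_locNorm hR hK hKb hx v
    have hh2 := sq_locNorm hR hK hKb hx h
    rw [hv] at hv2
    rw [hh] at hh2
    simp only [hessForm, map_add, map_sub, inner_add_left, inner_add_right, inner_sub_left,
      inner_sub_right] at hv2 hh2 ⊢
    linarith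
  have h2 := hessForm_nonneg hR hK hKb hx (v + h)
  have h3 := hessForm_nonneg hR hK hKb hx (v - h)
  constructor <;> rw [locNorm, Real.sqrt_le_iff] <;> constructor <;> linarith

/-- The third derivative of a self-concordant function as a trilinear form is bounded in the local
norm (with a constant that is not optimal). -/
theorem abs_third_le (hR : IsSelfConcordantBarrier K ν R) (hK : Convex ℝ K)
    (hKb : Bornology.IsBounded K) {x : E n} (hx : x ∈ interior K) {v h : E n}
    (hv0 : v ≠ 0) (hh0 : h ≠ 0) :
    |third R x h v v| ≤ 6 * locNorm R x h * locNorm R x v ^ 2 := by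
  -- the case of unit vectors, by polarization
  have unit : ∀ v h : E n, locNorm R x v = 1 → locNorm R x h = 1 → |third R x h v v| ≤ 6 := by
    intro v h hv hh
    -- The three cubic values are at most 16, 16 and 2 in absolute value, whence (16 + 16 + 2·2)/6 =
    -- 6.
    have hpol : third R x h v v = (third R x (v + h) (v + h) (v + h) -
        third R x (v - h) (v - h) (v - h) - 2 * third R x h h h) / 6 := by
      have e1 : third R x v h v = third R x h v v := third_comm_left hR hx v h v
      have e2 : third R x v v h = third R x h v v := by
        rw [third_comm_right hR hx, e1]
      have e3 : third R x h v h = third R x v h h := third_comm_left hR hx h v h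
      have e4 : third R x h h v = third R x v h h := by
        rw [third_comm_right hR hx, e3]
      simp only [third, map_add, map_sub, add_apply,
        sub_apply, inner_add_left, inner_add_right, inner_sub_left,
        inner_sub_right] at e1 e2 e3 e4 ⊢
      linarith
    obtain ⟨h1, h2⟩ := locNorm_le_two hR hK hKb hx hv hh
    have b1 := abs_third_self_le_locNorm hR hK hKb hx (v + h)
    have b2 := abs_third_self_le_locNorm hR hK hKb hx (v - h)
    have b3 := abs_third_self_le_locNorm hR hK hKb hx h
    have c1 := pow_le_pow_left₀ (locNorm_nonneg _ _) h1 3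
    have c2 := pow_le_pow_left₀ (locNorm_nonneg _ _) h2 3
    rw [hh] at b3
    rw [abs_le] at b1 b2 b3
    rw [hpol, abs_le]
    constructor <;> linarith [b1.1, b1.2, b2.1, b2.2, b3.1, b3.2]
  have hvp := locNorm_pos hR hK hKb hx hv0
  have hhp := locNorm_pos hR hK hKb hx hh0
  have h1 := unit ((locNorm R x v)⁻¹ • v) ((locNorm R x h)⁻¹ • h)
    (by rw [locNorm_smul _ _ (by positivity), inv_mul_cancel₀ hvp.ne'])
    (by rw [locNorm_smul _ _ (by positivity), inv_mul_cancel₀ hhp.ne'])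
  have h2 : third R x ((locNorm R x h)⁻¹ • h) ((locNorm R x v)⁻¹ • v) ((locNorm R x v)⁻¹ • v) =
      (locNorm R x h)⁻¹ * ((locNorm R x v)⁻¹ * ((locNorm R x v)⁻¹ * third R x h v v)) := by
    simp [third, inner_smul_left, inner_smul_right]
    ring
  rw [h2, abs_mul, abs_mul, abs_mul, abs_of_pos (inv_pos.2 hvp), abs_of_pos (inv_pos.2 hhp),
    inv_mul_le_iff₀ hhp, inv_mul_le_iff₀ hvp, inv_mul_le_iff₀ hvp] at h1
  linarith

/-- The Hessians of a self-concordant barrier at nearby points are comparable. -/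
theorem hessForm_add_comparable (hR : IsSelfConcordantBarrier K ν R) (hK : Convex ℝ K)
    (hKb : Bornology.IsBounded K) {x h : E n} (hx : x ∈ interior K)
    (hr : locNorm R x h ≤ 1 / 2) (v : E n) :
    hessForm R (x + h) v ≤ Real.exp (12 * locNorm R x h) * hessForm R x v ∧
      hessForm R x v ≤ Real.exp (12 * locNorm R x h) * hessForm R (x + h) v := by
  rcases eq_or_ne v 0 with rfl | hv
  · simp [hessForm]
  rcases eq_or_ne h 0 with rfl | hh
  · simp [locNorm, hessForm]
  have hxh := add_mem_interior_of_locNorm_lt_one hR hK hKb hx (h := h) (by linarith)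
  have hmem : ∀ t ∈ Icc (0 : ℝ) 1, x + t • h ∈ interior K :=
    fun t ht => add_smul_mem_interior hK hx hxh ht
  -- The logarithmic derivative of the form is at most 6 times the local norm of h at x + s h, and
  -- that norm has at most doubled since it started below 1/2; hence the rate 12.
  have hd : ∀ s ∈ Icc (0 : ℝ) 1, HasDerivAt (fun s : ℝ => Real.log (hessForm R (x + s • h) v))
      (third R (x + s • h) h v v / hessForm R (x + s • h) v) s := fun s hs =>
    (hasDerivAt_hess_line hR (hmem s hs) v v).log (hessForm_pos hR hK hKb (hmem s hs) hv).ne'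
  have hr0 := locNorm_nonneg (R := R) x h
  have hb : ∀ s ∈ Icc (0 : ℝ) 1, |third R (x + s • h) h v v / hessForm R (x + s • h) v| ≤
      12 * locNorm R x h := by
    intro s hs
    have hp := hessForm_pos hR hK hKb (hmem s hs) hv
    rw [abs_div, abs_of_pos hp, div_le_iff₀ hp]
    have h1 := abs_third_le hR hK hKb (hmem s hs) hv hh
    rw [sq_locNorm hR hK hKb (hmem s hs)] at h1
    have h2 := locNorm_line_le hR hK hKb hx hs (hmem s hs) (by linarith)
    have h3 : locNorm R x h / (1 - locNorm R x h) ≤ 2 * locNorm R x h := by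
      rw [div_le_iff₀ (by linarith)]
      nlinarith
    have h4 := mul_le_mul_of_nonneg_right (h2.trans h3) hp.le
    linarith
  have h1 := sub_le_sub_of_hasDerivAt_le hd
    (fun s _ => (hasDerivAt_id s).const_mul (12 * locNorm R x h))
    (fun s hs => (abs_le.1 (hb s hs)).2.trans_eq (mul_one _).symm)
  have h2 := sub_le_sub_of_hasDerivAt_le
    (fun s _ => (hasDerivAt_id s).const_mul (-(12 * locNorm R x h))) hd
    (fun s hs => (mul_one (-(12 * locNorm R x h))).le.trans (abs_le.1 (hb s hs)).1)
  simp only [one_smul, zero_smul, add_zero, id, mul_one, mul_zero, sub_zero] at h1 h2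
  have p0 := hessForm_pos hR hK hKb hx hv
  have p1 := hessForm_pos hR hK hKb hxh hv
  constructor
  · rw [← Real.log_le_log_iff p1 (by positivity), Real.log_mul (Real.exp_ne_zero _) p0.ne',
      Real.log_exp]
    linarith
  · rw [← Real.log_le_log_iff p0 (by positivity), Real.log_mul (Real.exp_ne_zero _) p1.ne',
      Real.log_exp]
    linarith

theorem sq_inner_gradient_le (hR : IsSelfConcordantBarrier K ν R) (hK : Convex ℝ K) (hν : 0 ≤ ν)
    (hKb : Bornology.IsBounded K) {x : E n} (hx : x ∈ interior K) (h : E n) :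
    inner ℝ (gradient R x) h ^ 2 ≤ ν * hessForm R x h := by
  have h1 := hR.first_le x hx h
  have hp := hessForm_nonneg hR hK hKb hx h
  rw [← Real.sqrt_eq_rpow] at h1
  change _ ≤ Real.sqrt ν * Real.sqrt |hessForm R x h| at h1
  rw [abs_of_nonneg hp, ← Real.sqrt_mul hν] at h1
  have h2 := pow_le_pow_left₀ (abs_nonneg _) h1 2
  rwa [sq_abs, Real.sq_sqrt (mul_nonneg hν hp)] at h2

/-- Riccati blow-up. If φ is the derivative of R along the chord, the barrier bound reads φ² ≤ νφ',
so 1/φ decreases at rate at least 1/ν. Were φ(0) > ν, then 1/φ would start below 1/ν and lose at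
least 1/ν over [0, 1], although monotonicity of the gradient keeps φ positive. -/
theorem inner_gradient_le_of_mem_interior (hR : IsSelfConcordantBarrier K ν R) (hK : Convex ℝ K)
    (hν : 0 ≤ ν) (hKb : Bornology.IsBounded K) {x h : E n} (hx : x ∈ interior K)
    (hxh : x + h ∈ interior K) : inner ℝ (gradient R x) h ≤ ν := by
  by_contra hlt
  push Not at hlt
  have hmem : ∀ t ∈ Icc (0 : ℝ) 1, x + t • h ∈ interior K :=
    fun t ht => add_smul_mem_interior hK hx hxh ht
  set a := inner ℝ (gradient R x) h with ha
  have ha0 : 0 < a := hν.trans_lt hlt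
  have hν0 : 0 < ν := by
    have h1 := sq_inner_gradient_le hR hK hν hKb hx h
    rcases eq_or_lt_of_le hν with h0 | h0
    · rw [← h0, zero_mul, ← ha] at h1
      nlinarith
    · exact h0
  have hge : ∀ s ∈ Icc (0 : ℝ) 1, a ≤ inner ℝ (gradient R (x + s • h)) h := by
    intro s hs
    rcases eq_or_lt_of_le hs.1 with h0 | h0
    · simp [← h0, ha]
    have h1 := le_inner_gradient_sub hR hK hKb hx (hmem s hs)
    have h2 : 0 ≤ locNorm R x (s • h) ^ 2 / (1 + locNorm R x (s • h)) := by
      have := locNorm_nonneg (R := R) x (s • h); positivity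
    have h3 := h2.trans h1
    rw [inner_smul_right, inner_sub_left] at h3
    have := nonneg_of_mul_nonneg_right h3 h0
    linarith
  have h1 := sub_le_sub_of_hasDerivAt_le (fun s _ => (hasDerivAt_id s).const_mul ν⁻¹)
    (fun s hs => ((hasDerivAt_gradient_line hR (hmem s hs) h).inv
      (ha0.trans_le (hge s hs)).ne').neg) (fun s hs => by
        have hp := ha0.trans_le (hge s hs)
        have h2 := sq_inner_gradient_le hR hK hν hKb (hmem s hs) h
        rw [mul_one, neg_div, neg_neg, le_div_iff₀ (by positivity), inv_mul_le_iff₀ hν0]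
        exact h2)
  have h2 : 0 < (inner ℝ (gradient R (x + (1 : ℝ) • h)) h)⁻¹ :=
    inv_pos.2 (ha0.trans_le (hge 1 ⟨zero_le_one, le_rfl⟩))
  simp only [Pi.neg_apply, Pi.inv_apply, zero_smul, add_zero, id, mul_one, mul_zero,
    sub_zero] at h1
  have h3 : a⁻¹ < ν⁻¹ := (inv_lt_inv₀ ha0 hν0).2 hlt
  rw [← ha] at h1
  linarith

theorem add_smul_mem_interior_of_lt_one (hK : Convex ℝ K) {x z : E n} (hx : x ∈ interior K)
    (hz : z ∈ K) {s : ℝ} (hs : s ∈ Ico (0 : ℝ) 1) : x + s • (z - x) ∈ interior K := by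
  rcases eq_or_lt_of_le hs.1 with h0 | h0
  · simpa [← h0] using hx
  · apply hK.openSegment_interior_self_subset_interior hx hz
    refine ⟨1 - s, s, by linarith [hs.2], h0, by ring, ?_⟩
    rw [smul_sub, sub_smul, one_smul]
    abel

theorem inner_gradient_le (hR : IsSelfConcordantBarrier K ν R) (hK : Convex ℝ K)
    (hν : 0 ≤ ν) (hKb : Bornology.IsBounded K) {x z : E n} (hx : x ∈ interior K)
    (hz : z ∈ K) : inner ℝ (gradient R x) (z - x) ≤ ν := by
  have hlim : Tendsto (fun s : ℝ => inner ℝ (gradient R x) (s • (z - x))) (𝓝[<] 1)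
      (𝓝 (inner ℝ (gradient R x) ((1 : ℝ) • (z - x)))) := by
    have : Continuous (fun s : ℝ => inner ℝ (gradient R x) (s • (z - x))) := by fun_prop
    exact (this.tendsto 1).mono_left nhdsWithin_le_nhds
  rw [one_smul] at hlim
  refine le_of_tendsto hlim ?_
  filter_upwards [Ico_mem_nhdsLT (zero_lt_one : (0 : ℝ) < 1)] with s hs
  exact inner_gradient_le_of_mem_interior hR hK hν hKb hx
    (add_smul_mem_interior_of_lt_one hK hx hz hs)

/-- Logarithmic growth of a `ν`-self-concordant barrier towards the boundary. -/
theorem barrier_le_add_log (hR : IsSelfConcordantBarrier K ν R) (hK : Convex ℝ K)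
    (hν : 0 ≤ ν) (hKb : Bornology.IsBounded K) {x z : E n} (hx : x ∈ interior K)
    (hz : z ∈ K) {s : ℝ} (hs : s ∈ Ico (0 : ℝ) 1) :
    R (x + s • (z - x)) ≤ R x - ν * Real.log (1 - s) := by
  have hmem : ∀ t ∈ Icc (0 : ℝ) 1, x + t • s • (z - x) ∈ interior K := fun t ht =>
    add_smul_mem_interior hK hx (add_smul_mem_interior_of_lt_one hK hx hz hs) ht
  have hpos : ∀ t ∈ Icc (0 : ℝ) 1, 0 < 1 - t * s := fun t ht => by
    have : t * s ≤ s := by nlinarith [ht.2, hs.1]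
    linarith [hs.2]
  have h1 := sub_le_sub_of_hasDerivAt_le (fun t ht => hasDerivAt_comp_line hR (hmem t ht))
    (fun t ht => ((((hasDerivAt_id t).mul_const s).const_sub 1).log (hpos t ht).ne').const_mul (-ν))
    (fun t ht => by
      have h2 := inner_gradient_le hR hK hν hKb (hmem t ht) hz
      -- The remaining vector to z is (1 - ts)(z - x), so the bound ν on its pairing with the
      -- gradient becomes the derivative νs/(1 - ts) of a logarithm.
      have h3 : z - (x + t • s • (z - x)) = (1 - t * s) • (z - x) := by
        rw [smul_smul, sub_smul, one_smul]; abel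
      rw [h3, inner_smul_right] at h2
      rw [inner_smul_right]
      simp only [one_mul, id]
      rw [neg_div, mul_neg, neg_mul, neg_neg, mul_div_assoc', le_div_iff₀ (hpos t ht)]
      nlinarith [hs.1])
  simp only [one_smul, zero_smul, add_zero, id, one_mul, zero_mul, sub_zero, Real.log_one,
    mul_zero] at h1
  linarith

end Barrier

/-! ### Positive inverse square roots. -/

section InvSqrt

variable {n : ℕ} {A M : E n →L[ℝ] E n}

theorem comp_eq_id_comm {f g : E n →L[ℝ] E n} (h : f ∘L g = ContinuousLinearMap.id ℝ (E n)) :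
    g ∘L f = ContinuousLinearMap.id ℝ (E n) := by
  have h1 : f.toLinearMap * g.toLinearMap = 1 := by
    ext1 v
    exact congrArg (fun L : E n →L[ℝ] E n => L v) h
  have h2 := mul_eq_one_comm.1 h1
  ext1 v
  exact congrArg (fun L : E n →ₗ[ℝ] E n => L v) h2

theorem inverse_eq_of_comp_eq_id {f g : E n →L[ℝ] E n}
    (h : f ∘L g = ContinuousLinearMap.id ℝ (E n)) : f.inverse = g :=
  ContinuousLinearMap.inverse_eq h (comp_eq_id_comm h)

theorem IsInvSqrt.inverse_eq (h : IsInvSqrt A M) : A.inverse = A ∘L M :=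
  inverse_eq_of_comp_eq_id (by rw [← ContinuousLinearMap.comp_assoc]; exact h.2)

theorem IsInvSqrt.apply_inverse (h : IsInvSqrt A M) (v : E n) : A (A.inverse v) = v := by
  rw [h.inverse_eq]
  exact congrArg (fun L : E n →L[ℝ] E n => L v) h.2

theorem IsInvSqrt.inverse_apply (h : IsInvSqrt A M) (v : E n) : A.inverse (A v) = v := by
  have h1 : A ∘L A.inverse = ContinuousLinearMap.id ℝ (E n) := by
    ext1 w; exact h.apply_inverse w
  exact congrArg (fun L : E n →L[ℝ] E n => L v) (comp_eq_id_comm h1)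

theorem IsInvSqrt.inner_left (h : IsInvSqrt A M) (v w : E n) :
    inner ℝ (A v) w = inner ℝ v (A w) := h.1.isSymmetric v w

theorem IsInvSqrt.inner_inverse_left (h : IsInvSqrt A M) (v w : E n) :
    inner ℝ (A.inverse v) w = inner ℝ v (A.inverse w) := by
  conv_lhs => rw [← h.apply_inverse w, ← h.inner_left, h.apply_inverse]

theorem IsInvSqrt.norm_inverse_sq (h : IsInvSqrt A M) (v : E n) :
    ‖A.inverse v‖ ^ 2 = inner ℝ (M v) v := by
  have h1 : A (M v) = A.inverse v := by rw [h.inverse_eq]; rfl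
  rw [← real_inner_self_eq_norm_sq]
  nth_rewrite 2 [← h1]
  rw [← h.inner_left, h.apply_inverse, real_inner_comm]

theorem IsInvSqrt.inner_apply_apply (h : IsInvSqrt A M) (v : E n) :
    inner ℝ (M (A v)) (A v) = ‖v‖ ^ 2 := by
  rw [← h.norm_inverse_sq, h.inverse_apply]

/-- The positive inverse square root is unique. -/
theorem IsInvSqrt.unique {A' : E n →L[ℝ] E n} (h : IsInvSqrt A M) (h' : IsInvSqrt A' M) :
    A = A' := by
  have hsq : ∀ v, A (A v) = A' (A' v) := by
    have e1 := comp_eq_id_comm h.2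
    have : A ∘L A = A' ∘L A' := by
      calc A ∘L A = (A' ∘L A') ∘L M ∘L (A ∘L A) := by
            rw [← ContinuousLinearMap.comp_assoc, h'.2, ContinuousLinearMap.id_comp]
        _ = A' ∘L A' := by rw [e1, ContinuousLinearMap.comp_id]
    exact fun v => congrArg (fun L : E n →L[ℝ] E n => L v) this
  -- Both squares invert M, hence coincide. If A b = λb with λ > 0, then w = A'b - λb satisfies A'w
  -- = -λw, and positivity of A' forces w = 0. It remains to run b through an eigenbasis of A.
  have hsym : A.toLinearMap.IsSymmetric := h.1.isSymmetric
  have hn : Module.finrank ℝ (E n) = n := by simp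
  set b := hsym.eigenvectorBasis hn with hb
  have key : ∀ i, A (b i) = A' (b i) := by
    intro i
    set lam : ℝ := hsym.eigenvalues hn i with hlam
    have h1 : A (b i) = lam • b i := hsym.apply_eigenvectorBasis hn i
    have hbi : b i ≠ 0 := fun h0 => by
      have := b.norm_eq_one i
      rw [h0, norm_zero] at this
      exact zero_ne_one this
    have hlam0 : 0 ≤ lam := by
      have h2 := h.1.inner_nonneg_left (b i)
      rw [h1, inner_smul_left, real_inner_self_eq_norm_sq, b.norm_eq_one] at h2
      simpa using h2
    have hlam1 : lam ≠ 0 := fun h0 => by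
      rw [h0, zero_smul] at h1
      have := h.inverse_apply (b i)
      rw [h1, map_zero] at this
      exact hbi this.symm
    have hlamp : 0 < lam := lt_of_le_of_ne hlam0 hlam1.symm
    set w := A' (b i) - lam • b i with hw
    have h2 : A' w = -lam • w := by
      have h3 := hsq (b i)
      rw [h1, map_smul, h1] at h3
      rw [hw, map_sub, map_smul, ← h3, smul_sub]
      module
    have h3 := h'.1.inner_nonneg_left w
    rw [h2, inner_smul_left, real_inner_self_eq_norm_sq] at h3
    simp only [conj_trivial] at h3
    have h4 : w = 0 := by
      by_contra h0
      have : 0 < ‖w‖ ^ 2 := by have := norm_pos_iff.2 h0; positivity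
      nlinarith
    rw [h1]
    exact (sub_eq_zero.1 h4).symm
  ext1 v
  have : A.toLinearMap = A'.toLinearMap := b.toBasis.ext (fun i => by simpa using key i)
  exact congrArg (fun L : E n →ₗ[ℝ] E n => L v) this

end InvSqrt

/-! ### Pathwise analysis: optimality conditions and feasibility of the plays. -/

/-- The deterministic standing assumptions on a single trajectory of the algorithm. -/
structure BoundedRun {n : ℕ} (K : Set (E n)) (ν : ℝ) (R : E n → ℝ) (σ η B : ℝ) (H T : ℕ)
    (F : ℕ → Hist n H → ℝ) (u : ℕ → UnitSphere n)
    (x : ℕ → E n) (A : ℕ → E n →L[ℝ] E n) (y g : ℕ → E n) : Prop where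
  convex : Convex ℝ K
  closed : IsClosed K
  bounded : Bornology.IsBounded K
  barrier : IsSelfConcordantBarrier K ν R
  sigma_pos : 0 < σ
  eta_pos : 0 < η
  B_pos : 0 < B
  one_le_H : 1 ≤ H
  H_le_T : H ≤ T
  run : IsRun K R σ η H T F u x A y g
  loss_nonneg : ∀ t ∈ Finset.Icc H T, ∀ w ∈ histSet K H, 0 ≤ F t w
  loss_le : ∀ t ∈ Finset.Icc H T, ∀ w ∈ histSet K H, F t w ≤ B
  sigma_diam : ∀ a ∈ K, ∀ b ∈ K, σ * ‖a - b‖ ^ 2 ≤ 8 * B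

/-- The upper bound on the local norm of the step `x_{t+1} - x_t`. -/
def stepBound (n : ℕ) (η B : ℝ) (H t : ℕ) : ℝ :=
  2 * (2 * (η * n * B * H) + Real.sqrt (8 * B * η / ((t + 1 - H : ℕ) : ℝ)))

theorem isLocalMin_of_isMinOn_interior {n : ℕ} {K : Set (E n)} {f : E n → ℝ} {x : E n}
    (hx : x ∈ interior K) (h : IsMinOn f (interior K) x) : IsLocalMin f x :=
  h.isLocalMin (isOpen_interior.mem_nhds hx)

section Stationarity

variable {n : ℕ} {K : Set (E n)} {ν : ℝ} {R : E n → ℝ}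

/-- First-order optimality for regularized quadratic objectives. -/
theorem stationary_of_isMinOn (hR : IsSelfConcordantBarrier K ν R) {ι : Type*} (S : Finset ι)
    (a p : ι → E n) (σ c : ℝ) {x : E n} (hx : x ∈ interior K)
    (hmin : IsMinOn (fun z => ∑ s ∈ S, (inner ℝ (a s) z + σ / 2 * ‖z - p s‖ ^ 2) + c * R z)
      (interior K) x) (h : E n) :
    ∑ s ∈ S, (inner ℝ (a s) h + σ * inner ℝ (x - p s) h) + c * inner ℝ (gradient R x) h = 0 := by
  have hloc := isLocalMin_of_isMinOn_interior hx hmin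
  have hx0 : x + (0 : ℝ) • h ∈ interior K := by simpa using hx
  have hd : HasDerivAt (fun s : ℝ => ∑ i ∈ S, (inner ℝ (a i) (x + s • h) +
      σ / 2 * ‖x + s • h - p i‖ ^ 2) + c * R (x + s • h))
      (∑ s ∈ S, (inner ℝ (a s) h + σ * inner ℝ (x - p s) h) + c * inner ℝ (gradient R x) h) 0 := by
    have h1 := (hasDerivAt_comp_line hR hx0).const_mul c
    rw [zero_smul, add_zero] at h1
    refine HasDerivAt.add (HasDerivAt.fun_sum fun i _ => HasDerivAt.add ?_ ?_) h1
    · simpa using (hasDerivAt_const (0 : ℝ) (a i)).inner ℝ (hasDerivAt_line x h 0)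
    · have h2 := ((hasDerivAt_line x h 0).sub_const (p i)).norm_sq.const_mul (σ / 2)
      refine h2.congr_deriv ?_
      rw [zero_smul, add_zero]
      ring
  have hloc' : IsLocalMin (fun s : ℝ => ∑ i ∈ S, (inner ℝ (a i) (x + s • h) +
      σ / 2 * ‖x + s • h - p i‖ ^ 2) + c * R (x + s • h)) 0 := by
    have hc : ContinuousAt (fun s : ℝ => x + s • h) 0 := by fun_prop
    have hc' := hc.tendsto
    simp only [zero_smul, add_zero] at hc'
    filter_upwards [hc'.eventually hloc] with s hs
    simpa only [zero_smul, add_zero] using hs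
  exact hloc'.hasDerivAt_eq_zero hd

/-- Strict monotonicity of ∇R + c·id. The injectivity serves twice: it makes the initial iterates
coincide across rounds and outcomes, and it lets later iterates be recovered measurably from their
optimality conditions. -/
theorem eq_of_gradient_add_eq (hR : IsSelfConcordantBarrier K ν R) (hK : Convex ℝ K)
    (hKb : Bornology.IsBounded K) {x y : E n} {c : ℝ} (hc : 0 ≤ c) (hx : x ∈ interior K)
    (hy : y ∈ interior K) (h : gradient R x + c • x = gradient R y + c • y) : x = y := by
  by_contra hne
  have h0 : y - x ≠ 0 := sub_ne_zero.2 (Ne.symm hne)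
  have h1 := le_inner_gradient_sub hR hK hKb hx (h := y - x) (by simpa using hy)
  have h2 := locNorm_pos hR hK hKb hx h0
  have h3 : 0 < locNorm R x (y - x) ^ 2 / (1 + locNorm R x (y - x)) := by positivity
  have h4 : gradient R (x + (y - x)) - gradient R x = -(c • (y - x)) := by
    rw [add_sub_cancel, smul_sub, sub_eq_iff_eq_add]
    rw [← sub_eq_iff_eq_add] at h
    rw [← h]; abel
  rw [h4, inner_neg_left, inner_smul_left, real_inner_self_eq_norm_sq] at h1
  simp only [conj_trivial] at h1
  have : 0 ≤ c * ‖y - x‖ ^ 2 := by positivity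
  linarith

/-- The Hessian form at Au and c‖Au‖² are nonnegative and add up to ‖u‖² = 1. The first being at
most 1 puts the play in the closed Dikin ellipsoid; the second bounds the exploration radius. -/
theorem play_mem (hR : IsSelfConcordantBarrier K ν R) (hK : Convex ℝ K) (hKc : IsClosed K)
    (hKb : Bornology.IsBounded K) {x : E n} (hx : x ∈ interior K) {A : E n →L[ℝ] E n} {c : ℝ}
    (hc : 0 ≤ c) (hA : IsInvSqrt A (hess R x + c • ContinuousLinearMap.id ℝ (E n)))
    {u : E n} (hu : ‖u‖ = 1) : x + A u ∈ K ∧ c * ‖A u‖ ^ 2 ≤ 1 := by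
  have h1 := hA.inner_apply_apply u
  rw [hu] at h1
  simp only [add_apply, smul_apply, ContinuousLinearMap.id_apply, inner_add_left,
    inner_smul_left, real_inner_self_eq_norm_sq, conj_trivial] at h1
  have h2 : 0 ≤ hessForm R x (A u) := hessForm_nonneg hR hK hKb hx _
  have h3 : 0 ≤ c * ‖A u‖ ^ 2 := by positivity
  change hessForm R x (A u) + _ = _ at h1
  refine ⟨add_mem_of_locNorm_le_one hR hK hKc hKb hx ?_, by linarith⟩
  rw [locNorm, Real.sqrt_le_left zero_le_one]
  linarith

end Stationarity

namespace BoundedRun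

variable {n : ℕ} {K : Set (E n)} {ν : ℝ} {R : E n → ℝ} {σ η B : ℝ} {H T : ℕ}
  {F : ℕ → Hist n H → ℝ} {u : ℕ → UnitSphere n}
  {x : ℕ → E n} {A : ℕ → E n →L[ℝ] E n} {y g : ℕ → E n}

theorem mem_interior (hr : BoundedRun K ν R σ η B H T F u x A y g) {t : ℕ} (h1 : 1 ≤ t)
    (ht : t ≤ T) : x t ∈ interior K := by
  rcases le_or_gt t H with h | h
  · exact (hr.run.init t (Finset.mem_Icc.2 ⟨h1, h⟩)).1
  · have := (hr.run.update (t - 1) (Finset.mem_Ico.2 ⟨by omega, by omega⟩)).1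
    rwa [Nat.sub_add_cancel h1] at this

theorem gradient_init (hr : BoundedRun K ν R σ η B H T F u x A y g) {t : ℕ} (h1 : 1 ≤ t)
    (ht : t ≤ H) : gradient R (x t) = 0 := by
  obtain ⟨h2, h3⟩ := hr.run.init t (Finset.mem_Icc.2 ⟨h1, ht⟩)
  have := isLocalMin_of_isMinOn_interior h2 h3
  rw [gradient, this.fderiv_eq_zero, map_zero]

theorem eq_init (hr : BoundedRun K ν R σ η B H T F u x A y g) {t : ℕ} (h1 : 1 ≤ t)
    (ht : t ≤ H) : x t = x H := by
  have hH := hr.one_le_H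
  have hHT := hr.H_le_T
  refine eq_of_gradient_add_eq hr.barrier hr.convex hr.bounded le_rfl
    (hr.mem_interior h1 (ht.trans hr.H_le_T)) (hr.mem_interior hH hHT) ?_
  rw [hr.gradient_init h1 ht, hr.gradient_init hH le_rfl]
  simp

/-- Only the gradients g_1, …, g_{t-H} occur. At t = H the sum is empty and what remains is the
criticality of x_H for R. -/
theorem stationary (hr : BoundedRun K ν R σ η B H T F u x A y g) {t : ℕ} (h1 : H ≤ t)
    (ht : t ≤ T) (h : E n) :
    ∑ s ∈ Finset.Ico H t, (inner ℝ (g (s + 1 - H)) h + σ * inner ℝ (x t - x (s + 1 - H)) h) +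
      1 / η * inner ℝ (gradient R (x t)) h = 0 := by
  rcases eq_or_lt_of_le h1 with h0 | h0
  · subst h0
    rw [hr.gradient_init hr.one_le_H le_rfl]
    simp
  · obtain ⟨h2, h3⟩ := hr.run.update (t - 1) (Finset.mem_Ico.2 ⟨by omega, by omega⟩)
    have e1 : t - 1 + 1 = t := by omega
    have e2 : Finset.Icc H (t - 1) = Finset.Ico H t := by ext s; simp; omega
    rw [e1] at h2 h3
    rw [e2] at h3
    exact stationary_of_isMinOn hr.barrier _ (fun s => g (s + 1 - H)) (fun s => x (s + 1 - H))
      σ (1 / η) h2 h3 h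

theorem isInvSqrt (hr : BoundedRun K ν R σ η B H T F u x A y g) {t : ℕ} (h1 : 1 ≤ t)
    (ht : t ≤ T) :
    IsInvSqrt (A t) (hess R (x t) + (η * σ * t) • ContinuousLinearMap.id ℝ (E n)) :=
  hr.run.explore t (Finset.mem_Icc.2 ⟨h1, ht.trans (le_max_right _ _)⟩)

theorem norm_inverse_sq (hr : BoundedRun K ν R σ η B H T F u x A y g) {t : ℕ} (h1 : 1 ≤ t)
    (ht : t ≤ T) (v : E n) :
    ‖(A t).inverse v‖ ^ 2 = hessForm R (x t) v + η * σ * t * ‖v‖ ^ 2 := by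
  rw [(hr.isInvSqrt h1 ht).norm_inverse_sq]
  simp only [add_apply, smul_apply, ContinuousLinearMap.id_apply, inner_add_left,
    inner_smul_left, real_inner_self_eq_norm_sq, conj_trivial]
  rfl

theorem play_mem (hr : BoundedRun K ν R σ η B H T F u x A y g) {t : ℕ} (h1 : 1 ≤ t)
    (ht : t ≤ T) {v : E n} (hv : ‖v‖ = 1) :
    x t + A t v ∈ K ∧ η * σ * t * ‖A t v‖ ^ 2 ≤ 1 := by
  have := hr.sigma_pos
  have := hr.eta_pos
  exact EBCO.play_mem hr.barrier hr.convex hr.closed hr.bounded (hr.mem_interior h1 ht)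
    (by positivity) (hr.isInvSqrt h1 ht) hv

theorem window_mem (hr : BoundedRun K ν R σ η B H T F u x A y g) {t : ℕ} (h1 : H ≤ t)
    (ht : t ≤ T) : window H y t ∈ histSet K H := by
  intro j
  have hj := j.2
  have h2 : t + 1 - H + (j : ℕ) ≤ T := by omega
  have h3 : 1 ≤ t + 1 - H + (j : ℕ) := by omega
  change y (t + 1 - H + (j : ℕ)) ∈ K
  rw [hr.run.play _ (Finset.mem_Icc.2 ⟨h3, h2.trans (le_max_right _ _)⟩)]
  exact (hr.play_mem h3 h2 (by simp)).1

/-- Self-adjointness moves A⁻¹ from the noise onto v, so the noise enters only through its unit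
length and the estimator is measured in the norms ‖A⁻¹v‖ in which the steps are small. -/
theorem abs_inner_grad_le (hr : BoundedRun K ν R σ η B H T F u x A y g) {t : ℕ} (h1 : H ≤ t)
    (ht : t ≤ T) (v : E n) {C : ℝ} (hC : ∀ i < H, ‖(A (t - i)).inverse v‖ ≤ C) :
    |inner ℝ (g t) v| ≤ n * B * H * C := by
  rw [hr.run.grad t (Finset.mem_Icc.2 ⟨h1, ht⟩), inner_smul_left, sum_inner]
  simp only [conj_trivial]
  have hF0 := hr.loss_nonneg t (Finset.mem_Icc.2 ⟨h1, ht⟩) _ (hr.window_mem h1 ht)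
  have hFB := hr.loss_le t (Finset.mem_Icc.2 ⟨h1, ht⟩) _ (hr.window_mem h1 ht)
  have hB := hr.B_pos
  have h2 : |∑ i ∈ Finset.range H, inner ℝ ((A (t - i)).inverse (u (t - i) : E n)) v| ≤ H * C := by
    refine (Finset.abs_sum_le_sum_abs _ _).trans ?_
    have : ∀ i ∈ Finset.range H, |inner ℝ ((A (t - i)).inverse (u (t - i) : E n)) v| ≤ C := by
      intro i hi
      have hi' := Finset.mem_range.1 hi
      rw [(hr.isInvSqrt (by omega) (by omega)).inner_inverse_left]
      refine (abs_real_inner_le_norm _ _).trans ?_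
      have : ‖(u (t - i) : E n)‖ = 1 := by simp
      rw [this, one_mul]
      exact hC i hi'
    refine (Finset.sum_le_sum this).trans ?_
    simp
  rw [abs_mul, abs_of_nonneg (by positivity : 0 ≤ (n : ℝ) * F t (window H y t)), mul_assoc,
    mul_assoc, mul_assoc]
  have hHC : 0 ≤ H * C := (abs_nonneg _).trans h2
  gcongr

end BoundedRun

theorem stepBound_nonneg {n : ℕ} {η B : ℝ} (hη : 0 ≤ η) (hB : 0 ≤ B) (H t : ℕ) :
    0 ≤ stepBound n η B H t := by
  unfold stepBound; positivity

/-- The number t + 1 - H of active proximal terms is 1 at t = H and grows afterwards. In earlier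
rounds truncated subtraction makes it 0, and division by zero makes the root vanish. -/
theorem stepBound_le {n : ℕ} {η B : ℝ} (hη : 0 ≤ η) (hB : 0 ≤ B) (H t : ℕ) :
    stepBound n η B H t ≤ stepBound n η B H H := by
  unfold stepBound
  have : Real.sqrt (8 * B * η / ((t + 1 - H : ℕ) : ℝ)) ≤
      Real.sqrt (8 * B * η / ((H + 1 - H : ℕ) : ℝ)) := by
    apply Real.sqrt_le_sqrt
    rw [Nat.add_sub_cancel_left, Nat.cast_one, div_one]
    rcases Nat.eq_zero_or_pos (t + 1 - H) with h | h
    · rw [h]; simp; positivity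
    · exact div_le_self (by positivity) (by exact_mod_cast h)
  linarith

/-! ### Stability of the iterates in the local norms. -/

namespace BoundedRun

variable {n : ℕ} {K : Set (E n)} {ν : ℝ} {R : E n → ℝ} {σ η B : ℝ} {H T : ℕ}
  {F : ℕ → Hist n H → ℝ} {u : ℕ → UnitSphere n}
  {x : ℕ → E n} {A : ℕ → E n →L[ℝ] E n} {y g : ℕ → E n}

/-- The squared norm attached to the regularized objective that defines `x_{t+1}`, at `x_t`. -/
def proxForm {n : ℕ} (R : E n → ℝ) (σ η : ℝ) (H : ℕ) (x : ℕ → E n) (t : ℕ) (v : E n) : ℝ :=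
  hessForm R (x t) v + η * σ * ((t + 1 - H : ℕ) : ℝ) * ‖v‖ ^ 2

theorem hessForm_nonneg (hr : BoundedRun K ν R σ η B H T F u x A y g) {t : ℕ} (h1 : 1 ≤ t)
    (ht : t ≤ T) (v : E n) : 0 ≤ hessForm R (x t) v :=
  EBCO.hessForm_nonneg hr.barrier hr.convex hr.bounded (hr.mem_interior h1 ht) v

theorem hessForm_le_proxForm (hr : BoundedRun K ν R σ η B H T F u x A y g) (t : ℕ) (v : E n) :
    hessForm R (x t) v ≤ proxForm R σ η H x t v := by
  have := hr.sigma_pos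
  have := hr.eta_pos
  have : 0 ≤ η * σ * ((t + 1 - H : ℕ) : ℝ) * ‖v‖ ^ 2 := by positivity
  unfold proxForm; linarith

theorem proxForm_nonneg (hr : BoundedRun K ν R σ η B H T F u x A y g) {t : ℕ} (h1 : 1 ≤ t)
    (ht : t ≤ T) (v : E n) : 0 ≤ proxForm R σ η H x t v :=
  (hr.hessForm_nonneg h1 ht v).trans (hr.hessForm_le_proxForm t v)

/-- Each step costs a factor exp(12ρ) in either direction, and the factors multiply. -/
theorem hessForm_chain (hr : BoundedRun K ν R σ η B H T F u x A y g) {ρ : ℝ}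
    (hρ2 : ρ ≤ 1 / 2) {a : ℕ} (ha : 1 ≤ a) (v : E n) (m : ℕ) (hm : a + m ≤ T)
    (hs : ∀ s, a ≤ s → s < a + m → locNorm R (x s) (x (s + 1) - x s) ≤ ρ) :
    hessForm R (x a) v ≤ Real.exp (12 * ρ * m) * hessForm R (x (a + m)) v ∧
      hessForm R (x (a + m)) v ≤ Real.exp (12 * ρ * m) * hessForm R (x a) v := by
  induction m with
  | zero => simp
  | succ m ih =>
    obtain ⟨h1, h2⟩ := ih (by omega) (fun s hs1 hs2 => hs s hs1 (by omega))
    have h3 := hs (a + m) (by omega) (by omega)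
    obtain ⟨h4, h5⟩ := hessForm_add_comparable hr.barrier hr.convex hr.bounded
      (hr.mem_interior (t := a + m) (by omega) (by omega)) (h3.trans hρ2) v
    rw [add_sub_cancel] at h4 h5
    have h6 : Real.exp (12 * locNorm R (x (a + m)) (x (a + m + 1) - x (a + m))) ≤
        Real.exp (12 * ρ) := Real.exp_le_exp.2 (by linarith)
    have h7 : Real.exp (12 * ρ * ((m + 1 : ℕ) : ℝ)) =
        Real.exp (12 * ρ * m) * Real.exp (12 * ρ) := by
      rw [← Real.exp_add]; congr 1; push_cast; ring
    have p1 := hr.hessForm_nonneg (t := a + m) (by omega) (by omega) v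
    have p2 := hr.hessForm_nonneg (t := a + m + 1) (by omega) (by omega) v
    rw [h7, ← add_assoc]
    constructor
    · refine h1.trans ?_
      rw [mul_assoc (Real.exp _)]
      exact mul_le_mul_of_nonneg_left (h5.trans (mul_le_mul_of_nonneg_right h6 p2))
        (Real.exp_nonneg _)
    · refine (h4.trans (mul_le_mul_of_nonneg_right h6 p1)).trans ?_
      rw [mul_comm (Real.exp (12 * ρ * m)), mul_assoc (Real.exp _)]
      exact mul_le_mul_of_nonneg_left h2 (Real.exp_nonneg _)

/-- Comparison of the Hessians at iterates which are at most `2 H` steps apart. -/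
theorem hessForm_le_four (hr : BoundedRun K ν R σ η B H T F u x A y g) {p s : ℕ} (hp : 1 ≤ p)
    (hpT : p ≤ T) (hs : 1 ≤ s) (hsT : s ≤ T) (h1 : p ≤ s + 2 * H) (h2 : s ≤ p + 2 * H)
    (hstep : ∀ r, min p s ≤ r → r < max p s →
      locNorm R (x r) (x (r + 1) - x r) ≤ 1 / (24 * H)) (v : E n) :
    hessForm R (x p) v ≤ 4 * hessForm R (x s) v := by
  have hH : (1 : ℝ) ≤ H := by exact_mod_cast hr.one_le_H
  have hρ : (1 : ℝ) / (24 * H) ≤ 1 / 2 := by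
    rw [div_le_div_iff₀ (by positivity) (by norm_num)]; linarith
  -- With steps of size 1/(24H), a path of at most 2H steps has total exponent at most 1, and e < 4.
  have hexp : ∀ m : ℕ, m ≤ 2 * H → Real.exp (12 * (1 / (24 * H)) * m) ≤ 4 := by
    intro m hm
    have hm' : (m : ℝ) ≤ 2 * H := by exact_mod_cast hm
    have : 12 * (1 / (24 * (H : ℝ))) * m ≤ 1 := by
      rw [mul_one_div, div_mul_eq_mul_div, div_le_one (by positivity)]; linarith
    have h3 := Real.exp_le_exp.2 this
    linarith [Real.exp_one_lt_d9]
  have hv := hr.hessForm_nonneg hs hsT v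
  rcases le_total p s with hps | hps
  · obtain ⟨m, rfl⟩ := Nat.exists_eq_add_of_le hps
    refine (hr.hessForm_chain hρ hp v m hsT fun r h3 h4 => hstep r ?_ ?_).1.trans
      (mul_le_mul_of_nonneg_right (hexp m (by omega)) hv) <;> omega
  · obtain ⟨m, rfl⟩ := Nat.exists_eq_add_of_le hps
    refine (hr.hessForm_chain hρ hs v m hpT fun r h3 h4 => hstep r ?_ ?_).2.trans
      (mul_le_mul_of_nonneg_right (hexp m (by omega)) hv) <;> omega

/-- The left side squared is the Hessian form at x_p plus ησp‖v‖², whereas the proximal form at x_s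
carries only s + 1 - H. The factor 4 from the Hessian comparison becomes 2 under the root, and c²
pays for the mismatch of the two counters. -/
theorem norm_inverse_le (hr : BoundedRun K ν R σ η B H T F u x A y g) {p s : ℕ} (hp : 1 ≤ p)
    (hpT : p ≤ T) (hs : 1 ≤ s) (hsT : s ≤ T) (h1 : p ≤ s + 2 * H) (h2 : s ≤ p + 2 * H)
    (hstep : ∀ r, min p s ≤ r → r < max p s →
      locNorm R (x r) (x (r + 1) - x r) ≤ 1 / (24 * H)) {c : ℝ} (hc : 1 ≤ c)
    (hpc : p ≤ c ^ 2 * ((s + 1 - H : ℕ) : ℝ)) (v : E n) :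
    ‖(A p).inverse v‖ ≤ 2 * c * Real.sqrt (proxForm R σ η H x s v) := by
  have hσ := hr.sigma_pos
  have hη := hr.eta_pos
  refine abs_le_of_sq_le_sq' ?_ (by positivity) |>.2
  rw [hr.norm_inverse_sq hp hpT, mul_pow, Real.sq_sqrt (hr.proxForm_nonneg hs hsT v), proxForm]
  have h3 := hr.hessForm_le_four hp hpT hs hsT h1 h2 hstep v
  have h4 := hr.hessForm_nonneg hs hsT v
  have h5 : 0 ≤ η * σ * ‖v‖ ^ 2 := by positivity
  have h6 := mul_le_mul_of_nonneg_left hpc h5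
  have h7 : 0 ≤ η * σ * ‖v‖ ^ 2 * (c ^ 2 * ((s + 1 - H : ℕ) : ℝ)) := by positivity
  have h8 : 1 ≤ c ^ 2 := one_le_pow₀ hc
  nlinarith [mul_le_mul_of_nonneg_right h8 h4]

/-- The difference of the optimality conditions of two consecutive iterates. -/
theorem optimality_sub (hr : BoundedRun K ν R σ η B H T F u x A y g) {t : ℕ} (h1 : H ≤ t)
    (ht : t < T) {h : E n} (hh : h = x (t + 1) - x t) {k : ℕ} (hk : k = t + 1 - H) :
    inner ℝ (gradient R (x (t + 1)) - gradient R (x t)) h + η * σ * k * ‖h‖ ^ 2 =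
      -(η * inner ℝ (g k) h) - η * σ * inner ℝ (x t - x k) h := by
  have hη := hr.eta_pos
  have e1 := hr.stationary h1 ht.le h
  have e2 := hr.stationary (t := t + 1) (by omega) ht h
  rw [Finset.sum_Ico_succ_top h1, ← hk] at e2
  -- Passing from x_t to x_{t+1} adds σ‖h‖² in each of the k - 1 old proximal terms; the new term,
  -- anchored at x_k, supplies the last one and so the coefficient k.
  have e3 : ∑ s ∈ Finset.Ico H t, (inner ℝ (g (s + 1 - H)) h +
      σ * inner ℝ (x (t + 1) - x (s + 1 - H)) h) =
      ∑ s ∈ Finset.Ico H t, (inner ℝ (g (s + 1 - H)) h + σ * inner ℝ (x t - x (s + 1 - H)) h) +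
        (k - 1) * (σ * ‖h‖ ^ 2) := by
    have : ((k : ℝ) - 1) * (σ * ‖h‖ ^ 2) = ∑ s ∈ Finset.Ico H t, σ * ‖h‖ ^ 2 := by
      rw [Finset.sum_const, Nat.card_Ico, nsmul_eq_mul, hk]
      have : t + 1 - H = (t - H) + 1 := by omega
      rw [this]; push_cast; ring
    rw [this, ← Finset.sum_add_distrib]
    refine Finset.sum_congr rfl fun s _ => ?_
    have e4 : x (t + 1) - x (s + 1 - H) = h + (x t - x (s + 1 - H)) := by rw [hh]; abel
    rw [e4, inner_add_left, real_inner_self_eq_norm_sq]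
    ring
  have e5 : x (t + 1) - x k = h + (x t - x k) := by rw [hh]; abel
  rw [e3, e5, inner_add_left h (x t - x k), real_inner_self_eq_norm_sq] at e2
  rw [inner_sub_left]
  field_simp at e1 e2
  linear_combination e2 - e1

/-- Cauchy–Schwarz: the distance to the anchor x_k is at most √(8B/σ), and √(ησk)‖h‖ is part of the
proximal norm. The factor 1/√k makes this contribution to the steps decay. -/
theorem proximal_term_le (hr : BoundedRun K ν R σ η B H T F u x A y g) {t : ℕ} (h1 : H ≤ t)
    (ht : t ≤ T) {k : ℕ} (hk : k = t + 1 - H) (h : E n) :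
    -(η * σ * inner ℝ (x t - x k) h) ≤
      Real.sqrt (8 * B * η / (k : ℝ)) * Real.sqrt (proxForm R σ η H x t h) := by
  have hσ := hr.sigma_pos
  have hη := hr.eta_pos
  have hB := hr.B_pos
  have hH := hr.one_le_H
  have hk0 : (0 : ℝ) < k := by exact_mod_cast (by omega : 0 < k)
  have hxt := hr.mem_interior (t := t) (by omega) ht
  have c1 : |inner ℝ (x t - x k) h| ≤ ‖x t - x k‖ * ‖h‖ := abs_real_inner_le_norm _ _
  have c2 : η * σ * (‖x t - x k‖ * ‖h‖) ≤
      Real.sqrt (8 * B * η / (k : ℝ)) * Real.sqrt (proxForm R σ η H x t h) := by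
    refine abs_le_of_sq_le_sq' ?_ (by positivity) |>.2
    rw [mul_pow, mul_pow (Real.sqrt _), Real.sq_sqrt (by positivity),
      Real.sq_sqrt (hr.proxForm_nonneg (by omega) ht h), proxForm, ← hk]
    have c3 := hr.sigma_diam _ (interior_subset hxt) _
      (interior_subset (hr.mem_interior (t := k) (by omega) (by omega)))
    have c4 : (η * σ) ^ 2 * (‖x t - x k‖ * ‖h‖) ^ 2 =
        (η * (σ * ‖x t - x k‖ ^ 2) / k) * (η * σ * k * ‖h‖ ^ 2) := by
      rw [div_mul_eq_mul_div, eq_div_iff hk0.ne']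
      ring
    rw [c4]
    have c5 : η * (σ * ‖x t - x k‖ ^ 2) / k ≤ 8 * B * η / k := by
      refine div_le_div_of_nonneg_right ?_ hk0.le
      rw [mul_comm (8 * B)]
      exact mul_le_mul_of_nonneg_left c3 hη.le
    have c6 : η * σ * k * ‖h‖ ^ 2 ≤ hessForm R (x t) h + η * σ * k * ‖h‖ ^ 2 := by
      have := hr.hessForm_nonneg (by omega) ht h
      linarith
    exact mul_le_mul c5 c6 (by positivity) (by positivity)
  have c7 : 0 ≤ η * σ := by positivity
  have c8 := mul_le_mul_of_nonneg_left ((neg_le_abs _).trans c1) c7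
  rw [mul_neg] at c8
  exact c8.trans c2

/-- The difference of the optimality conditions is at least N²/(1 + N) by strong monotonicity and at
most δN, so N ≤ δ(1 + N), and 2δ ≤ 1 yields N ≤ 2δ. The gradient bound is left as a hypothesis
because it rests on the smallness of earlier steps, supplied by the induction in
`sqrt_proxForm_step_le`. -/
theorem proxForm_step_le (hr : BoundedRun K ν R σ η B H T F u x A y g) {t : ℕ} (h1 : H ≤ t)
    (ht : t < T) (hsmall : stepBound n η B H t ≤ 1)
    (hg : |inner ℝ (g (t + 1 - H)) (x (t + 1) - x t)| ≤
      n * B * H * (2 * Real.sqrt (proxForm R σ η H x t (x (t + 1) - x t)))) :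
    Real.sqrt (proxForm R σ η H x t (x (t + 1) - x t)) ≤ stepBound n η B H t := by
  have hσ := hr.sigma_pos
  have hη := hr.eta_pos
  have hB := hr.B_pos
  have hH := hr.one_le_H
  set h := x (t + 1) - x t with hh
  set k := t + 1 - H with hk
  set N := Real.sqrt (proxForm R σ η H x t h) with hN
  have hN0 : 0 ≤ N := Real.sqrt_nonneg _
  have hNsq : N ^ 2 = hessForm R (x t) h + η * σ * k * ‖h‖ ^ 2 :=
    Real.sq_sqrt (hr.proxForm_nonneg (by omega) ht.le h)
  have hk1 : (1 : ℝ) ≤ k := by exact_mod_cast (by omega : 1 ≤ k)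
  have hxt := hr.mem_interior (t := t) (by omega) ht.le
  have hxt' := hr.mem_interior (t := t + 1) (by omega) ht
  have hopt := hr.optimality_sub h1 ht hh hk
  have hmono := le_inner_gradient_sub hr.barrier hr.convex hr.bounded hxt (h := h)
    (by rw [hh, add_sub_cancel]; exact hxt')
  have hxh : x t + h = x (t + 1) := by rw [hh, add_sub_cancel]
  rw [hxh] at hmono
  set r := locNorm R (x t) h with hrdef
  have hr0 : 0 ≤ r := locNorm_nonneg _ _
  have hrsq : r ^ 2 = hessForm R (x t) h :=
    sq_locNorm hr.barrier hr.convex hr.bounded hxt h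
  have hq0 : 0 ≤ η * σ * k * ‖h‖ ^ 2 := by positivity
  have hrN : r ≤ N := by
    refine abs_le_of_sq_le_sq' ?_ hN0 |>.2
    rw [hNsq, hrsq]; linarith
  -- the left side of the optimality identity dominates `N² / (1 + N)`
  have hlow : N ^ 2 / (1 + N) ≤
      inner ℝ (gradient R (x (t + 1)) - gradient R (x t)) h + η * σ * k * ‖h‖ ^ 2 := by
    refine le_trans ?_ (add_le_add_left hmono _)
    rw [hNsq, ← hrsq, add_div]
    refine add_le_add ?_ (div_le_self hq0 (by linarith))
    gcongr
  -- the right side is at most `δ N`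
  set δ := 2 * (η * n * B * H) + Real.sqrt (8 * B * η / (k : ℝ)) with hδ
  have hδ0 : 0 ≤ δ := by positivity
  have hup : -(η * inner ℝ (g k) h) - η * σ * inner ℝ (x t - x k) h ≤ δ * N := by
    have b1 : -(η * inner ℝ (g k) h) ≤ 2 * (η * n * B * H) * N := by
      have := (neg_abs_le (inner ℝ (g k) h))
      nlinarith [mul_le_mul_of_nonneg_left hg hη.le]
    have b2 := hr.proximal_term_le h1 ht.le hk h
    rw [← hN] at b2
    rw [hδ, add_mul]; linarith
  have hfin : N ^ 2 / (1 + N) ≤ δ * N := hlow.trans (hopt.trans_le hup)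
  have hsb : stepBound n η B H t = 2 * δ := rfl
  rw [hsb] at hsmall ⊢
  rw [div_le_iff₀ (by linarith)] at hfin
  rcases eq_or_lt_of_le hN0 with h0 | h0
  · rw [← h0]; linarith
  · have h8 : N ≤ δ * (1 + N) := by
      have : N * N ≤ N * (δ * (1 + N)) := by nlinarith
      exact le_of_mul_le_mul_left this h0
    nlinarith

/-- Stability of the iterates in the local norms. -/
theorem sqrt_proxForm_step_le (hr : BoundedRun K ν R σ η B H T F u x A y g)
    (hsmall : stepBound n η B H H ≤ 1 / (24 * H)) {t : ℕ} (h1 : 1 ≤ t) (ht : t < T) :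
    Real.sqrt (proxForm R σ η H x t (x (t + 1) - x t)) ≤ stepBound n η B H t := by
  have hH := hr.one_le_H
  have hH' : (1 : ℝ) ≤ H := by exact_mod_cast hH
  induction t using Nat.strong_induction_on with
  | _ t ih =>
  rcases lt_or_ge t H with htH | htH
  · rw [hr.eq_init h1 htH.le, hr.eq_init (t := t + 1) (by omega) htH, sub_self]
    simp only [proxForm, hessForm, map_zero, inner_zero_left, norm_zero]
    simpa using stepBound_nonneg hr.eta_pos.le hr.B_pos.le H t
  · have hle1 : (1 : ℝ) / (24 * H) ≤ 1 := by
      rw [div_le_one (by positivity)]; linarith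
    have hb := stepBound_le (n := n) hr.eta_pos.le hr.B_pos.le H t
    refine hr.proxForm_step_le htH ht (hb.trans (hsmall.trans hle1)) ?_
    rcases lt_or_ge (t + 1 - H) H with hk | hk
    · rw [hr.run.grad_init _ (Finset.mem_Icc.2 ⟨by omega, by omega⟩), inner_zero_left, abs_zero]
      have := hr.B_pos
      positivity
    · refine hr.abs_inner_grad_le hk (by omega) _ fun i hi => ?_
      -- The matrices in g_{t+1-H} have indices between t + 2 - 2H and t + 1 - H. Hence c = 1
      -- suffices, and every step between them and t is covered by the induction hypothesis.
      have := hr.norm_inverse_le (p := t + 1 - H - i) (s := t) (by omega) (by omega) h1 ht.le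
        (by omega) (by omega) (c := 1) ?_ le_rfl ?_ (x (t + 1) - x t)
      · simpa using this
      · intro r hr1 hr2
        refine le_trans ?_ ((ih r (by omega) (by omega) (by omega)).trans
          ((stepBound_le hr.eta_pos.le hr.B_pos.le H r).trans hsmall))
        exact Real.sqrt_le_sqrt (hr.hessForm_le_proxForm r _)
      · rw [one_pow, one_mul]
        exact_mod_cast (by omega : t + 1 - H - i ≤ t + 1 - H)

end BoundedRun

/-! ### Double counting and the total movement. -/

/-- Exchange of summation. Applied to windows of at most H rounds, it bounds the accumulated
movement by H times the total. -/
theorem sum_sum_le_of_card_le {ι κ : Type*} [DecidableEq κ] (I : Finset ι) (U : Finset κ)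
    (J : ι → Finset κ) (f : κ → ℝ) (N : ℕ) (hf : ∀ s ∈ U, 0 ≤ f s) (hJ : ∀ t ∈ I, J t ⊆ U)
    (hN : ∀ s ∈ U, (I.filter fun t => s ∈ J t).card ≤ N) :
    ∑ t ∈ I, ∑ s ∈ J t, f s ≤ N * ∑ s ∈ U, f s := by
  have h1 : ∑ t ∈ I, ∑ s ∈ J t, f s = ∑ s ∈ U, ∑ t ∈ I.filter fun t => s ∈ J t, f s := by
    refine Finset.sum_comm' fun t s => ?_
    simp only [Finset.mem_filter]
    exact ⟨fun h => ⟨⟨h.1, h.2⟩, hJ t h.1 h.2⟩, fun h => ⟨h.1.1, h.1.2⟩⟩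
  rw [h1, Finset.mul_sum]
  refine Finset.sum_le_sum fun s hs => ?_
  rw [Finset.sum_const, nsmul_eq_mul]
  exact mul_le_mul_of_nonneg_right (by exact_mod_cast hN s hs) (hf s hs)

theorem sum_one_div_sqrt_le (N : ℕ) :
    ∑ k ∈ Finset.range N, 1 / Real.sqrt ((k + 1 : ℕ) : ℝ) ≤ 2 * Real.sqrt N := by
  induction N with
  | zero => simp
  | succ N ih =>
    rw [Finset.sum_range_succ]
    have h0 : 0 ≤ Real.sqrt (N : ℝ) := Real.sqrt_nonneg _
    have h1 : 0 < Real.sqrt ((N + 1 : ℕ) : ℝ) := Real.sqrt_pos.2 (by positivity)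
    have h2 : Real.sqrt (N : ℝ) ^ 2 = N := Real.sq_sqrt (by positivity)
    have h3 : Real.sqrt ((N + 1 : ℕ) : ℝ) ^ 2 = N + 1 := by
      rw [Real.sq_sqrt (by positivity)]; push_cast; ring
    have h4 : 1 / Real.sqrt ((N + 1 : ℕ) : ℝ) ≤
        2 * (Real.sqrt ((N + 1 : ℕ) : ℝ) - Real.sqrt (N : ℝ)) := by
      rw [div_le_iff₀ h1]
      nlinarith [sq_nonneg (Real.sqrt ((N + 1 : ℕ) : ℝ) - Real.sqrt (N : ℝ))]
    linarith

/-- The total movement of the iterates. -/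
theorem sum_stepBound_le {n : ℕ} {η B : ℝ} (hη : 0 ≤ η) (hB : 0 ≤ B) {H T : ℕ} (hH : 1 ≤ H) :
    ∑ s ∈ Finset.Ico 1 T, stepBound n η B H s ≤
      4 * (η * n * B * H) * T + 4 * Real.sqrt (8 * B * η) * Real.sqrt T := by
  have h1 : ∑ s ∈ Finset.Ico 1 T, Real.sqrt (8 * B * η / ((s + 1 - H : ℕ) : ℝ)) ≤
      2 * Real.sqrt (8 * B * η) * Real.sqrt T := by
    have h2 : ∑ s ∈ Finset.Ico 1 T, Real.sqrt (8 * B * η / ((s + 1 - H : ℕ) : ℝ)) =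
        ∑ s ∈ Finset.Ico H T, Real.sqrt (8 * B * η / ((s + 1 - H : ℕ) : ℝ)) := by
      symm
      refine Finset.sum_subset (Finset.Ico_subset_Ico_left hH) fun s hs hs' => ?_
      rw [Finset.mem_Ico] at hs hs'
      have : s + 1 - H = 0 := by omega
      rw [this]; simp
    rw [h2, Finset.sum_Ico_eq_sum_range]
    have h3 : ∀ i ∈ Finset.range (T - H), Real.sqrt (8 * B * η / ((H + i + 1 - H : ℕ) : ℝ)) =
        Real.sqrt (8 * B * η) * (1 / Real.sqrt ((i + 1 : ℕ) : ℝ)) := by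
      intro i _
      rw [show H + i + 1 - H = i + 1 by omega, Real.sqrt_div (by positivity), mul_one_div]
    rw [Finset.sum_congr rfl h3, ← Finset.mul_sum]
    have h4 := sum_one_div_sqrt_le (T - H)
    have h5 : Real.sqrt ((T - H : ℕ) : ℝ) ≤ Real.sqrt T :=
      Real.sqrt_le_sqrt (by exact_mod_cast Nat.sub_le _ _)
    have h6 := Real.sqrt_nonneg (8 * B * η)
    nlinarith
  unfold stepBound
  rw [← Finset.mul_sum, Finset.sum_add_distrib, Finset.sum_const, Nat.card_Ico, nsmul_eq_mul]
  have h7 : ((T - 1 : ℕ) : ℝ) * (2 * (η * n * B * H)) ≤ T * (2 * (η * n * B * H)) := by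
    gcongr
    exact_mod_cast Nat.sub_le _ _
  linarith

/-- The factor √H would be correct too; H is simpler and harmless, since powers of H end up in the
logarithmic factor. -/
theorem norm_hist_le {n H : ℕ} {w : Hist n H} {c : ℝ} (hc : 0 ≤ c) (hH : 1 ≤ H)
    (h : ∀ j, ‖w j‖ ≤ c) : ‖w‖ ≤ H * c := by
  rw [PiLp.norm_eq_of_L2, Real.sqrt_le_left (by positivity)]
  have h1 : ∑ i, ‖w i‖ ^ 2 ≤ ∑ _i : Fin H, c ^ 2 :=
    Finset.sum_le_sum fun i _ => pow_le_pow_left₀ (norm_nonneg _) (h i) 2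
  refine h1.trans ?_
  have : (1 : ℝ) ≤ H := by exact_mod_cast hH
  rw [Finset.sum_const, Finset.card_univ, Fintype.card_fin, nsmul_eq_mul, mul_pow]
  have h2 : (H : ℝ) ≤ H ^ 2 := by nlinarith
  exact mul_le_mul_of_nonneg_right h2 (sq_nonneg c)

/-! ### Cost of memory and delay, and the regret of the regularized leader. -/

namespace BoundedRun

variable {n : ℕ} {K : Set (E n)} {ν : ℝ} {R : E n → ℝ} {σ η B : ℝ} {H T : ℕ}
  {F : ℕ → Hist n H → ℝ} {u : ℕ → UnitSphere n}
  {x : ℕ → E n} {A : ℕ → E n →L[ℝ] E n} {y g : ℕ → E n}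

theorem locNorm_step_le (hr : BoundedRun K ν R σ η B H T F u x A y g)
    (hsmall : stepBound n η B H H ≤ 1 / (24 * H)) {t : ℕ} (h1 : 1 ≤ t) (ht : t < T) :
    locNorm R (x t) (x (t + 1) - x t) ≤ stepBound n η B H t :=
  (Real.sqrt_le_sqrt (hr.hessForm_le_proxForm t _)).trans (hr.sqrt_proxForm_step_le hsmall h1 ht)

theorem locNorm_step_le' (hr : BoundedRun K ν R σ η B H T F u x A y g)
    (hsmall : stepBound n η B H H ≤ 1 / (24 * H)) {t : ℕ} (h1 : 1 ≤ t) (ht : t < T) :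
    locNorm R (x t) (x (t + 1) - x t) ≤ 1 / (24 * H) :=
  (hr.locNorm_step_le hsmall h1 ht).trans
    ((stepBound_le hr.eta_pos.le hr.B_pos.le H t).trans hsmall)

/-- Each step is small in its local norm, which dominates the Euclidean norm up to the diameter. The
bound d stays free because it is used both with D and with √(8B/σ). -/
theorem norm_sub_le_sum (hr : BoundedRun K ν R σ η B H T F u x A y g)
    (hsmall : stepBound n η B H H ≤ 1 / (24 * H)) {d : ℝ} (hd0 : 0 ≤ d)
    (hd : ∀ a ∈ K, ∀ b ∈ K, ‖a - b‖ ≤ d) {a b : ℕ} (ha : 1 ≤ a) (hab : a ≤ b) (hb : b ≤ T) :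
    ‖x b - x a‖ ≤ d * ∑ s ∈ Finset.Ico a b, stepBound n η B H s := by
  rw [← Finset.sum_Ico_sub x hab, Finset.mul_sum]
  refine (norm_sum_le _ _).trans (Finset.sum_le_sum fun s hs => ?_)
  rw [Finset.mem_Ico] at hs
  exact (norm_le_mul_locNorm hr.barrier hr.convex hr.closed hr.bounded
    (hr.mem_interior (t := s) (by omega) (by omega)) hd _).trans
    (mul_le_mul_of_nonneg_left (hr.locNorm_step_le hsmall (by omega) (by omega)) hd0)

theorem norm_window_sub_diag_le (hr : BoundedRun K ν R σ η B H T F u x A y g)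
    (hsmall : stepBound n η B H H ≤ 1 / (24 * H)) {d : ℝ} (hd0 : 0 ≤ d)
    (hd : ∀ a ∈ K, ∀ b ∈ K, ‖a - b‖ ≤ d) {t : ℕ} (h1 : H ≤ t) (ht : t ≤ T) :
    ‖window H x t - diag H (x t)‖ ≤
      H * (d * ∑ s ∈ Finset.Ico (t + 1 - H) t, stepBound n η B H s) := by
  have hnn : ∀ s, 0 ≤ stepBound n η B H s := stepBound_nonneg hr.eta_pos.le hr.B_pos.le H
  refine norm_hist_le (mul_nonneg hd0 (Finset.sum_nonneg fun s _ => hnn s)) hr.one_le_H fun j => ?_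
  change ‖x (t + 1 - H + (j : ℕ)) - x t‖ ≤ _
  have hj := j.2
  rw [norm_sub_rev]
  refine (hr.norm_sub_le_sum hsmall hd0 hd (by omega) (by omega) ht).trans ?_
  refine mul_le_mul_of_nonneg_left ?_ hd0
  exact Finset.sum_le_sum_of_subset_of_nonneg
    (Finset.Ico_subset_Ico_left (by omega)) fun s _ _ => hnn s

/-- This is the price of the delay: g_t first influences x_{t+H}, and each of the H steps in between
is small in the norms given by the matrices of g_t. -/
theorem abs_inner_grad_sub_le (hr : BoundedRun K ν R σ η B H T F u x A y g)
    (hsmall : stepBound n η B H H ≤ 1 / (24 * H)) {t : ℕ} (h1 : H ≤ t) (ht : t + H ≤ T) :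
    |inner ℝ (g t) (x (t + H) - x t)| ≤
      n * B * H * (2 * H * ∑ s ∈ Finset.Ico t (t + H), stepBound n η B H s) := by
  refine hr.abs_inner_grad_le h1 (by omega) _ fun i hi => ?_
  have hH := hr.one_le_H
  rw [← Finset.sum_Ico_sub x (by omega : t ≤ t + H), map_sum, Finset.mul_sum]
  refine (norm_sum_le _ _).trans (Finset.sum_le_sum fun s hs => ?_)
  rw [Finset.mem_Ico] at hs
  -- For s ≥ t ≥ H one has t - i ≤ H²(s + 1 - H). The loss is real at t = s = H, where the proximal
  -- form counts a single term.
  refine (hr.norm_inverse_le (p := t - i) (s := s) (c := H) (by omega) (by omega) (by omega)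
    (by omega) (by omega) (by omega) (fun r hr1 hr2 => hr.locNorm_step_le' hsmall (by omega)
      (by omega)) (by exact_mod_cast hH) ?_ _).trans ?_
  · have h2 : t - i ≤ H ^ 2 * (s + 1 - H) := by
      obtain ⟨a, rfl⟩ := Nat.exists_eq_add_of_le h1
      obtain ⟨b, rfl⟩ := Nat.exists_eq_add_of_le hs.1
      have e1 : H + a + b + 1 - H = a + b + 1 := by omega
      rw [e1]
      have e2 : H ≤ H ^ 2 := by nlinarith
      have e3 : H * (a + 1) ≤ H ^ 2 * (a + b + 1) := Nat.mul_le_mul e2 (by omega)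
      have e4 : a ≤ H * a := by nlinarith
      have e5 : H * (a + 1) = H * a + H := by ring
      omega
    exact_mod_cast h2
  · exact mul_le_mul_of_nonneg_left (hr.sqrt_proxForm_step_le hsmall (by omega) (by omega))
      (by positivity)

/-- The be-the-leader inequality. -/
theorem be_the_leader (hr : BoundedRun K ν R σ η B H T F u x A y g) (m : ℕ) (hm : H + m ≤ T)
    {z : E n} (hz : z ∈ interior K) :
    ∑ s ∈ Finset.Ico H (H + m), (inner ℝ (g (s + 1 - H)) (x (s + 1)) +
        σ / 2 * ‖x (s + 1) - x (s + 1 - H)‖ ^ 2) + 1 / η * R (x H) ≤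
      ∑ s ∈ Finset.Ico H (H + m), (inner ℝ (g (s + 1 - H)) z +
        σ / 2 * ‖z - x (s + 1 - H)‖ ^ 2) + 1 / η * R z := by
  induction m generalizing z with
  | zero =>
    have hη := hr.eta_pos
    have := isMinOn_iff.1 (hr.run.init H (Finset.mem_Icc.2 ⟨hr.one_le_H, le_rfl⟩)).2 z hz
    simp only [add_zero, Finset.Ico_self, Finset.sum_empty, zero_add]
    gcongr
  | succ m ih =>
    have hx := hr.run.update (H + m) (Finset.mem_Ico.2 ⟨by omega, by omega⟩)
    have h1 := ih (by omega) hx.1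
    have h2 := isMinOn_iff.1 hx.2 z hz
    have e : Finset.Icc H (H + m) = Finset.Ico H (H + m + 1) := by ext s; simp
    rw [e, Finset.sum_Ico_succ_top (by omega)] at h2
    rw [← add_assoc, Finset.sum_Ico_succ_top (by omega)]
    linarith

/-- The regret of the iterates with respect to the estimated gradients. -/
theorem sum_inner_grad_le (hr : BoundedRun K ν R σ η B H T F u x A y g)
    (hsmall : stepBound n η B H H ≤ 1 / (24 * H)) {z : E n} (hz : z ∈ interior K) :
    ∑ t ∈ Finset.Icc H (T - H), (inner ℝ (g t) (x t - z) - σ / 2 * ‖x t - z‖ ^ 2) ≤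
      1 / η * (R z - R (x H)) + 4 * B * H +
        2 * n * B * H ^ 3 * ∑ s ∈ Finset.Ico 1 T, stepBound n η B H s := by
  have hH := hr.one_le_H
  have hHT := hr.H_le_T
  have hσ := hr.sigma_pos
  have hB := hr.B_pos
  have hnn : ∀ s, 0 ≤ stepBound n η B H s := stepBound_nonneg hr.eta_pos.le hr.B_pos.le H
  -- Here g_t is paired with x_{t+H}, the first iterate whose objective contains it, as the
  -- be-the-leader inequality demands.
  set a : ℕ → ℝ := fun t => inner ℝ (g t) (x (t + H) - z) + σ / 2 * ‖x (t + H) - x t‖ ^ 2 -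
    σ / 2 * ‖z - x t‖ ^ 2 with ha
  have hbtl : ∑ t ∈ Finset.Ico 1 (T + 1 - H), a t ≤ 1 / η * (R z - R (x H)) := by
    have h1 := hr.be_the_leader (T - H) (by omega) hz
    rw [Nat.add_sub_cancel' hHT] at h1
    have h2 : ∑ t ∈ Finset.Ico 1 (T + 1 - H), a t = ∑ s ∈ Finset.Ico H T,
        ((inner ℝ (g (s + 1 - H)) (x (s + 1)) + σ / 2 * ‖x (s + 1) - x (s + 1 - H)‖ ^ 2) -
          (inner ℝ (g (s + 1 - H)) z + σ / 2 * ‖z - x (s + 1 - H)‖ ^ 2)) := by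
      refine Finset.sum_nbij' (fun t => t + H - 1) (fun s => s + 1 - H) ?_ ?_ ?_ ?_ ?_
      · intro t ht; rw [Finset.mem_Ico] at ht ⊢; omega
      · intro t ht; rw [Finset.mem_Ico] at ht ⊢; omega
      · intro t ht; rw [Finset.mem_Ico] at ht; omega
      · intro t ht; rw [Finset.mem_Ico] at ht; omega
      · intro t ht
        rw [Finset.mem_Ico] at ht
        have e1 : t + H - H = t := by omega
        have e2 : t + H - 1 + 1 = t + H := by omega
        simp only [e2, e1, ha, inner_sub_right]
        ring
    rw [h2, Finset.sum_sub_distrib, mul_sub]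
    linarith
  rw [← Finset.sum_filter_add_sum_filter_not _ (fun t => H ≤ t)] at hbtl
  have hset : (Finset.Ico 1 (T + 1 - H)).filter (fun t => H ≤ t) = Finset.Icc H (T - H) := by
    ext t; simp; omega
  rw [hset] at hbtl
  -- Before round H the gradient is zero, so a term can only be negative through -σ/2‖z - x_t‖² ≥
  -- -4B.
  have hfirst : -(4 * B * H) ≤ ∑ t ∈ (Finset.Ico 1 (T + 1 - H)).filter (fun t => ¬ H ≤ t), a t := by
    have h1 : ∀ t ∈ (Finset.Ico 1 (T + 1 - H)).filter (fun t => ¬ H ≤ t), -(4 * B) ≤ a t := by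
      intro t ht
      rw [Finset.mem_filter, Finset.mem_Ico] at ht
      have h2 : g t = 0 := hr.run.grad_init t (Finset.mem_Icc.2 ⟨by omega, by omega⟩)
      have h3 := hr.sigma_diam z (interior_subset hz) (x t)
        (interior_subset (hr.mem_interior (t := t) (by omega) (by omega)))
      have h4 : 0 ≤ σ / 2 * ‖x (t + H) - x t‖ ^ 2 := by positivity
      simp only [ha, h2, inner_zero_left]
      linarith
    have h2 := Finset.card_nsmul_le_sum _ _ _ h1
    have h3 : ((Finset.Ico 1 (T + 1 - H)).filter (fun t => ¬ H ≤ t)).card ≤ H := by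
      have : (Finset.Ico 1 (T + 1 - H)).filter (fun t => ¬ H ≤ t) ⊆ Finset.range H := by
        intro t; simp
      exact (Finset.card_le_card this).trans_eq (Finset.card_range H)
    rw [nsmul_eq_mul] at h2
    have h4 : (((Finset.Ico 1 (T + 1 - H)).filter (fun t => ¬ H ≤ t)).card : ℝ) ≤ H := by
      exact_mod_cast h3
    nlinarith
  have hmain : ∑ t ∈ Finset.Icc H (T - H),
      (inner ℝ (g t) (x t - z) - σ / 2 * ‖x t - z‖ ^ 2) ≤
      ∑ t ∈ Finset.Icc H (T - H), (a t + n * B * H * (2 * H *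
        ∑ s ∈ Finset.Ico t (t + H), stepBound n η B H s)) := by
    refine Finset.sum_le_sum fun t ht => ?_
    rw [Finset.mem_Icc] at ht
    have h1 := hr.abs_inner_grad_sub_le hsmall ht.1 (by omega)
    have h2 := (neg_abs_le _).trans' (neg_le_neg h1)
    have h3 : 0 ≤ σ / 2 * ‖x (t + H) - x t‖ ^ 2 := by positivity
    have h4 : inner ℝ (g t) (x t - z) =
        inner ℝ (g t) (x (t + H) - z) - inner ℝ (g t) (x (t + H) - x t) := by
      rw [← inner_sub_right]; congr 1; abel
    simp only [ha]
    rw [h4, norm_sub_rev (x t) z]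
    linarith
  have hdbl : ∑ t ∈ Finset.Icc H (T - H), ∑ s ∈ Finset.Ico t (t + H), stepBound n η B H s ≤
      H * ∑ s ∈ Finset.Ico 1 T, stepBound n η B H s := by
    refine sum_sum_le_of_card_le _ _ _ _ H (fun s _ => hnn s) ?_ ?_
    · intro t ht s hs
      rw [Finset.mem_Icc] at ht
      rw [Finset.mem_Ico] at hs ⊢
      omega
    · intro s _
      have : (Finset.Icc H (T - H)).filter (fun t => s ∈ Finset.Ico t (t + H)) ⊆
          Finset.Ico (s + 1 - H) (s + 1) := by
        intro t ht
        rw [Finset.mem_filter, Finset.mem_Ico] at ht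
        rw [Finset.mem_Ico]
        omega
      refine (Finset.card_le_card this).trans ?_
      rw [Nat.card_Ico]; omega
  rw [Finset.sum_add_distrib, ← Finset.mul_sum, ← Finset.mul_sum] at hmain
  have h5 : (n : ℝ) * B * H * (2 * H * ∑ t ∈ Finset.Icc H (T - H),
      ∑ s ∈ Finset.Ico t (t + H), stepBound n η B H s) ≤
      n * B * H * (2 * H * (H * ∑ s ∈ Finset.Ico 1 T, stepBound n η B H s)) := by
    gcongr
  linarith

theorem sum_window_le (hr : BoundedRun K ν R σ η B H T F u x A y g) :
    ∑ t ∈ Finset.Icc H (T - H), ∑ s ∈ Finset.Ico (t + 1 - H) t, stepBound n η B H s ≤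
      H * ∑ s ∈ Finset.Ico 1 T, stepBound n η B H s := by
  have hH := hr.one_le_H
  refine sum_sum_le_of_card_le _ _ _ _ H
    (fun s _ => stepBound_nonneg hr.eta_pos.le hr.B_pos.le H s) ?_ ?_
  · intro t ht s hs
    rw [Finset.mem_Icc] at ht
    rw [Finset.mem_Ico] at hs ⊢
    omega
  · intro s _
    have : (Finset.Icc H (T - H)).filter (fun t => s ∈ Finset.Ico (t + 1 - H) t) ⊆
        Finset.Ico (s + 1) (s + 1 + H) := by
      intro t ht
      rw [Finset.mem_filter, Finset.mem_Ico] at ht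
      rw [Finset.mem_Ico]
      omega
    refine (Finset.card_le_card this).trans ?_
    rw [Nat.card_Ico]; omega

/-- A bound on the inverse exploration matrices which only depends on the first iterate. -/
theorem norm_inverse_le_init (hr : BoundedRun K ν R σ η B H T F u x A y g)
    (hsmall : stepBound n η B H H ≤ 1 / (24 * H)) {t : ℕ} (h1 : 1 ≤ t) (ht : t ≤ T) (v : E n) :
    ‖(A t).inverse v‖ ≤
      Real.sqrt (Real.exp (12 * T) * ‖hess R (x H)‖ + η * σ * T) * ‖v‖ := by
  have hH := hr.one_le_H
  have hH' : (1 : ℝ) ≤ H := by exact_mod_cast hH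
  have hσ := hr.sigma_pos
  have hη := hr.eta_pos
  have htT : (t : ℝ) ≤ T := by exact_mod_cast ht
  refine abs_le_of_sq_le_sq' ?_ (by positivity) |>.2
  rw [hr.norm_inverse_sq h1 ht, mul_pow, Real.sq_sqrt (by positivity), add_mul]
  have hρ : (1 : ℝ) / (24 * H) ≤ 1 / 2 := by
    rw [div_le_div_iff₀ (by positivity) (by norm_num)]; linarith
  have h2 := (hr.hessForm_chain hρ le_rfl v (t - 1) (by omega)
    (fun s hs1 hs2 => hr.locNorm_step_le' hsmall hs1 (by omega))).2
  rw [Nat.add_sub_cancel' h1, hr.eq_init le_rfl hH] at h2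
  have h3 : Real.exp (12 * (1 / (24 * H)) * ((t - 1 : ℕ) : ℝ)) ≤ Real.exp (12 * T) := by
    apply Real.exp_le_exp.2
    have h4 : ((t - 1 : ℕ) : ℝ) ≤ T := by exact_mod_cast (Nat.sub_le t 1).trans ht
    have h5 : (0 : ℝ) ≤ 1 / (24 * H) := by positivity
    have h6 : (0 : ℝ) ≤ ((t - 1 : ℕ) : ℝ) := by positivity
    nlinarith
  have h4 : hessForm R (x H) v ≤ ‖hess R (x H)‖ * ‖v‖ ^ 2 := by
    refine (real_inner_le_norm _ _).trans ?_
    rw [sq, ← mul_assoc]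
    exact mul_le_mul_of_nonneg_right ((hess R (x H)).le_opNorm v) (norm_nonneg _)
  have h5 := hr.hessForm_nonneg hH hr.H_le_T v
  have h6 := h2.trans (mul_le_mul h3 h4 h5 (Real.exp_nonneg _))
  rw [← mul_assoc] at h6
  refine add_le_add h6 ?_
  gcongr

end BoundedRun

/-! ### Moments of uniform directions. -/

section Sphere

variable {n : ℕ}

/-- The action of a linear isometry on the unit sphere. -/
def sphereMap (e : E n ≃ₗᵢ[ℝ] E n) (u : UnitSphere n) : UnitSphere n :=
  ⟨e u, by simp⟩

theorem continuous_sphereMap (e : E n ≃ₗᵢ[ℝ] E n) : Continuous (sphereMap e) :=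
  (e.continuous.comp continuous_subtype_val).subtype_mk _

-- The cone over the preimage of a set is the preimage of its cone, and Lebesgue measure is
-- invariant under linear isometries.
open scoped Pointwise in
theorem measurePreserving_sphereMap (e : E n ≃ₗᵢ[ℝ] E n) :
    MeasurePreserving (sphereMap e) (uniformSphere n) (uniformSphere n) := by
  have h : MeasurePreserving (sphereMap e) (volume : Measure (E n)).toSphere
      (volume : Measure (E n)).toSphere := by
    refine ⟨(continuous_sphereMap e).measurable, ?_⟩
    ext s hs
    have hms : MeasurableSet (sphereMap e ⁻¹' s) := (continuous_sphereMap e).measurable hs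
    rw [Measure.map_apply (continuous_sphereMap e).measurable hs, Measure.toSphere_apply' _ hms,
      Measure.toSphere_apply' _ hs]
    have hset : Ioo (0 : ℝ) 1 • ((↑) '' (sphereMap e ⁻¹' s) : Set (E n)) =
        e ⁻¹' (Ioo (0 : ℝ) 1 • ((↑) '' s : Set (E n))) := by
      ext v
      simp only [Set.mem_smul, mem_image, mem_preimage]
      constructor
      · rintro ⟨r, hr, _, ⟨w, hw, rfl⟩, rfl⟩
        exact ⟨r, hr, _, ⟨_, hw, rfl⟩, (map_smul e r (w : E n)).symm⟩
      · rintro ⟨r, hr, _, ⟨w, hw, rfl⟩, h⟩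
        refine ⟨r, hr, _, ⟨sphereMap e.symm w, ?_, rfl⟩, ?_⟩
        · have : sphereMap e (sphereMap e.symm w) = w := by
            apply Subtype.ext; exact e.apply_symm_apply _
          rwa [this]
        · apply e.injective
          rw [← h, map_smul]
          congr 1
          exact e.apply_symm_apply _
    rw [hset]
    congr 1
    exact (LinearIsometryEquiv.measurePreserving e).measure_preimage_emb
      e.toHomeomorph.measurableEmbedding _
  exact h.smul_measure _

theorem isProbabilityMeasure_uniformSphere (hn : 1 ≤ n) :
    IsProbabilityMeasure (uniformSphere n) := by
  constructor
  rw [uniformSphere, Measure.smul_apply, smul_eq_mul]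
  have : Nontrivial (E n) := by
    have : Nonempty (Fin n) := ⟨⟨0, hn⟩⟩
    infer_instance
  refine ENNReal.inv_mul_cancel ?_ (measure_ne_top _ _)
  rw [Measure.measure_univ_ne_zero]
  exact Measure.toSphere_ne_zero _

theorem continuous_inner_sphere (a : E n) :
    Continuous fun u : UnitSphere n => inner ℝ a (u : E n) :=
  by fun_prop

theorem integrable_of_continuous_compact {X : Type*} [TopologicalSpace X] [CompactSpace X]
    [MeasurableSpace X] [BorelSpace X] [SecondCountableTopology X] {μ : Measure X}
    [IsFiniteMeasure μ] {f : X → ℝ} (hf : Continuous f) : Integrable f μ := by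
  obtain ⟨C, hC⟩ := isCompact_univ.exists_bound_of_continuousOn hf.continuousOn
  exact Integrable.of_bound hf.aestronglyMeasurable C (ae_of_all _ fun x => hC x (mem_univ x))

theorem integrable_sq_inner_sphere (hn : 1 ≤ n) (a : E n) :
    Integrable (fun u : UnitSphere n => inner ℝ a (u : E n) ^ 2) (uniformSphere n) := by
  have hP := isProbabilityMeasure_uniformSphere hn
  exact integrable_of_continuous_compact (by fun_prop)

/-- The moment depends only on ‖a‖, because the reflection exchanging two vectors of equal length
preserves the law. The n coordinate moments are therefore equal, and they add up to 1. -/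
theorem integral_sq_inner_sphere (hn : 1 ≤ n) (a : E n) :
    ∫ u, inner ℝ a (u : E n) ^ 2 ∂(uniformSphere n) = ‖a‖ ^ 2 / n := by
  have hP := isProbabilityMeasure_uniformSphere hn
  have hrot : ∀ a b : E n, ‖a‖ = ‖b‖ → ∫ u, inner ℝ a (u : E n) ^ 2 ∂(uniformSphere n) =
      ∫ u, inner ℝ b (u : E n) ^ 2 ∂(uniformSphere n) := by
    intro a b hab
    set e : E n ≃ₗᵢ[ℝ] E n := (Submodule.span ℝ {a - b})ᗮ.reflection with he
    have hea : e a = b := Submodule.reflection_sub hab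
    have hf : AEStronglyMeasurable (fun u : UnitSphere n => inner ℝ b (u : E n) ^ 2)
        (uniformSphere n) :=
      ((continuous_inner_sphere b).pow 2).aestronglyMeasurable
    have hmp := measurePreserving_sphereMap e
    rw [← hmp.map_eq] at hf
    have h1 := integral_map hmp.measurable.aemeasurable hf
    rw [hmp.map_eq] at h1
    rw [h1]
    congr 1
    funext u
    change _ = inner ℝ b (e u) ^ 2
    rw [← hea, e.inner_map_map]
  set q : E n → ℝ := fun a => ∫ u, inner ℝ a (u : E n) ^ 2 ∂(uniformSphere n) with hq
  set i₀ : Fin n := ⟨0, hn⟩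
  have hn0 : (n : ℝ) ≠ 0 := by positivity
  have hbase : q (EuclideanSpace.single i₀ 1) = 1 / n := by
    have h1 : ∑ i, q (EuclideanSpace.single i 1) = 1 := by
      simp only [hq]
      rw [← integral_finsetSum _ fun i _ => integrable_sq_inner_sphere hn _]
      have : ∀ u : UnitSphere n,
          ∑ i, inner ℝ (EuclideanSpace.single i (1 : ℝ)) (u : E n) ^ 2 = 1 := by
        intro u
        have h2 : ‖(u : E n)‖ ^ 2 = 1 := by simp
        rw [EuclideanSpace.norm_sq_eq] at h2
        simpa [EuclideanSpace.inner_single_left] using h2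
      simp [this]
    have h2 : ∀ i, q (EuclideanSpace.single i 1) = q (EuclideanSpace.single i₀ 1) :=
      fun i => hrot _ _ (by simp)
    rw [Finset.sum_congr rfl fun i _ => h2 i, Finset.sum_const, Finset.card_univ,
      Fintype.card_fin, nsmul_eq_mul] at h1
    rw [eq_div_iff hn0, mul_comm]
    exact h1
  have h3 : q a = q (‖a‖ • EuclideanSpace.single i₀ 1) := hrot _ _ (by simp [norm_smul])
  change q a = _
  rw [h3]
  simp only [hq, inner_smul_left, mul_pow, conj_trivial]
  rw [integral_const_mul]
  change ‖a‖ ^ 2 * q (EuclideanSpace.single i₀ 1) = _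
  rw [hbase, mul_one_div]

theorem integral_inner_mul_inner_sphere (hn : 1 ≤ n) (a b : E n) :
    ∫ u, inner ℝ a (u : E n) * inner ℝ b (u : E n) ∂(uniformSphere n) = inner ℝ a b / n := by
  have hP := isProbabilityMeasure_uniformSphere hn
  have h1 : ∀ u : UnitSphere n, inner ℝ a (u : E n) * inner ℝ b (u : E n) =
      4⁻¹ * (inner ℝ (a + b) (u : E n) ^ 2 - inner ℝ (a - b) (u : E n) ^ 2) := by
    intro u; rw [inner_add_left, inner_sub_left]; ring
  simp only [h1]
  rw [integral_const_mul, integral_sub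
    (integrable_sq_inner_sphere hn _) (integrable_sq_inner_sphere hn _),
    integral_sq_inner_sphere hn, integral_sq_inner_sphere hn, norm_add_sq_real, norm_sub_sq_real]
  ring

/-- The joint law of `H` independent uniform directions. -/
def noiseLaw (n H : ℕ) : Measure (Fin H → UnitSphere n) := Measure.pi fun _ => uniformSphere n

theorem isProbabilityMeasure_noiseLaw (hn : 1 ≤ n) (H : ℕ) :
    IsProbabilityMeasure (noiseLaw n H) := by
  have := isProbabilityMeasure_uniformSphere hn
  unfold noiseLaw; infer_instance

theorem measurePreserving_neg_sphere :
    MeasurePreserving (fun u : UnitSphere n => -u) (uniformSphere n) (uniformSphere n) :=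
  measurePreserving_sphereMap (LinearIsometryEquiv.neg ℝ)

/-- The uniform law is even, so reversing any chosen subset of the independent directions preserves
the joint law. -/
theorem integral_noiseLaw_flip (hn : 1 ≤ n) {H : ℕ} (s : Fin H → Prop) [DecidablePred s]
    {f : (Fin H → UnitSphere n) → ℝ} (hf : Continuous f) :
    ∫ u, f (fun j => if s j then -u j else u j) ∂(noiseLaw n H) = ∫ u, f u ∂(noiseLaw n H) := by
  have hP := isProbabilityMeasure_uniformSphere hn
  have hmp : MeasurePreserving (fun (u : Fin H → UnitSphere n) j => if s j then -u j else u j)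
      (noiseLaw n H) (noiseLaw n H) := by
    have := measurePreserving_pi (fun _ : Fin H => uniformSphere n) (fun _ => uniformSphere n)
      (f := fun j u => if s j then -u else u) (fun j => by
        by_cases hj : s j
        · simpa [hj] using measurePreserving_neg_sphere
        · simp only [hj, if_false]
          exact MeasurePreserving.id (uniformSphere n))
    exact this
  have hf' : AEStronglyMeasurable f (noiseLaw n H) := hf.aestronglyMeasurable
  rw [← hmp.map_eq] at hf'
  have h1 := integral_map hmp.measurable.aemeasurable hf'
  rw [hmp.map_eq] at h1
  exact h1.symm

theorem integral_noiseLaw_odd (hn : 1 ≤ n) {H : ℕ}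
    {f : (Fin H → UnitSphere n) → ℝ} (hf : Continuous f) (hodd : ∀ u, f (-u) = -f u) :
    ∫ u, f u ∂(noiseLaw n H) = 0 := by
  have h1 := integral_noiseLaw_flip hn (fun _ : Fin H => True) hf
  have h2 : ∀ u : Fin H → UnitSphere n, f (fun j => if True then -u j else u j) = -f u := by
    intro u; rw [← hodd]; simp; rfl
  simp only [h2] at h1
  rw [integral_neg] at h1
  linarith

theorem integral_noiseLaw_inner_mul_inner (hn : 1 ≤ n) {H : ℕ} (p q : Fin H → E n) :
    ∫ u, (∑ j, inner ℝ (p j) (u j : E n)) * (∑ k, inner ℝ (q k) (u k : E n)) ∂(noiseLaw n H) =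
      (∑ j, inner ℝ (p j) (q j)) / n := by
  have hP := isProbabilityMeasure_noiseLaw hn H
  have hP' := isProbabilityMeasure_uniformSphere hn
  have hc : ∀ j k : Fin H, Continuous fun u : Fin H → UnitSphere n =>
      inner ℝ (p j) (u j : E n) * inner ℝ (q k) (u k : E n) := fun j k => by fun_prop
  have hoff : ∀ j k : Fin H, ∫ u, inner ℝ (p j) (u j : E n) * inner ℝ (q k) (u k : E n)
      ∂(noiseLaw n H) = if j = k then inner ℝ (p j) (q k) / n else 0 := by
    intro j k
    split_ifs with hjk
    · subst hjk
      rw [← integral_inner_mul_inner_sphere hn]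
      have hmp : MeasurePreserving (Function.eval j) (noiseLaw n H) (uniformSphere n) :=
        measurePreserving_eval (fun _ : Fin H => uniformSphere n) j
      have hf : AEStronglyMeasurable (fun u : UnitSphere n => inner ℝ (p j) (u : E n) *
          inner ℝ (q j) (u : E n)) (uniformSphere n) :=
        ((continuous_inner_sphere _).mul (continuous_inner_sphere _)).aestronglyMeasurable
      rw [← hmp.map_eq] at hf
      have h1 := integral_map hmp.measurable.aemeasurable hf
      rw [hmp.map_eq] at h1
      exact h1.symm
    -- For j ≠ k, reversing u_j alone changes the sign of the product.
    · have h1 := integral_noiseLaw_flip hn (fun i : Fin H => i = j) (hc j k)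
      simp only [Ne.symm hjk, ↓reduceIte] at h1
      have h2 : ∀ u : Fin H → UnitSphere n,
          inner ℝ (p j) ((-u j : UnitSphere n) : E n) * inner ℝ (q k) (u k : E n) =
          -(inner ℝ (p j) (u j : E n) * inner ℝ (q k) (u k : E n)) := by
        intro u; simp
      simp only [h2] at h1
      rw [integral_neg] at h1
      linarith
  simp only [Finset.sum_mul_sum]
  rw [integral_finsetSum _ fun j _ => integrable_finsetSum _ fun k _ =>
    integrable_of_continuous_compact (hc j k)]
  rw [Finset.sum_div]
  refine Finset.sum_congr rfl fun j _ => ?_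
  rw [integral_finsetSum _ fun k _ => integrable_of_continuous_compact (hc j k)]
  simp [hoff]

end Sphere

/-! ### Quadratic data of the losses. -/

section Quadratic

variable {n H : ℕ}

theorem continuous_quad (W : Hist n H →L[ℝ] Hist n H) (b : Hist n H) (c : ℝ) :
    Continuous (quad W b c) := by
  unfold quad; fun_prop

theorem quad_add {S : Hist n H →L[ℝ] Hist n H} (hS : ∀ v w, inner ℝ (S v) w = inner ℝ v (S w))
    (b : Hist n H) (c : ℝ) (w v : Hist n H) :
    quad S b c (w + v) =
      quad S b c w + inner ℝ ((2 : ℝ) • S w + b) v + inner ℝ v (S v) := by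
  simp only [quad, map_add, inner_add_left, inner_add_right, inner_smul_left, conj_trivial]
  rw [← hS w v, real_inner_comm (S w) v]
  ring

theorem gradient_quad (W : Hist n H →L[ℝ] Hist n H) (b : Hist n H) (c : ℝ) (w : Hist n H) :
    gradient (quad W b c) w = W w + W.adjoint w + b := by
  have h1 : HasFDerivAt (quad W b c)
      (innerSL ℝ (W w + W.adjoint w + b)) w := by
    have h2 := (((hasFDerivAt_id w).inner ℝ (W.hasFDerivAt (x := w))).add
      ((hasFDerivAt_const b w).inner ℝ (hasFDerivAt_id w))).add_const c
    refine h2.congr_fderiv ?_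
    ext v
    simp only [innerSL_apply_apply, inner_add_left, ContinuousLinearMap.adjoint_inner_left, id,
      add_apply, ContinuousLinearMap.comp_apply, ContinuousLinearMap.prod_apply,
      ContinuousLinearMap.id_apply, fderivInnerCLM_apply, zero_apply, inner_zero_left, add_zero]
    linarith [real_inner_comm v (W w), real_inner_comm w (W v)]
  have h3 : HasGradientAt (quad W b c) (W w + W.adjoint w + b) w := by
    rw [hasGradientAt_iff_hasFDerivAt]
    exact h1
  exact h3.gradient

/-- The symmetrized data of an admissible loss. -/
structure IsLossData (K : Set (E n)) (L β : ℝ) (F : Hist n H → ℝ)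
    (S : Hist n H →L[ℝ] Hist n H) (b : Hist n H) (c : ℝ) : Prop where
  eqOn : EqOn F (quad S b c) (histSet K H)
  symm : ∀ v w, inner ℝ (S v) w = inner ℝ v (S w)
  nonneg : ∀ v, 0 ≤ inner ℝ v (S v)
  le_beta : ∀ v, inner ℝ v (S v) ≤ β * ‖v‖ ^ 2
  norm_gradient_le : ∀ w ∈ histSet K H, ‖(2 : ℝ) • S w + b‖ ≤ L

/-- A loss is constrained only on K^H, so its quadratic data are probed by finite differences around
a diagonal point with interior entries. -/
theorem exists_pos_add_smul_mem {K : Set (E n)} {x₀ : E n} (hx₀ : x₀ ∈ interior K)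
    (v : Hist n H) : ∃ ε : ℝ, 0 < ε ∧ ∀ r : ℝ, |r| ≤ ε → diag H x₀ + r • v ∈ histSet K H := by
  obtain ⟨δ, hδ, hball⟩ := Metric.isOpen_iff.1 isOpen_interior x₀ hx₀
  refine ⟨δ / (2 * (‖v‖ + 1)), by positivity, fun r hr j => interior_subset (hball ?_)⟩
  change x₀ + r • v j ∈ _
  rw [Metric.mem_ball, dist_eq_norm, add_sub_cancel_left, norm_smul, Real.norm_eq_abs]
  have h1 : ‖v j‖ ≤ ‖v‖ := PiLp.norm_apply_le v j
  calc |r| * ‖v j‖ ≤ δ / (2 * (‖v‖ + 1)) * (‖v‖ + 1) := by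
        gcongr; linarith
    _ = δ / 2 := by field_simp
    _ < δ := by linarith

/-- The given W need not be symmetric, but symmetrizing does not change the function. Midpoint
convexity along ±εv at an interior diagonal point shows that the form is nonnegative in every
direction v. -/
theorem IsAdmissibleLoss.exists_lossData {K : Set (E n)} (hK : (interior K).Nonempty)
    {B L β : ℝ} {F : Hist n H → ℝ} (hF : IsAdmissibleLoss K B L β F) :
    ∃ (S : Hist n H →L[ℝ] Hist n H) (b : Hist n H) (c : ℝ), IsLossData K L β F S b c := by
  obtain ⟨W, b, c, h1, h2, h3⟩ := hF.quadratic
  set S : Hist n H →L[ℝ] Hist n H := (2⁻¹ : ℝ) • (W + W.adjoint) with hS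
  have hSW : ∀ v, inner ℝ v (S v) = inner ℝ v (W v) := by
    intro v
    simp only [hS, smul_apply, add_apply, inner_smul_right, inner_add_right,
      ContinuousLinearMap.adjoint_inner_right]
    rw [real_inner_comm]
    ring
  have hquad : ∀ w, quad W b c w = quad S b c w := by intro w; simp only [quad, hSW]
  have hsymm : ∀ v w, inner ℝ (S v) w = inner ℝ v (S w) := by
    intro v w
    simp only [hS, smul_apply, add_apply, inner_smul_right, inner_add_right,
      inner_smul_left, inner_add_left, ContinuousLinearMap.adjoint_inner_right,
      ContinuousLinearMap.adjoint_inner_left, conj_trivial]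
    ring
  have heq : EqOn F (quad S b c) (histSet K H) := fun w hw => (h1 hw).trans (hquad w)
  refine ⟨S, b, c, heq, hsymm, fun v => ?_, fun v => (hSW v).trans_le (h2 v), fun w hw => ?_⟩
  · obtain ⟨x₀, hx₀⟩ := hK
    obtain ⟨ε, hε, hmem⟩ := exists_pos_add_smul_mem hx₀ v
    have m1 := hmem ε (abs_of_pos hε).le
    have m2 := hmem (-ε) (by rw [abs_neg, abs_of_pos hε])
    have m0 := hmem 0 (by simpa using hε.le)
    rw [zero_smul, add_zero] at m0
    have hconv := hF.convexOn.2 m1 m2 (by norm_num : (0 : ℝ) ≤ 2⁻¹) (by norm_num : (0 : ℝ) ≤ 2⁻¹)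
      (by norm_num)
    have e : (2⁻¹ : ℝ) • (diag H x₀ + ε • v) + (2⁻¹ : ℝ) • (diag H x₀ + -ε • v) = diag H x₀ := by
      module
    rw [e, heq m0, heq m1, heq m2, quad_add hsymm, quad_add hsymm] at hconv
    simp only [inner_smul_right, inner_smul_left, map_smul, smul_eq_mul, conj_trivial] at hconv
    have : 0 ≤ ε ^ 2 * inner ℝ v (S v) := by linarith
    exact nonneg_of_mul_nonneg_right this (by positivity)
  · have h4 := h3 w hw
    rw [gradient_quad] at h4
    have : (2 : ℝ) • S w + b = W w + W.adjoint w + b := by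
      simp only [hS, smul_apply, add_apply, smul_smul]
      norm_num
    rwa [this]

/-- Polarization: on unit vectors, four times the bilinear value is the difference of two numbers in
[0, 4β] by the parallelogram law. -/
theorem IsLossData.abs_inner_le {K : Set (E n)} {L β : ℝ} {F : Hist n H → ℝ}
    {S : Hist n H →L[ℝ] Hist n H} {b : Hist n H} {c : ℝ} (h : IsLossData K L β F S b c)
    (hβ : 0 ≤ β) (v w : Hist n H) : |inner ℝ (S v) w| ≤ β * ‖v‖ * ‖w‖ := by
  have unit : ∀ v w : Hist n H, ‖v‖ = 1 → ‖w‖ = 1 → |inner ℝ (S v) w| ≤ β := by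
    intro v w hv hw
    have hpol : inner ℝ (v + w) (S (v + w)) - inner ℝ (v - w) (S (v - w)) =
        4 * inner ℝ (S v) w := by
      simp only [map_add, map_sub, inner_add_left, inner_add_right, inner_sub_left, inner_sub_right]
      rw [← h.symm v w, real_inner_comm (S v) w]
      ring
    have hpar := parallelogram_law_with_norm ℝ v w
    rw [hv, hw] at hpar
    have a1 := h.le_beta (v + w)
    have a2 := h.le_beta (v - w)
    have a3 := h.nonneg (v + w)
    have a4 := h.nonneg (v - w)
    have a5 : β * ‖v + w‖ ^ 2 ≤ β * 4 := mul_le_mul_of_nonneg_left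
      (by nlinarith [mul_self_nonneg ‖v - w‖]) hβ
    have a6 : β * ‖v - w‖ ^ 2 ≤ β * 4 := mul_le_mul_of_nonneg_left
      (by nlinarith [mul_self_nonneg ‖v + w‖]) hβ
    rw [abs_le]
    constructor <;> linarith
  rcases eq_or_ne v 0 with rfl | hv
  · simp
  rcases eq_or_ne w 0 with rfl | hw
  · simp
  have hv' := norm_pos_iff.2 hv
  have hw' := norm_pos_iff.2 hw
  have h1 := unit (‖v‖⁻¹ • v) (‖w‖⁻¹ • w) (by rw [norm_smul]; simp [hv])
    (by rw [norm_smul]; simp [hw])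
  rw [map_smul, inner_smul_left, inner_smul_right, conj_trivial, abs_mul, abs_mul,
    abs_of_pos (inv_pos.2 hv'), abs_of_pos (inv_pos.2 hw'), inv_mul_le_iff₀ hv',
    inv_mul_le_iff₀ hw'] at h1
  linarith

end Quadratic

/-! ### Averaging a quadratic over the exploration noise. -/

section Estimator

variable {n H : ℕ}

/-- The perturbation `(A_0 u_0, …, A_{H-1} u_{H-1})` of a history. -/
def perturb (A : Fin H → E n →L[ℝ] E n) (u : Fin H → UnitSphere n) : Hist n H :=
  WithLp.toLp 2 fun j => A j (u j : E n)

theorem continuous_perturb (A : Fin H → E n →L[ℝ] E n) : Continuous (perturb A) := by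
  refine (PiLp.continuous_toLp 2 _).comp ?_
  fun_prop

theorem perturb_neg (A : Fin H → E n →L[ℝ] E n) (u : Fin H → UnitSphere n) :
    perturb A (-u) = -perturb A u := by
  ext j : 1
  change A j ((-u j : UnitSphere n) : E n) = -(A j (u j : E n))
  simp

theorem inner_perturb (A : Fin H → E n →L[ℝ] E n) (u : Fin H → UnitSphere n) (w : Hist n H) :
    inner ℝ w (perturb A u) = ∑ j, inner ℝ (w j) (A j (u j : E n)) := by
  rw [PiLp.inner_apply]; rfl

theorem norm_perturb_sq (A : Fin H → E n →L[ℝ] E n) (u : Fin H → UnitSphere n) :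
    ‖perturb A u‖ ^ 2 = ∑ j, ‖A j (u j : E n)‖ ^ 2 := by
  rw [PiLp.norm_sq_eq_of_L2]; rfl

/-- The linear term is odd and averages out; the quadratic one is at most β times the squared
exploration radii. -/
theorem integral_quad_perturb_le (hn : 1 ≤ n) {S : Hist n H →L[ℝ] Hist n H}
    (hS : ∀ v w, inner ℝ (S v) w = inner ℝ v (S w)) {β : ℝ} (hβ : 0 ≤ β)
    (hSβ : ∀ v, inner ℝ v (S v) ≤ β * ‖v‖ ^ 2) (b : Hist n H) (c : ℝ) (w : Hist n H)
    (A : Fin H → E n →L[ℝ] E n) (a : Fin H → ℝ)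
    (hA : ∀ j, ∀ v : E n, ‖v‖ = 1 → ‖A j v‖ ^ 2 ≤ a j) :
    ∫ u, quad S b c (w + perturb A u) ∂(noiseLaw n H) ≤ quad S b c w + β * ∑ j, a j := by
  have hP := isProbabilityMeasure_noiseLaw hn H
  have hc := continuous_perturb A
  have hlin : Continuous fun u => inner ℝ ((2 : ℝ) • S w + b) (perturb A u) := by fun_prop
  have hquad : Continuous fun u => inner ℝ (perturb A u) (S (perturb A u)) := by fun_prop
  simp only [quad_add hS]
  rw [integral_add (integrable_of_continuous_compact (by fun_prop))
    (integrable_of_continuous_compact hquad),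
    integral_add (integrable_const _) (integrable_of_continuous_compact hlin),
    integral_noiseLaw_odd hn hlin (fun u => by rw [perturb_neg, inner_neg_right])]
  simp only [integral_const, probReal_univ, one_smul, add_zero]
  gcongr
  have h1 : ∀ u, inner ℝ (perturb A u) (S (perturb A u)) ≤ β * ∑ j, a j := by
    intro u
    refine (hSβ _).trans (mul_le_mul_of_nonneg_left ?_ hβ)
    rw [norm_perturb_sq]
    exact Finset.sum_le_sum fun j _ => hA j _ (by simp)
  calc ∫ u, inner ℝ (perturb A u) (S (perturb A u)) ∂(noiseLaw n H)
      ≤ ∫ _u, β * ∑ j, a j ∂(noiseLaw n H) :=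
        integral_mono (integrable_of_continuous_compact hquad) (integrable_const _) h1
    _ = β * ∑ j, a j := by simp

/-- The one-point gradient estimator is unbiased for quadratic losses. -/
theorem integral_estimator (hn : 1 ≤ n) {S : Hist n H →L[ℝ] Hist n H}
    (hS : ∀ v w, inner ℝ (S v) w = inner ℝ v (S w)) (b : Hist n H) (c : ℝ) (w : Hist n H)
    (A A' : Fin H → E n →L[ℝ] E n) (hAsymm : ∀ j v w, inner ℝ (A j v) w = inner ℝ v (A j w))
    (hAsymm' : ∀ j v w, inner ℝ (A' j v) w = inner ℝ v (A' j w))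
    (hAA : ∀ j v, A j (A' j v) = v) (v : E n) :
    ∫ u, (n * quad S b c (w + perturb A u)) * (∑ j, inner ℝ (A' j (u j : E n)) v) ∂(noiseLaw n H) =
      inner ℝ ((2 : ℝ) • S w + b) (diag H v) := by
  have hP := isProbabilityMeasure_noiseLaw hn H
  have hn0 : (n : ℝ) ≠ 0 := by positivity
  set G := (2 : ℝ) • S w + b with hG
  have hc := continuous_perturb A
  have hsum : Continuous fun u : Fin H → UnitSphere n => ∑ j, inner ℝ (A' j (u j : E n)) v := by
    fun_prop
  have hodd : ∀ u : Fin H → UnitSphere n,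
      ∑ j, inner ℝ (A' j ((-u) j : E n)) v = -∑ j, inner ℝ (A' j (u j : E n)) v := by
    intro u
    rw [← Finset.sum_neg_distrib]
    refine Finset.sum_congr rfl fun j _ => ?_
    rw [← inner_neg_left, ← map_neg]
    simp
  -- The first product is an even function times an odd one and integrates to zero. In the second, n
  -- times the covariance of the two linear forms remains, where A_j cancels A'_j.
  have hsplit : ∀ u, (n * quad S b c (w + perturb A u)) * (∑ j, inner ℝ (A' j (u j : E n)) v) =
      n * ((quad S b c w + inner ℝ (perturb A u) (S (perturb A u))) *
        (∑ j, inner ℝ (A' j (u j : E n)) v)) +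
      n * ((∑ j, inner ℝ (A j (G j)) (u j : E n)) *
        (∑ j, inner ℝ (A' j v) (u j : E n))) := by
    intro u
    rw [quad_add hS, ← hG, inner_perturb]
    have e1 : ∑ j, inner ℝ (A j (G j)) (u j : E n) = ∑ j, inner ℝ (G j) (A j (u j : E n)) :=
      Finset.sum_congr rfl fun j _ => hAsymm j _ _
    have e2 : ∑ j, inner ℝ (A' j v) (u j : E n) = ∑ j, inner ℝ (A' j (u j : E n)) v :=
      Finset.sum_congr rfl fun j _ => by rw [hAsymm', real_inner_comm]
    rw [e1, e2]
    ring
  simp only [hsplit]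
  rw [integral_add (integrable_of_continuous_compact (by fun_prop))
    (integrable_of_continuous_compact (by fun_prop)), integral_const_mul, integral_const_mul,
    integral_noiseLaw_odd hn (by fun_prop), integral_noiseLaw_inner_mul_inner hn]
  · rw [mul_zero, zero_add, mul_div_cancel₀ _ hn0, PiLp.inner_apply]
    refine Finset.sum_congr rfl fun j _ => ?_
    rw [hAsymm, hAA]
    rfl
  · intro u
    rw [hodd, perturb_neg, map_neg, inner_neg_neg]
    ring

end Estimator

/-! ### Measurability of implicitly defined quantities. -/

section Measurability

variable {Ω : Type*}

/-- Lusin–Souslin: an injective continuous map sends Borel sets of a Polish space to Borel sets.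
This turns implicit definitions, by optimality or by a square root, into measurable ones. -/
theorem measurable_of_comp_injOn {m : MeasurableSpace Ω} {X Y : Type*} [TopologicalSpace X]
    [PolishSpace X] [MeasurableSpace X] [BorelSpace X] [TopologicalSpace Y] [T2Space Y]
    [MeasurableSpace Y] [OpensMeasurableSpace Y] {f : X → Y} {s : Set X} (hs : MeasurableSet s)
    (hf : ContinuousOn f s) (hinj : InjOn f s) {Z : Ω → X} (hZ : ∀ ω, Z ω ∈ s)
    (h : Measurable fun ω => f (Z ω)) : Measurable Z := by
  intro v hv
  have h1 : Z ⁻¹' v = (fun ω => f (Z ω)) ⁻¹' (f '' (s ∩ v)) := by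
    ext ω
    constructor
    · exact fun hω => ⟨Z ω, ⟨hZ ω, hω⟩, rfl⟩
    · rintro ⟨a, ⟨ha, hav⟩, hae⟩
      have : a = Z ω := hinj ha (hZ ω) hae
      rwa [this] at hav
  rw [h1]
  exact h ((hs.inter hv).image_of_continuousOn_injOn (hf.mono inter_subset_left)
    (hinj.mono inter_subset_left))

theorem measurable_comp_of_continuousOn {m : MeasurableSpace Ω} {X Y : Type*} [TopologicalSpace X]
    [MeasurableSpace X] [BorelSpace X] [TopologicalSpace Y] [MeasurableSpace Y] [BorelSpace Y]
    {f : X → Y} {s : Set X} (hf : ContinuousOn f s) {Z : Ω → X} (hZ : ∀ ω, Z ω ∈ s)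
    (h : Measurable Z) : Measurable fun ω => f (Z ω) :=
  (continuousOn_iff_continuous_domRestrict.1 hf).measurable.comp (h.subtype_mk (h := hZ))

variable {n : ℕ} {K : Set (E n)} {ν : ℝ} {R : E n → ℝ}

theorem measurable_hess_comp (hR : IsSelfConcordantBarrier K ν R) {m : MeasurableSpace Ω}
    {Z : Ω → E n} (hZ : ∀ ω, Z ω ∈ interior K) (h : Measurable Z) :
    Measurable fun ω => hess R (Z ω) :=
  measurable_comp_of_continuousOn
    (fun _ hx => (hR.contDiffAt_hess hx).continuousAt.continuousWithinAt) hZ h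

theorem isClosed_setOf_isPositive : IsClosed {A : E n →L[ℝ] E n | A.IsPositive} := by
  have h1 : {A : E n →L[ℝ] E n | A.IsPositive} =
      (⋂ v, ⋂ w, {A : E n →L[ℝ] E n | inner ℝ (A v) w = inner ℝ v (A w)}) ∩
        ⋂ v, {A : E n →L[ℝ] E n | 0 ≤ inner ℝ (A v) v} := by
    ext A
    simp only [mem_inter_iff, mem_iInter]
    exact ContinuousLinearMap.isPositive_iff A
  rw [h1]
  refine IsClosed.inter (isClosed_iInter fun v => isClosed_iInter fun w => ?_)
    (isClosed_iInter fun v => ?_)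
  · exact isClosed_eq (by fun_prop) (by fun_prop)
  · exact isClosed_le (by fun_prop) (by fun_prop)

theorem isInvSqrt_ringInverse {A : E n →L[ℝ] E n} (hA : A.IsPositive) (hu : IsUnit A) :
    IsInvSqrt A (Ring.inverse (A * A)) :=
  ⟨hA, Ring.mul_inverse_cancel _ (hu.mul hu)⟩

theorem IsInvSqrt.isUnit {A M : E n →L[ℝ] E n} (h : IsInvSqrt A M) : IsUnit A := by
  have h1 : A * A.inverse = 1 := by ext1 w; exact h.apply_inverse w
  have h2 : A.inverse * A = 1 := by ext1 w; exact h.inverse_apply w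
  exact ⟨⟨A, A.inverse, h1, h2⟩, rfl⟩

/-- On invertible positive operators A ↦ (A²)⁻¹ is continuous, and it is injective by uniqueness of
the positive root; its value at A is M. -/
theorem measurable_of_isInvSqrt {m : MeasurableSpace Ω} {A M : Ω → E n →L[ℝ] E n}
    (h : ∀ ω, IsInvSqrt (A ω) (M ω)) (hM : Measurable M) : Measurable A := by
  refine measurable_of_comp_injOn (f := fun A : E n →L[ℝ] E n => Ring.inverse (A * A))
    (s := {A | A.IsPositive} ∩ {A | IsUnit A})
    (isClosed_setOf_isPositive.measurableSet.inter Units.isOpen.measurableSet) ?_ ?_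
    (fun ω => ⟨(h ω).1, (h ω).isUnit⟩) ?_
  · rintro A ⟨-, hu⟩
    obtain ⟨U, hU⟩ := IsUnit.mul hu hu
    have h1 : ContinuousAt (fun A : E n →L[ℝ] E n => A * A) A := by fun_prop
    have h2 := NormedRing.inverse_continuousAt U
    rw [hU] at h2
    exact (ContinuousAt.comp (f := fun A : E n →L[ℝ] E n => A * A) h2 h1).continuousWithinAt
  · rintro A ⟨hA, hAu⟩ A' ⟨hA', hAu'⟩ he
    have h1 := isInvSqrt_ringInverse hA hAu
    have h2 := isInvSqrt_ringInverse hA' hAu'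
    simp only at he
    rw [he] at h1
    exact h1.unique h2
  · convert hM using 2 with ω
    have h1 : A ω * A ω * M ω = 1 := (h ω).2
    have hu := (h ω).isUnit.mul (h ω).isUnit
    calc Ring.inverse (A ω * A ω) = Ring.inverse (A ω * A ω) * (A ω * A ω * M ω) := by
          rw [h1, mul_one]
      _ = M ω := by rw [← mul_assoc, Ring.inverse_mul_cancel _ hu, one_mul]

theorem measurable_clm_apply {m : MeasurableSpace Ω} {A : Ω → E n →L[ℝ] E n} {v : Ω → E n}
    (hA : Measurable A) (hv : Measurable v) : Measurable fun ω => A ω (v ω) := by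
  have : Continuous fun p : (E n →L[ℝ] E n) × E n => p.1 p.2 := by fun_prop
  exact this.measurable.comp (hA.prodMk hv)

theorem measurable_inverse_of_isInvSqrt {m : MeasurableSpace Ω} {A M : Ω → E n →L[ℝ] E n}
    (h : ∀ ω, IsInvSqrt (A ω) (M ω)) (hM : Measurable M) : Measurable fun ω => (A ω).inverse := by
  have h1 : (fun ω => (A ω).inverse) = fun ω => (A ω) ∘L (M ω) := by
    funext ω; exact (h ω).inverse_eq
  rw [h1]
  have : Continuous fun p : (E n →L[ℝ] E n) × (E n →L[ℝ] E n) => p.1 ∘L p.2 := by fun_prop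
  exact this.measurable.comp ((measurable_of_isInvSqrt h hM).prodMk hM)

variable {H : ℕ} {L β : ℝ} {F : Ω → Hist n H → ℝ} {S : Ω → Hist n H →L[ℝ] Hist n H}
  {b : Ω → Hist n H} {c : Ω → ℝ}

theorem quadratic_eq_finite_differences {ε : ℝ} (hε : ε ≠ 0) (q l r : ℝ) :
    q + l + r = q + (q + ε * l + ε * (ε * r) - (q + -ε * l + -ε * (-ε * r))) / (2 * ε) +
      (q + ε * l + ε * (ε * r) + (q + -ε * l + -ε * (-ε * r)) - 2 * q) / (2 * ε ^ 2) := by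
  field_simp
  ring

theorem quad_eq_finite_differences {S : Hist n H →L[ℝ] Hist n H}
    (hS : ∀ v w, inner ℝ (S v) w = inner ℝ v (S w)) (b : Hist n H) (c : ℝ) (w v : Hist n H)
    {ε : ℝ} (hε : ε ≠ 0) :
    quad S b c (w + v) = quad S b c w +
      (quad S b c (w + ε • v) - quad S b c (w + -ε • v)) / (2 * ε) +
      (quad S b c (w + ε • v) + quad S b c (w + -ε • v) - 2 * quad S b c w) / (2 * ε ^ 2) := by
  have h1 : ∀ r : ℝ, quad S b c (w + r • v) =
      quad S b c w + r * inner ℝ ((2 : ℝ) • S w + b) v + r * (r * inner ℝ v (S v)) := by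
    intro r
    rw [quad_add hS, inner_smul_right, map_smul, inner_smul_right, real_inner_smul_left]
  rw [h1, h1, quad_add hS]
  exact quadratic_eq_finite_differences hε _ _ _

/-- A quadratic function is determined by its values on `K^H`, through finite differences; hence
its values at any point are measurable as soon as those on `K^H` are. -/
theorem measurable_quad {m : MeasurableSpace Ω} (hK : (interior K).Nonempty)
    (hF : ∀ ω, IsLossData K L β (F ω) (S ω) (b ω) (c ω))
    (hm : ∀ w ∈ histSet K H, Measurable fun ω => F ω w) (w : Hist n H) :
    Measurable fun ω => quad (S ω) (b ω) (c ω) w := by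
  obtain ⟨x₀, hx₀⟩ := hK
  obtain ⟨v, rfl⟩ : ∃ v, w = diag H x₀ + v := ⟨w - diag H x₀, by abel⟩
  obtain ⟨ε, hε, hmem⟩ := exists_pos_add_smul_mem hx₀ v
  have hq : ∀ r : ℝ, |r| ≤ ε →
      Measurable fun ω => quad (S ω) (b ω) (c ω) (diag H x₀ + r • v) := fun r hr =>
    by
    have h1 : (fun ω => quad (S ω) (b ω) (c ω) (diag H x₀ + r • v)) =
        fun ω => F ω (diag H x₀ + r • v) := funext fun ω => ((hF ω).eqOn (hmem r hr)).symm
    rw [h1]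
    exact hm _ (hmem r hr)
  have m1 := hq ε (abs_of_pos hε).le
  have m2 := hq (-ε) (by rw [abs_neg, abs_of_pos hε])
  have m0 := hq 0 (by simpa using hε.le)
  simp only [zero_smul, add_zero] at m0
  have h1 := fun ω => quad_eq_finite_differences (hF ω).symm (b ω) (c ω) (diag H x₀) v hε.ne'
  simp only [h1]
  exact (m0.add ((m1.sub m2).div_const _)).add (((m1.add m2).sub (m0.const_mul 2)).div_const _)

theorem measurable_uncurry_quad {m : MeasurableSpace Ω}
    (hq : ∀ w, Measurable fun ω => quad (S ω) (b ω) (c ω) w) :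
    Measurable (Function.uncurry fun (w : Hist n H) (ω : Ω) => quad (S ω) (b ω) (c ω) w) := by
  refine measurable_uncurry_of_continuous_of_measurable ?_ ?_
  · exact fun ω => continuous_quad (S ω) (b ω) (c ω)
  · exact hq

theorem measurable_quad_comp {m : MeasurableSpace Ω} {X : Type*} [MeasurableSpace X]
    (hq : ∀ w, Measurable fun ω => quad (S ω) (b ω) (c ω) w)
    {Z : X → Ω} (hZ : Measurable Z) {w : X → Hist n H} (hw : Measurable w) :
    Measurable fun a => quad (S (Z a)) (b (Z a)) (c (Z a)) (w a) := by
  have h1 := hw.prodMk hZ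
  have h2 := (measurable_uncurry_quad hq).comp h1
  exact h2

theorem measurable_hist {m : MeasurableSpace Ω} {w : Fin H → Ω → E n}
    (hw : ∀ j, Measurable (w j)) : Measurable fun ω => (WithLp.toLp 2 fun j => w j ω : Hist n H) :=
  (WithLp.measurable_toLp 2 _).comp (measurable_pi_lambda _ hw)

theorem continuous_diag : Continuous (diag (n := n) H) := by
  refine (PiLp.continuous_toLp 2 _).comp ?_
  fun_prop

/-- Integration with respect to independent random variables. -/
theorem integral_comp_of_indepFun {mΩ : MeasurableSpace Ω} {P : Measure Ω} [IsProbabilityMeasure P]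
    {X Y : Type*} [MeasurableSpace X] [MeasurableSpace Y] {Z : Ω → X} {U : Ω → Y}
    (hZ : Measurable Z) (hU : Measurable U) (hind : IndepFun Z U P) {Ψ : X × Y → ℝ}
    (hΨ : Measurable Ψ) {C : ℝ} (hC : ∀ ω v, |Ψ (Z ω, v)| ≤ C) :
    ∫ ω, Ψ (Z ω, U ω) ∂P = ∫ ω, (∫ v, Ψ (Z ω, v) ∂(P.map U)) ∂P := by
  have hmap := (indepFun_iff_map_prod_eq_prod_map_map hZ.aemeasurable hU.aemeasurable).1 hind
  have hP1 : IsProbabilityMeasure (P.map Z) := Measure.isProbabilityMeasure_map hZ.aemeasurable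
  have hP2 : IsProbabilityMeasure (P.map U) := Measure.isProbabilityMeasure_map hU.aemeasurable
  have h1 : ∫ ω, Ψ (Z ω, U ω) ∂P = ∫ p, Ψ p ∂((P.map Z).prod (P.map U)) := by
    rw [← hmap]
    exact (integral_map (hZ.prodMk hU).aemeasurable hΨ.aestronglyMeasurable).symm
  have hset : MeasurableSet {p : X × Y | |Ψ p| ≤ C} :=
    measurableSet_le hΨ.abs measurable_const
  have hint : Integrable Ψ ((P.map Z).prod (P.map U)) := by
    refine Integrable.of_bound hΨ.aestronglyMeasurable C ?_
    simp only [Real.norm_eq_abs]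
    rw [← hmap, ae_map_iff (hZ.prodMk hU).aemeasurable hset]
    exact ae_of_all _ fun ω => hC ω _
  rw [h1, integral_prod _ hint]
  exact integral_map hZ.aemeasurable
    (hΨ.stronglyMeasurable.integral_prod_right' (ν := P.map U)).aestronglyMeasurable

end Measurability

/-! ### Information available in each round. -/

section SigmaAlgebras

variable {Ω : Type*} {n H : ℕ} {K : Set (E n)} {u : ℕ → Ω → UnitSphere n}
  {F : ℕ → Ω → Hist n H → ℝ}

theorem noiseSigma_mono {a b a' b' : ℕ} (ha : a' ≤ a) (hb : b ≤ b') :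
    noiseSigma u a b ≤ noiseSigma u a' b' :=
  biSup_mono fun _ hs => by
    rw [Finset.mem_Icc] at hs ⊢; omega

theorem measurable_noiseSigma {a b s : ℕ} (hs : s ∈ Finset.Icc a b) :
    Measurable[noiseSigma u a b] (u s) := by
  have h1 : MeasurableSpace.comap (u s) inferInstance ≤ noiseSigma u a b :=
    le_biSup (fun s => MeasurableSpace.comap (u s) inferInstance) hs
  exact Measurable.mono (comap_measurable (u s)) h1 le_rfl

theorem measurable_lossSigma {f : Ω → Hist n H → ℝ} {w : Hist n H} (hw : w ∈ histSet K H) :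
    Measurable[lossSigma K f] fun ω => f ω w := by
  have h1 : MeasurableSpace.comap (fun ω => f ω w) inferInstance ≤ lossSigma K f :=
    le_biSup (fun w => MeasurableSpace.comap (fun ω => f ω w) inferInstance) hw
  exact Measurable.mono (comap_measurable _) h1 le_rfl

theorem pastSigma_mono {s t : ℕ} (hst : s ≤ t) : pastSigma K u F s ≤ pastSigma K u F t := by
  refine sup_le_sup (noiseSigma_mono le_rfl (by omega)) (biSup_mono fun r hr => ?_)
  rw [Finset.mem_Icc] at hr ⊢
  omega

theorem lossSigma_le_pastSigma {s t : ℕ} (hs : s ∈ Finset.Icc H (t - H)) :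
    lossSigma K (F s) ≤ pastSigma K u F t :=
  (le_biSup (fun s => lossSigma K (F s)) hs).trans le_sup_right

theorem measurable_noise_pastSigma {s t : ℕ} (hs : s ∈ Finset.Icc 1 (t - H)) :
    Measurable[pastSigma K u F t] (u s) :=
  Measurable.mono (measurable_noiseSigma hs) le_sup_left le_rfl

theorem noiseSigma_le [m : MeasurableSpace Ω] {a b : ℕ}
    (hu : ∀ s ∈ Finset.Icc a b, Measurable (u s)) : noiseSigma u a b ≤ m :=
  iSup₂_le fun s hs => (hu s hs).comap_le

theorem lossSigma_le [m : MeasurableSpace Ω] {f : Ω → Hist n H → ℝ}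
    (hf : ∀ w ∈ histSet K H, Measurable fun ω => f ω w) : lossSigma K f ≤ m :=
  iSup₂_le fun w hw => (hf w hw).comap_le

theorem pastSigma_le [m : MeasurableSpace Ω] {t : ℕ}
    (hu : ∀ s ∈ Finset.Icc 1 (t - H), Measurable (u s))
    (hF : ∀ s ∈ Finset.Icc H (t - H), ∀ w ∈ histSet K H, Measurable fun ω => F s ω w) :
    pastSigma K u F t ≤ m :=
  sup_le (noiseSigma_le hu) (iSup₂_le fun s hs => lossSigma_le (hF s hs))

end SigmaAlgebras

/-- A random trajectory of the algorithm, with quadratic data for the losses. -/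
structure RandomRun {Ω : Type*} {n : ℕ} (K : Set (E n)) (ν : ℝ) (R : E n → ℝ)
    (σ η B L β : ℝ) (H T : ℕ) (F : ℕ → Ω → Hist n H → ℝ) (u : ℕ → Ω → UnitSphere n)
    (x : ℕ → Ω → E n) (A : ℕ → Ω → E n →L[ℝ] E n) (y g : ℕ → Ω → E n)
    (S : ℕ → Ω → Hist n H →L[ℝ] Hist n H) (b : ℕ → Ω → Hist n H) (c : ℕ → Ω → ℝ) : Prop where
  run : ∀ ω, BoundedRun K ν R σ η B H T (fun t => F t ω) (fun t => u t ω) (fun t => x t ω)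
    (fun t => A t ω) (fun t => y t ω) (fun t => g t ω)
  data : ∀ t ∈ Finset.Icc H T, ∀ ω, IsLossData K L β (F t ω) (S t ω) (b t ω) (c t ω)
  nonempty : (interior K).Nonempty

namespace RandomRun

variable {Ω : Type*} {n : ℕ} {K : Set (E n)} {ν : ℝ} {R : E n → ℝ}
    {σ η B L β : ℝ} {H T : ℕ} {F : ℕ → Ω → Hist n H → ℝ} {u : ℕ → Ω → UnitSphere n}
    {x : ℕ → Ω → E n} {A : ℕ → Ω → E n →L[ℝ] E n} {y g : ℕ → Ω → E n}
    {S : ℕ → Ω → Hist n H →L[ℝ] Hist n H} {b : ℕ → Ω → Hist n H} {c : ℕ → Ω → ℝ}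

theorem measurable_hess (hr : RandomRun K ν R σ η B L β H T F u x A y g S b c)
    {m : MeasurableSpace Ω} {t : ℕ} (h1 : 1 ≤ t) (ht : t ≤ T) (hx : Measurable (x t)) :
    Measurable fun ω => hess R (x t ω) + (η * σ * t) • ContinuousLinearMap.id ℝ (E n) := by
  rcases isEmpty_or_nonempty Ω with hΩ | ⟨⟨ω₀⟩⟩
  · exact measurable_of_empty _
  · exact (measurable_hess_comp (hr.run ω₀).barrier (fun ω => (hr.run ω).mem_interior h1 ht)
      hx).add_const _

theorem measurable_explore (hr : RandomRun K ν R σ η B L β H T F u x A y g S b c)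
    {m : MeasurableSpace Ω} {t : ℕ} (h1 : 1 ≤ t) (ht : t ≤ T) (hx : Measurable (x t)) :
    Measurable (A t) :=
  measurable_of_isInvSqrt (fun ω => (hr.run ω).isInvSqrt h1 ht) (hr.measurable_hess h1 ht hx)

theorem measurable_explore_inverse (hr : RandomRun K ν R σ η B L β H T F u x A y g S b c)
    {m : MeasurableSpace Ω} {t : ℕ} (h1 : 1 ≤ t) (ht : t ≤ T) (hx : Measurable (x t)) :
    Measurable fun ω => (A t ω).inverse :=
  measurable_inverse_of_isInvSqrt (fun ω => (hr.run ω).isInvSqrt h1 ht)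
    (hr.measurable_hess h1 ht hx)

theorem measurable_play (hr : RandomRun K ν R σ η B L β H T F u x A y g S b c)
    {m : MeasurableSpace Ω} {t : ℕ} (h1 : 1 ≤ t) (ht : t ≤ T) (hx : Measurable (x t))
    (hu : Measurable (u t)) : Measurable (y t) := by
  have h2 : y t = fun ω => x t ω + A t ω (u t ω : E n) := by
    funext ω
    exact (hr.run ω).run.play t (Finset.mem_Icc.2 ⟨h1, ht.trans (le_max_right _ _)⟩)
  rw [h2]
  exact hx.add (measurable_clm_apply (hr.measurable_explore h1 ht hx) hu.subtype_val)

theorem loss_window_eq (hr : RandomRun K ν R σ η B L β H T F u x A y g S b c) {t : ℕ}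
    (h1 : H ≤ t) (ht : t ≤ T) (ω : Ω) :
    F t ω (window H (fun s => y s ω) t) =
      quad (S t ω) (b t ω) (c t ω) (window H (fun s => y s ω) t) :=
  (hr.data t (Finset.mem_Icc.2 ⟨h1, ht⟩) ω).eqOn ((hr.run ω).window_mem h1 ht)

theorem measurable_quad (hr : RandomRun K ν R σ η B L β H T F u x A y g S b c)
    {m : MeasurableSpace Ω} {t : ℕ} (h1 : H ≤ t) (ht : t ≤ T) (hF : lossSigma K (F t) ≤ m)
    (w : Hist n H) : Measurable fun ω => quad (S t ω) (b t ω) (c t ω) w :=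
  EBCO.measurable_quad hr.nonempty (hr.data t (Finset.mem_Icc.2 ⟨h1, ht⟩))
    (fun _ hw => (measurable_lossSigma hw).mono hF le_rfl) w

theorem measurable_loss_window (hr : RandomRun K ν R σ η B L β H T F u x A y g S b c)
    {m : MeasurableSpace Ω} {t : ℕ} (h1 : H ≤ t) (ht : t ≤ T) (hF : lossSigma K (F t) ≤ m)
    (hx : ∀ s, t + 1 - H ≤ s → s ≤ t → Measurable (x s))
    (hu : ∀ s, t + 1 - H ≤ s → s ≤ t → Measurable (u s)) :
    Measurable fun ω => F t ω (window H (fun s => y s ω) t) := by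
  have hy : ∀ j : Fin H, Measurable (y (t + 1 - H + (j : ℕ))) := fun j =>
    hr.measurable_play (by omega) (by omega) (hx _ (by omega) (by omega))
      (hu _ (by omega) (by omega))
  have h2 : Measurable fun ω => window H (fun s => y s ω) t := measurable_hist hy
  have h3 := measurable_quad_comp (hr.measurable_quad h1 ht hF) measurable_id h2
  have h4 : (fun ω => F t ω (window H (fun s => y s ω) t)) =
      fun ω => quad (S t ω) (b t ω) (c t ω) (window H (fun s => y s ω) t) :=
    funext fun ω => hr.loss_window_eq h1 ht ω
  rw [h4]
  exact h3

theorem measurable_grad (hr : RandomRun K ν R σ η B L β H T F u x A y g S b c)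
    {m : MeasurableSpace Ω} {t : ℕ} (h1 : H ≤ t) (ht : t ≤ T) (hF : lossSigma K (F t) ≤ m)
    (hx : ∀ s, t + 1 - H ≤ s → s ≤ t → Measurable (x s))
    (hu : ∀ s, t + 1 - H ≤ s → s ≤ t → Measurable (u s)) : Measurable (g t) := by
  have h2 : g t = fun ω => ((n : ℝ) * F t ω (window H (fun s => y s ω) t)) •
      ∑ i ∈ Finset.range H, (A (t - i) ω).inverse (u (t - i) ω : E n) := by
    funext ω
    exact (hr.run ω).run.grad t (Finset.mem_Icc.2 ⟨h1, ht⟩)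
  rw [h2]
  refine ((hr.measurable_loss_window h1 ht hF hx hu).const_mul _).smul
    (Finset.measurable_fun_sum _ fun i hi => ?_)
  rw [Finset.mem_range] at hi
  exact measurable_clm_apply (hr.measurable_explore_inverse (by omega) (by omega)
    (hx _ (by omega) (by omega))) (hu _ (by omega) (by omega)).subtype_val

/-- By induction, the optimality condition equates ∇R(x_t) + ησ(t - H)x_t with a combination of x_s
and g_s for s ≤ t - H, all known by then, and the map on the left is continuous and injective on the
interior. Thus x_t involves none of the H most recent noises. -/
theorem measurable_iterate (hr : RandomRun K ν R σ η B L β H T F u x A y g S b c) {t : ℕ}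
    (h1 : 1 ≤ t) (ht : t ≤ T) : Measurable[pastSigma K u F t] (x t) := by
  rcases isEmpty_or_nonempty Ω with hΩ | ⟨⟨ω₀⟩⟩
  · let _ : MeasurableSpace Ω := pastSigma K u F t
    exact measurable_of_empty _
  have hr₀ := hr.run ω₀
  have hH := hr₀.one_le_H
  induction t using Nat.strong_induction_on with
  | _ t ih =>
  rcases le_or_gt t H with htH | htH
  · let _ : MeasurableSpace Ω := pastSigma K u F t
    refine measurable_const' fun ω ω' => ?_
    refine eq_of_gradient_add_eq hr₀.barrier hr₀.convex hr₀.bounded le_rfl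
      ((hr.run ω).mem_interior h1 ht) ((hr.run ω').mem_interior h1 ht) ?_
    rw [(hr.run ω).gradient_init h1 htH, (hr.run ω').gradient_init h1 htH]
    simp
  · have hη := hr₀.eta_pos
    have hσ := hr₀.sigma_pos
    set a : ℝ := η * σ * (t - H : ℕ) with ha
    have hxs : ∀ s, 1 ≤ s → s < t → Measurable[pastSigma K u F t] (x s) := fun s hs1 hs2 =>
      (ih s hs2 hs1 (by omega)).mono (pastSigma_mono hs2.le) le_rfl
    have hgs : ∀ s, 1 ≤ s → s ≤ t - H → Measurable[pastSigma K u F t] (g s) := by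
      intro s hs1 hs2
      rcases lt_or_ge s H with hsH | hsH
      · let _ : MeasurableSpace Ω := pastSigma K u F t
        refine measurable_const' fun ω ω' => ?_
        rw [(hr.run ω).run.grad_init s (Finset.mem_Icc.2 ⟨hs1, by omega⟩),
          (hr.run ω').run.grad_init s (Finset.mem_Icc.2 ⟨hs1, by omega⟩)]
      · exact hr.measurable_grad hsH (by omega)
          (lossSigma_le_pastSigma (Finset.mem_Icc.2 ⟨hsH, hs2⟩))
          (fun r _ _ => hxs r (by omega) (by omega))
          (fun r _ _ => measurable_noise_pastSigma (Finset.mem_Icc.2 ⟨by omega, by omega⟩))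
    have hopt : ∀ ω, gradient R (x t ω) + a • x t ω = ∑ s ∈ Finset.Ico H t,
        ((η * σ) • x (s + 1 - H) ω - η • g (s + 1 - H) ω) := by
      intro ω
      refine ext_inner_right ℝ fun h => ?_
      have h2 := (hr.run ω).stationary htH.le ht h
      have h3 : a * inner ℝ (x t ω) h =
          ∑ s ∈ Finset.Ico H t, η * σ * inner ℝ (x t ω) h := by
        rw [Finset.sum_const, Nat.card_Ico, nsmul_eq_mul, ha]; ring
      rw [inner_add_left, real_inner_smul_left, h3, sum_inner]
      simp only [inner_sub_left, real_inner_smul_left] at h2 ⊢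
      have h4 : inner ℝ (gradient R (x t ω)) h = -(η * ∑ s ∈ Finset.Ico H t,
          (inner ℝ (g (s + 1 - H) ω) h +
            σ * (inner ℝ (x t ω) h - inner ℝ (x (s + 1 - H) ω) h))) := by
        rw [one_div] at h2
        have h5 := congrArg (fun r => η * r) h2
        simp only [mul_add, mul_zero] at h5
        rw [mul_inv_cancel_left₀ hη.ne'] at h5
        linarith
      rw [h4, Finset.mul_sum, ← Finset.sum_neg_distrib, ← Finset.sum_add_distrib]
      exact Finset.sum_congr rfl fun s _ => by ring
    refine measurable_of_comp_injOn (f := fun z => gradient R z + a • z) (s := interior K)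
      isOpen_interior.measurableSet ?_ ?_ (fun ω => (hr.run ω).mem_interior h1 ht) ?_
    · intro z hz
      exact ((contDiffAt_gradient (hr₀.barrier.contDiffAt hz)).continuousAt.add
        (by fun_prop)).continuousWithinAt
    · intro z hz z' hz' h
      exact eq_of_gradient_add_eq hr₀.barrier hr₀.convex hr₀.bounded (by positivity) hz hz' h
    · simp only [hopt]
      refine Finset.measurable_fun_sum _ fun s hs => ?_
      rw [Finset.mem_Ico] at hs
      exact ((hxs (s + 1 - H) (by omega) (by omega)).const_smul (η * σ)).sub
        ((hgs (s + 1 - H) (by omega) (by omega)).const_smul η)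

end RandomRun

/-! ### Losses near the diagonal. -/

section Diag

variable {n H : ℕ}

theorem diag_add (a b : E n) : diag H (a + b) = diag H a + diag H b := rfl

theorem diag_sub (a b : E n) : diag H (a - b) = diag H a - diag H b := rfl

theorem diag_smul (r : ℝ) (a : E n) : diag H (r • a) = r • diag H a := rfl

theorem norm_diag_sq (a : E n) : ‖diag H a‖ ^ 2 = H * ‖a‖ ^ 2 := by
  rw [PiLp.norm_sq_eq_of_L2]
  simp [diag]

theorem norm_diag_le (hH : 1 ≤ H) (a : E n) : ‖diag H a‖ ≤ H * ‖a‖ :=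
  norm_hist_le (norm_nonneg a) hH fun _ => le_rfl

theorem diag_mem {K : Set (E n)} {z : E n} (hz : z ∈ K) : diag H z ∈ histSet K H := fun _ => hz

/-- Comparison of a loss at a history near the diagonal with its value on the diagonal. -/
theorem IsLossData.quad_sub_le {K : Set (E n)} {L β : ℝ} {F : Hist n H → ℝ}
    {S : Hist n H →L[ℝ] Hist n H} {b : Hist n H} {c : ℝ} (h : IsLossData K L β F S b c)
    (hβ : 0 ≤ β) {w : Hist n H} (hw : w ∈ histSet K H) {x z : E n} :
    quad S b c w - quad S b c (diag H z) ≤ L * ‖w - diag H x‖ +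
      2 * (β * ‖w - diag H x‖ * ‖diag H (x - z)‖) +
      inner ℝ ((2 : ℝ) • S w + b) (diag H (x - z)) -
        inner ℝ (diag H (x - z)) (S (diag H (x - z))) := by
  have h1 : quad S b c w - quad S b c (diag H x) ≤ L * ‖w - diag H x‖ := by
    have e : diag H x = w + -(w - diag H x) := by abel
    have h2 := quad_add h.symm b c w (-(w - diag H x))
    rw [← e] at h2
    have h3 := h.nonneg (-(w - diag H x))
    have h4 := (real_inner_le_norm ((2 : ℝ) • S w + b) (w - diag H x)).trans
      (mul_le_mul_of_nonneg_right (h.norm_gradient_le w hw) (norm_nonneg _))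
    rw [inner_neg_right] at h2
    linarith
  have h2 : quad S b c (diag H x) - quad S b c (diag H z) =
      inner ℝ ((2 : ℝ) • S (diag H x) + b) (diag H (x - z)) -
        inner ℝ (diag H (x - z)) (S (diag H (x - z))) := by
    have e : diag H z = diag H x + -(diag H (x - z)) := by rw [diag_sub]; abel
    rw [e, quad_add h.symm, inner_neg_right, map_neg, inner_neg_neg]
    ring
  -- The estimator is unbiased for the gradient at w, not at the diagonal point; exchanging the two
  -- costs the Hessian applied to w - diag x.
  have h3 : inner ℝ ((2 : ℝ) • S (diag H x) + b) (diag H (x - z)) =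
      inner ℝ ((2 : ℝ) • S w + b) (diag H (x - z)) -
        2 * inner ℝ (S (w - diag H x)) (diag H (x - z)) := by
    simp only [inner_add_left, real_inner_smul_left, map_sub, inner_sub_left]
    ring
  have h4 := (neg_le_abs _).trans (h.abs_inner_le hβ (w - diag H x) (diag H (x - z)))
  linarith

end Diag

theorem integrable_of_abs_le {Ω : Type*} [MeasurableSpace Ω] {P : Measure Ω}
    [IsProbabilityMeasure P] {f : Ω → ℝ} {C : ℝ} (hf : Measurable f) (hC : ∀ ω, |f ω| ≤ C) :
    Integrable f P :=
  Integrable.of_bound hf.aestronglyMeasurable C (ae_of_all _ hC)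

/-! ### Integrating out the fresh noise. -/

namespace RandomRun

section Pathwise

variable {Ω : Type*}
    {n : ℕ} {K : Set (E n)} {ν : ℝ} {R : E n → ℝ}
    {σ η B L β : ℝ} {H T N : ℕ} {F : ℕ → Ω → Hist n H → ℝ} {u : ℕ → Ω → UnitSphere n}
    {x : ℕ → Ω → E n} {A : ℕ → Ω → E n →L[ℝ] E n} {y g : ℕ → Ω → E n}
    {S : ℕ → Ω → Hist n H →L[ℝ] Hist n H} {b : ℕ → Ω → Hist n H} {c : ℕ → Ω → ℝ}

/-- The window of the `H` most recent noises. -/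
def noiseWindow (H : ℕ) (u : ℕ → Ω → UnitSphere n) (t : ℕ) (ω : Ω) : Fin H → UnitSphere n :=
  fun j => u (t + 1 - H + (j : ℕ)) ω

/-- The window of the `H` most recent exploration matrices. -/
def exploreWindow (H : ℕ) (A : ℕ → Ω → E n →L[ℝ] E n) (t : ℕ) (ω : Ω) :
    Fin H → E n →L[ℝ] E n :=
  fun j => A (t + 1 - H + (j : ℕ)) ω

/-- The σ-algebra of everything that is known before the `H` most recent noises are drawn. -/
@[reducible] def knownSigma (K : Set (E n)) (u : ℕ → Ω → UnitSphere n)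
    (F : ℕ → Ω → Hist n H → ℝ) (t : ℕ) : MeasurableSpace Ω :=
  pastSigma K u F t ⊔ lossSigma K (F t)

theorem lossSigma_le_knownSigma (t : ℕ) : lossSigma K (F t) ≤ knownSigma K u F t := le_sup_right

theorem measurable_past (hr : RandomRun K ν R σ η B L β H T F u x A y g S b c)
    {m : MeasurableSpace Ω} {s t : ℕ} (hm : knownSigma K u F t ≤ m)
    (hs : 1 ≤ s) (hst : s ≤ t) (ht : t ≤ T) : Measurable (x s) :=
  (hr.measurable_iterate hs (hst.trans ht)).mono
    (((pastSigma_mono hst).trans le_sup_left).trans hm) le_rfl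

theorem window_play_eq (hr : RandomRun K ν R σ η B L β H T F u x A y g S b c) {t : ℕ}
    (h1 : H ≤ t) (ht : t ≤ T) (ω : Ω) :
    window H (fun s => y s ω) t =
      window H (fun s => x s ω) t + perturb (exploreWindow H A t ω) (noiseWindow H u t ω) := by
  ext j : 1
  exact (hr.run ω).run.play _ (Finset.mem_Icc.2 ⟨by omega, by
    have := j.2
    have := le_max_right H T
    omega⟩)

theorem window_add_perturb_mem (hr : RandomRun K ν R σ η B L β H T F u x A y g S b c) {t : ℕ}
    (h1 : H ≤ t) (ht : t ≤ T) (ω : Ω) (v : Fin H → UnitSphere n) :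
    window H (fun s => x s ω) t + perturb (exploreWindow H A t ω) v ∈ histSet K H := fun j =>
  ((hr.run ω).play_mem (t := t + 1 - H + (j : ℕ)) (by omega) (by omega)
    (v := (v j : E n)) (by simp)).1

theorem window_iterate_mem (hr : RandomRun K ν R σ η B L β H T F u x A y g S b c) {t : ℕ}
    (h1 : H ≤ t) (ht : t ≤ T) (ω : Ω) : window H (fun s => x s ω) t ∈ histSet K H := fun j =>
  interior_subset ((hr.run ω).mem_interior (t := t + 1 - H + (j : ℕ)) (by omega) (by omega))

theorem abs_quad_le (hr : RandomRun K ν R σ η B L β H T F u x A y g S b c) {t : ℕ}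
    (h1 : H ≤ t) (ht : t ≤ T) (ω : Ω) {w : Hist n H} (hw : w ∈ histSet K H) :
    0 ≤ quad (S t ω) (b t ω) (c t ω) w ∧ |quad (S t ω) (b t ω) (c t ω) w| ≤ B := by
  have hmem := Finset.mem_Icc.2 ⟨h1, ht⟩
  rw [← (hr.data t hmem ω).eqOn hw]
  have h0 := (hr.run ω).loss_nonneg t hmem w hw
  exact ⟨h0, by rw [abs_of_nonneg h0]; exact (hr.run ω).loss_le t hmem w hw⟩

theorem measurable_window_iterate (hr : RandomRun K ν R σ η B L β H T F u x A y g S b c)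
    {m : MeasurableSpace Ω} {t : ℕ} (hm : knownSigma K u F t ≤ m) (h1 : H ≤ t) (ht : t ≤ T) :
    Measurable fun ω => window H (fun s => x s ω) t :=
  measurable_hist fun j => hr.measurable_past hm (by omega) (by omega) ht

theorem measurable_quad_window (hr : RandomRun K ν R σ η B L β H T F u x A y g S b c)
    {m : MeasurableSpace Ω} {t : ℕ} (hm : knownSigma K u F t ≤ m) (h1 : H ≤ t) (ht : t ≤ T) :
    Measurable fun ω => quad (S t ω) (b t ω) (c t ω) (window H (fun s => x s ω) t) := by
  have h2 := measurable_quad_comp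
    (hr.measurable_quad h1 ht ((lossSigma_le_knownSigma t).trans hm)) measurable_id
    (hr.measurable_window_iterate hm h1 ht)
  exact h2

theorem measurable_quad_perturb (hr : RandomRun K ν R σ η B L β H T F u x A y g S b c)
    {m : MeasurableSpace Ω} {t : ℕ} (hm : knownSigma K u F t ≤ m) (h1 : H ≤ t) (ht : t ≤ T) :
    Measurable fun p : Ω × (Fin H → UnitSphere n) => quad (S t p.1) (b t p.1) (c t p.1)
        (window H (fun s => x s p.1) t + perturb (exploreWindow H A t p.1) p.2) := by
  have hw : Measurable fun p : Ω × (Fin H → UnitSphere n) => window H (fun s => x s p.1) t :=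
    (hr.measurable_window_iterate hm h1 ht).comp measurable_fst
  have hp : Measurable fun p : Ω × (Fin H → UnitSphere n) =>
      perturb (exploreWindow H A t p.1) p.2 := by
    refine measurable_hist (w := fun j (p : Ω × (Fin H → UnitSphere n)) =>
      exploreWindow H A t p.1 j (p.2 j : E n)) fun j => ?_
    refine measurable_clm_apply ?_ ?_
    · exact (hr.measurable_explore (t := t + 1 - H + (j : ℕ)) (by omega) (by omega)
        (hr.measurable_past hm (by omega) (by omega) ht)).comp measurable_fst
    · exact ((measurable_pi_apply j).comp measurable_snd).subtype_val
  have h2 := measurable_quad_comp (hr.measurable_quad h1 ht ((lossSigma_le_knownSigma t).trans hm))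
    (measurable_fst (α := Ω) (β := Fin H → UnitSphere n)) (hw.add hp)
  exact h2

end Pathwise

section Expectation

variable {Ω : Type*} [mΩ : MeasurableSpace Ω] {P : Measure Ω}
    {n : ℕ} {K : Set (E n)} {ν : ℝ} {R : E n → ℝ}
    {σ η B L β : ℝ} {H T N : ℕ} {F : ℕ → Ω → Hist n H → ℝ} {u : ℕ → Ω → UnitSphere n}
    {x : ℕ → Ω → E n} {A : ℕ → Ω → E n →L[ℝ] E n} {y g : ℕ → Ω → E n}
    {S : ℕ → Ω → Hist n H →L[ℝ] Hist n H} {b : ℕ → Ω → Hist n H} {c : ℕ → Ω → ℝ}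

theorem measurable_noiseWindow (hu : IsUniformNoise P N u) {t : ℕ} (h1 : H ≤ t) (ht : t ≤ N) :
    Measurable (noiseWindow H u t) :=
  measurable_pi_lambda _ fun j => hu.measurable _ (Finset.mem_Icc.2 ⟨by omega, by omega⟩)

theorem map_noiseWindow (hu : IsUniformNoise P N u) {t : ℕ} (h1 : H ≤ t) (ht : t ≤ N) :
    P.map (noiseWindow H u t) = noiseLaw n H := by
  have hmem : ∀ j : Fin H, t + 1 - H + (j : ℕ) ∈ Finset.Icc 1 N := fun j =>
    Finset.mem_Icc.2 ⟨by omega, by omega⟩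
  have h2 := hu.indep.precomp (g := fun j : Fin H => (⟨t + 1 - H + (j : ℕ), hmem j⟩ :
    Finset.Icc 1 N)) (fun i j hij => by
      have := congrArg Subtype.val hij
      simp only at this
      exact Fin.ext (by omega))
  have h3 := h2.map_fun_eq_pi_map (fun j => (hu.measurable _ (hmem j)).aemeasurable)
  have h4 : (fun j : Fin H => P.map (u (t + 1 - H + (j : ℕ)))) = fun _ => uniformSphere n :=
    funext fun j => hu.law _ (hmem j)
  rw [noiseLaw, ← h4]
  exact h3

theorem indep_noiseWindow (hadv : IsDelayedAdversary P K T u F) {t : ℕ} (h1 : H ≤ t)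
    (ht : t ≤ T) :
    Indep (MeasurableSpace.comap (noiseWindow H u t) inferInstance)
      (pastSigma K u F t ⊔ lossSigma K (F t)) P := by
  refine indep_of_indep_of_le_left (hadv t (Finset.mem_Icc.2 ⟨h1, ht⟩)) ?_
  refine Measurable.comap_le ?_
  exact @measurable_pi_lambda _ _ _ (noiseSigma u (t + 1 - H) t) _ _ fun j =>
    measurable_noiseSigma (Finset.mem_Icc.2 ⟨by omega, by omega⟩)

theorem knownSigma_le (hu : IsUniformNoise P N u) (hTN : T ≤ N)
    (hF : ∀ t ∈ Finset.Icc H T, ∀ w ∈ histSet K H, Measurable fun ω => F t ω w) {t : ℕ}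
    (h1 : H ≤ t) (ht : t ≤ T) : knownSigma K u F t ≤ mΩ := by
  refine sup_le (pastSigma_le (fun s hs => hu.measurable s ?_) fun s hs => hF s ?_)
    (lossSigma_le (hF t (Finset.mem_Icc.2 ⟨h1, ht⟩)))
  all_goals rw [Finset.mem_Icc] at hs ⊢; omega

/-- Independence lets the recent noises be integrated first, with everything known before them
frozen. -/
theorem integral_noiseWindow [IsProbabilityMeasure P] (hu : IsUniformNoise P N u) (hTN : T ≤ N)
    (hF : ∀ t ∈ Finset.Icc H T, ∀ w ∈ histSet K H, Measurable fun ω => F t ω w)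
    (hadv : IsDelayedAdversary P K T u F) {t : ℕ} (h1 : H ≤ t) (ht : t ≤ T)
    {Ψ : Ω × (Fin H → UnitSphere n) → ℝ}
    (hΨ : Measurable[(knownSigma K u F t).prod MeasurableSpace.pi] Ψ) {C : ℝ}
    (hC : ∀ ω v, |Ψ (ω, v)| ≤ C) :
    ∫ ω, Ψ (ω, noiseWindow H u t ω) ∂P = ∫ ω, (∫ v, Ψ (ω, v) ∂(noiseLaw n H)) ∂P := by
  have hle := knownSigma_le hu hTN hF h1 ht
  -- The identity, seen as a map into Ω with the σ-algebra of known events, plays the role of the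
  -- variable independent of the noise.
  have hid : @Measurable Ω Ω mΩ (knownSigma K u F t) id := measurable_id'' hle
  have hind : @IndepFun Ω Ω (Fin H → UnitSphere n) mΩ (knownSigma K u F t) _ id
      (noiseWindow H u t) P := by
    refine (@IndepFun_iff_Indep Ω Ω _ mΩ (knownSigma K u F t) _ id _ P).2 ?_
    rw [MeasurableSpace.comap_id]
    exact (indep_noiseWindow hadv h1 ht).symm
  have h2 := @integral_comp_of_indepFun Ω mΩ P _ Ω (Fin H → UnitSphere n) (knownSigma K u F t) _
    id (noiseWindow H u t) hid (measurable_noiseWindow hu h1 (ht.trans hTN)) hind Ψ hΨ C hC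
  rw [map_noiseWindow hu h1 (ht.trans hTN)] at h2
  exact h2

/-- The effect of the exploration on the expected loss. -/
theorem integral_loss_window_le [IsProbabilityMeasure P]
    (hr : RandomRun K ν R σ η B L β H T F u x A y g S b c)
    (hn : 1 ≤ n) (hβ : 0 ≤ β) (hu : IsUniformNoise P N u) (hTN : T ≤ N)
    (hF : ∀ t ∈ Finset.Icc H T, ∀ w ∈ histSet K H, Measurable fun ω => F t ω w)
    (hadv : IsDelayedAdversary P K T u F) {t : ℕ} (h1 : H ≤ t) (ht : t ≤ T) :
    ∫ ω, F t ω (window H (fun s => y s ω) t) ∂P ≤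
      ∫ ω, quad (S t ω) (b t ω) (c t ω) (window H (fun s => x s ω) t) ∂P +
        β * (H * (1 / (η * σ * ((t + 1 - H : ℕ) : ℝ)))) := by
  have hPn := isProbabilityMeasure_noiseLaw hn H
  have h2 := integral_noiseWindow hu hTN hF hadv h1 ht
    (hr.measurable_quad_perturb (m := knownSigma K u F t) le_rfl h1 ht)
    (fun ω v => (hr.abs_quad_le h1 ht ω (hr.window_add_perturb_mem h1 ht ω v)).2)
  simp only [← hr.window_play_eq h1 ht] at h2
  simp only [hr.loss_window_eq h1 ht]
  rw [h2]
  have hint : Integrable (fun ω => quad (S t ω) (b t ω) (c t ω)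
      (window H (fun s => x s ω) t)) P := by
    exact integrable_of_abs_le (hr.measurable_quad_window (knownSigma_le hu hTN hF h1 ht) h1 ht)
      fun ω => (hr.abs_quad_le h1 ht ω (hr.window_iterate_mem h1 ht ω)).2
  have h3 : ∫ ω, (quad (S t ω) (b t ω) (c t ω) (window H (fun s => x s ω) t) +
      β * (H * (1 / (η * σ * ((t + 1 - H : ℕ) : ℝ))))) ∂P =
      ∫ ω, quad (S t ω) (b t ω) (c t ω) (window H (fun s => x s ω) t) ∂P +
        β * (H * (1 / (η * σ * ((t + 1 - H : ℕ) : ℝ)))) := by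
    rw [integral_add hint (integrable_const _)]
    simp
  rw [← h3]
  refine integral_mono_of_nonneg (ae_of_all _ fun ω => integral_nonneg fun v =>
    (hr.abs_quad_le h1 ht ω (hr.window_add_perturb_mem h1 ht ω v)).1)
    (hint.add (integrable_const _)) (ae_of_all _ fun ω => ?_)
  have hd := hr.data t (Finset.mem_Icc.2 ⟨h1, ht⟩) ω
  have hσ := (hr.run ω).sigma_pos
  have hη := (hr.run ω).eta_pos
  refine (integral_quad_perturb_le hn hd.symm hβ hd.le_beta _ _ _ _
    (fun _ => 1 / (η * σ * ((t + 1 - H : ℕ) : ℝ))) fun j v hv => ?_).trans (le_of_eq ?_)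
  · have h4 := ((hr.run ω).play_mem (t := t + 1 - H + (j : ℕ)) (by omega) (by omega) hv).2
    have h5 : (0 : ℝ) < ((t + 1 - H : ℕ) : ℝ) := by exact_mod_cast (by omega : 0 < t + 1 - H)
    rw [le_div_iff₀ (by positivity)]
    refine le_trans ?_ h4
    rw [mul_comm]
    refine mul_le_mul_of_nonneg_right ?_ (sq_nonneg _)
    refine mul_le_mul_of_nonneg_left ?_ (by positivity)
    exact_mod_cast Nat.le_add_right _ _
  · simp

end Expectation

end RandomRun

theorem sum_range_sub_eq_sum_fin {M : Type*} [AddCommMonoid M] (f : ℕ → M) {H t : ℕ}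
    (h : H ≤ t) : ∑ i ∈ Finset.range H, f (t - i) = ∑ j : Fin H, f (t + 1 - H + (j : ℕ)) := by
  rw [← Finset.sum_range_reflect, Finset.sum_range]
  refine Finset.sum_congr rfl fun j _ => ?_
  congr 1
  omega

namespace RandomRun

section Pathwise

variable {Ω : Type*}
    {n : ℕ} {K : Set (E n)} {ν : ℝ} {R : E n → ℝ}
    {σ η B L β : ℝ} {H T N : ℕ} {F : ℕ → Ω → Hist n H → ℝ} {u : ℕ → Ω → UnitSphere n}
    {x : ℕ → Ω → E n} {A : ℕ → Ω → E n →L[ℝ] E n} {y g : ℕ → Ω → E n}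
    {S : ℕ → Ω → Hist n H →L[ℝ] Hist n H} {b : ℕ → Ω → Hist n H} {c : ℕ → Ω → ℝ}

/-- The initial iterate does not depend on the randomness. -/
theorem iterate_init_eq (hr : RandomRun K ν R σ η B L β H T F u x A y g S b c) (ω ω' : Ω) :
    x H ω = x H ω' := by
  have hr₀ := hr.run ω
  have hH := hr₀.one_le_H
  refine eq_of_gradient_add_eq hr₀.barrier hr₀.convex hr₀.bounded le_rfl
    (hr₀.mem_interior hH hr₀.H_le_T) ((hr.run ω').mem_interior hH hr₀.H_le_T) ?_
  rw [hr₀.gradient_init hH le_rfl, (hr.run ω').gradient_init hH le_rfl]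
  simp

/-- The pathwise bound depends on ω only through x_H, which is deterministic. Its size is
irrelevant: it serves to make the estimator bounded, hence integrable. -/
theorem exists_norm_inverse_le (hr : RandomRun K ν R σ η B L β H T F u x A y g S b c)
    (hsmall : stepBound n η B H H ≤ 1 / (24 * H)) :
    ∃ C : ℝ, 0 ≤ C ∧ ∀ ω t, 1 ≤ t → t ≤ T → ∀ v, ‖(A t ω).inverse v‖ ≤ C * ‖v‖ := by
  rcases isEmpty_or_nonempty Ω with hΩ | ⟨⟨ω₀⟩⟩
  · exact ⟨0, le_rfl, fun ω => (hΩ.false ω).elim⟩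
  · refine ⟨Real.sqrt (Real.exp (12 * T) * ‖hess R (x H ω₀)‖ + η * σ * T), Real.sqrt_nonneg _,
      fun ω t h1 ht v => ?_⟩
    have h2 := (hr.run ω).norm_inverse_le_init hsmall h1 ht v
    rwa [hr.iterate_init_eq ω ω₀] at h2

theorem measurable_mul_sum_inverse (hr : RandomRun K ν R σ η B L β H T F u x A y g S b c)
    {t : ℕ} (h1 : H ≤ t) (ht : t ≤ T)
    {m : MeasurableSpace Ω} (hm : knownSigma K u F t ≤ m) {f : Ω × (Fin H → UnitSphere n) → ℝ}
    (hf : Measurable f) {v : Ω → E n} (hv : Measurable v) :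
    Measurable fun p : Ω × (Fin H → UnitSphere n) => f p *
      ∑ j : Fin H, inner ℝ ((A (t + 1 - H + (j : ℕ)) p.1).inverse (p.2 j : E n)) (v p.1) := by
  refine hf.mul (Finset.measurable_fun_sum _ fun j _ =>
    Measurable.inner ?_ (hv.comp measurable_fst))
  refine measurable_clm_apply ?_ ((measurable_pi_apply j).comp measurable_snd).subtype_val
  exact (hr.measurable_explore_inverse (t := t + 1 - H + (j : ℕ)) (by omega) (by omega)
    (hr.measurable_past hm (by omega) (by omega) ht)).comp measurable_fst

end Pathwise

section Expectation

variable {Ω : Type*} [mΩ : MeasurableSpace Ω] {P : Measure Ω}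
    {n : ℕ} {K : Set (E n)} {ν : ℝ} {R : E n → ℝ}
    {σ η B L β : ℝ} {H T N : ℕ} {F : ℕ → Ω → Hist n H → ℝ} {u : ℕ → Ω → UnitSphere n}
    {x : ℕ → Ω → E n} {A : ℕ → Ω → E n →L[ℝ] E n} {y g : ℕ → Ω → E n}
    {S : ℕ → Ω → Hist n H →L[ℝ] Hist n H} {b : ℕ → Ω → Hist n H} {c : ℕ → Ω → ℝ}

theorem integrable_inner_grad [IsProbabilityMeasure P]
    (hr : RandomRun K ν R σ η B L β H T F u x A y g S b c)
    (hsmall : stepBound n η B H H ≤ 1 / (24 * H))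
    (hu : IsUniformNoise P N u) (hTN : T ≤ N)
    (hF : ∀ t ∈ Finset.Icc H T, ∀ w ∈ histSet K H, Measurable fun ω => F t ω w)
    {t : ℕ} (h1 : H ≤ t) (ht : t ≤ T) {v : Ω → E n} (hv : Measurable v) {d : ℝ}
    (hd : ∀ ω, ‖v ω‖ ≤ d) : Integrable (fun ω => inner ℝ (g t ω) (v ω)) P := by
  obtain ⟨C, hC0, hC⟩ := hr.exists_norm_inverse_le hsmall
  have hle := knownSigma_le hu hTN hF h1 ht
  have hH : ∀ ω, 1 ≤ H := fun ω => (hr.run ω).one_le_H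
  have hg : Measurable (g t) := by
    rcases isEmpty_or_nonempty Ω with hΩ | ⟨⟨ω₀⟩⟩
    · exact measurable_of_empty _
    have := hH ω₀
    exact hr.measurable_grad h1 ht ((lossSigma_le_knownSigma t).trans hle)
      (fun s h2 h3 => hr.measurable_past hle (by omega) h3 ht)
      fun s h2 h3 => hu.measurable s (Finset.mem_Icc.2 ⟨by omega, by omega⟩)
  refine integrable_of_abs_le (C := n * B * H * (C * d)) (hg.inner hv) fun ω => ?_
  have := hH ω
  refine (hr.run ω).abs_inner_grad_le h1 ht _ fun i hi => ?_
  exact (hC ω _ (by omega) (by omega) _).trans (mul_le_mul_of_nonneg_left (hd ω) hC0)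

/-- The gradient estimator is unbiased along directions known in advance. -/
theorem integral_inner_grad [IsProbabilityMeasure P]
    (hr : RandomRun K ν R σ η B L β H T F u x A y g S b c) (hn : 1 ≤ n)
    (hsmall : stepBound n η B H H ≤ 1 / (24 * H))
    (hu : IsUniformNoise P N u) (hTN : T ≤ N)
    (hF : ∀ t ∈ Finset.Icc H T, ∀ w ∈ histSet K H, Measurable fun ω => F t ω w)
    (hadv : IsDelayedAdversary P K T u F) {t : ℕ} (h1 : H ≤ t) (ht : t ≤ T)
    {v : Ω → E n} (hv : Measurable[knownSigma K u F t] v) {d : ℝ} (hd : ∀ ω, ‖v ω‖ ≤ d) :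
    ∫ ω, inner ℝ (g t ω) (v ω) ∂P =
      ∫ ω, inner ℝ ((2 : ℝ) • S t ω (window H (fun s => x s ω) t) + b t ω) (diag H (v ω)) ∂P := by
  obtain ⟨C, hC0, hC⟩ := hr.exists_norm_inverse_le hsmall
  have h3 := integral_noiseWindow hu hTN hF hadv h1 ht
    (Ψ := fun p => (n * quad (S t p.1) (b t p.1) (c t p.1)
      (window H (fun s => x s p.1) t + perturb (exploreWindow H A t p.1) p.2)) *
        ∑ j : Fin H, inner ℝ ((A (t + 1 - H + (j : ℕ)) p.1).inverse (p.2 j : E n)) (v p.1))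
    (C := n * B * (H * (C * d))) ?_ ?_
  · refine Eq.trans (integral_congr_ae (ae_of_all _ fun ω => ?_)) (h3.trans ?_)
    · simp only
      rw [(hr.run ω).run.grad t (Finset.mem_Icc.2 ⟨h1, ht⟩), real_inner_smul_left, sum_inner,
        sum_range_sub_eq_sum_fin (fun s => inner ℝ ((A s ω).inverse (u s ω : E n)) (v ω)) h1,
        hr.loss_window_eq h1 ht, hr.window_play_eq h1 ht]
      rfl
    · refine integral_congr_ae (ae_of_all _ fun ω => ?_)
      have hA : ∀ j : Fin H, IsInvSqrt (A (t + 1 - H + (j : ℕ)) ω) _ := fun j =>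
        (hr.run ω).isInvSqrt (by omega) (by omega)
      have h5 := integral_estimator hn (hr.data t (Finset.mem_Icc.2 ⟨h1, ht⟩) ω).symm (b t ω)
        (c t ω) (window H (fun s => x s ω) t) (exploreWindow H A t ω)
        (fun j => (A (t + 1 - H + (j : ℕ)) ω).inverse)
        (fun j => (hA j).inner_left) (fun j => (hA j).inner_inverse_left)
        (fun j => (hA j).apply_inverse) (v ω)
      exact h5
  · have h4 := (hr.measurable_quad_perturb (m := knownSigma K u F t) le_rfl h1 ht).const_mul (n : ℝ)
    have h5 := hr.measurable_mul_sum_inverse h1 ht le_rfl h4 hv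
    exact h5
  · intro ω w
    have h4 := (hr.abs_quad_le h1 ht ω (hr.window_add_perturb_mem h1 ht ω w)).2
    simp only [abs_mul, Nat.abs_cast]
    refine mul_le_mul (mul_le_mul_of_nonneg_left h4 (Nat.cast_nonneg n)) ?_ (abs_nonneg _)
      (mul_nonneg (Nat.cast_nonneg n) (hr.run ω).B_pos.le)
    refine (Finset.abs_sum_le_sum_abs _ _).trans ((Finset.sum_le_card_nsmul _ _ (C * d)
      fun j _ => ?_).trans (by simp))
    have hA : IsInvSqrt (A (t + 1 - H + (j : ℕ)) ω) _ :=
      (hr.run ω).isInvSqrt (by omega) (by omega)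
    rw [hA.inner_inverse_left]
    refine (abs_real_inner_le_norm _ _).trans ?_
    have h5 : ‖(w j : E n)‖ = 1 := by simp
    rw [h5, one_mul]
    exact (hC ω _ (by omega) (by omega) _).trans (mul_le_mul_of_nonneg_left (hd ω) hC0)

end Expectation

end RandomRun

/-! ### From fixed directions to random ones. -/

section SimpleApproximation

theorem simpleFunc_section_eq_sum {Ω V : Type*} [MeasurableSpace Ω] (G : Ω → V → ℝ)
    (φ : SimpleFunc Ω V) (ω : Ω) :
    G ω (φ ω) = ∑ h ∈ φ.range, (φ ⁻¹' {h}).indicator (fun ω => G ω h) ω := by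
  rw [Finset.sum_eq_single (φ ω)]
  · rw [Set.indicator_of_mem (by simp)]
  · intro h _ hne
    exact Set.indicator_of_notMem (by simpa using hne.symm) _
  · intro h
    exact (h (SimpleFunc.mem_range_self φ ω)).elim

variable {Ω : Type*} {m mΩ : MeasurableSpace Ω} {P : Measure Ω} [IsProbabilityMeasure P]
  {V : Type*} [NormedAddCommGroup V] [NormedSpace ℝ V]

/-- If a family of random variables `G · h` has nonnegative integral over every event of `m`, then
so has `ω ↦ G ω (X ω)` for every bounded `m`-measurable `X`. -/
theorem integral_section_nonneg (hm : m ≤ mΩ) {G : Ω → V → ℝ}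
    (hG : ∀ h, Integrable (fun ω => G ω h) P)
    (hpos : ∀ h s, MeasurableSet[m] s → 0 ≤ ∫ ω in s, G ω h ∂P)
    (hcont : ∀ ω, Continuous (G ω)) {C d : ℝ} (hd : 0 ≤ d)
    (hC : ∀ ω h, ‖h‖ ≤ d → |G ω h| ≤ C) {X : Ω → V} (hX : StronglyMeasurable[m] X)
    (hXd : ∀ ω, ‖X ω‖ ≤ d) : 0 ≤ ∫ ω, G ω (X ω) ∂P := by
  have hs : ∀ (φ : @SimpleFunc Ω m V) (h : V), MeasurableSet[mΩ] (φ ⁻¹' {h}) := fun φ h =>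
    hm _ (@SimpleFunc.measurableSet_fiber _ _ m φ h)
  have hsum : ∀ φ : @SimpleFunc Ω m V, (fun ω => G ω (φ ω)) =
      fun ω => ∑ h ∈ @SimpleFunc.range Ω V m φ, (φ ⁻¹' {h}).indicator (fun ω => G ω h) ω := fun φ =>
    funext fun ω => @simpleFunc_section_eq_sum Ω V m G φ ω
  have hint : ∀ φ : @SimpleFunc Ω m V, Integrable (fun ω => G ω (φ ω)) P := by
    intro φ
    rw [hsum φ]
    exact integrable_finsetSum _ fun h _ => (hG h).indicator (hs φ h)
  have hnn : ∀ φ : @SimpleFunc Ω m V, 0 ≤ ∫ ω, G ω (φ ω) ∂P := by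
    intro φ
    rw [hsum φ]
    rw [integral_finsetSum _ fun h _ => (hG h).indicator (hs φ h)]
    refine Finset.sum_nonneg fun h _ => ?_
    rw [integral_indicator (hs φ h)]
    exact hpos h _ (@SimpleFunc.measurableSet_fiber _ _ m φ h)
  have hlim : Tendsto (fun k => ∫ ω, G ω (hX.approxBounded d k ω) ∂P) atTop
      (𝓝 (∫ ω, G ω (X ω) ∂P)) := by
    refine tendsto_integral_of_dominated_convergence (fun _ => C)
      (fun k => (hint (hX.approxBounded d k)).1) (integrable_const C)
      (fun k => ae_of_all _ fun ω => hC ω _ (hX.norm_approxBounded_le hd k ω))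
      (ae_of_all _ fun ω => ?_)
    exact ((hcont ω).tendsto _).comp (hX.tendsto_approxBounded_of_norm_le (hXd ω))
  exact ge_of_tendsto' hlim fun k => hnn _

end SimpleApproximation

/-! ### Consequences of conditional strong convexity. -/

section CondStronglyConvex

variable {Ω : Type*} [mΩ : MeasurableSpace Ω] {P : Measure Ω} [IsProbabilityMeasure P]
  {n H : ℕ} {K : Set (E n)} {σ B L β : ℝ} {u : ℕ → Ω → UnitSphere n}
  {F : ℕ → Ω → Hist n H → ℝ} {t : ℕ}

/-- The midpoint gap of a σ-strongly convex function is at least σ/8‖a - b‖². Integrating over an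
event of the past replaces the conditional mean by the loss itself. -/
theorem IsCondStronglyConvex.le_setIntegral (h : IsCondStronglyConvex P K σ u F t)
    (hle : pastSigma K u F t ≤ mΩ) (hF : ∀ z ∈ K, Integrable (fun ω => F t ω (diag H z)) P)
    {a b : E n} (ha : a ∈ K) (hb : b ∈ K) {s : Set Ω} (hs : MeasurableSet[pastSigma K u F t] s) :
    P.real s * (σ / 8 * ‖a - b‖ ^ 2) ≤
      ∫ ω in s, (2⁻¹ * F t ω (diag H a) + 2⁻¹ * F t ω (diag H b) -
        F t ω (diag H ((2⁻¹ : ℝ) • a + (2⁻¹ : ℝ) • b))) ∂P := by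
  obtain ⟨fbar, h1, h2⟩ := h
  have hK : Convex ℝ K := by
    obtain ⟨ω, hω⟩ := h2.exists
    exact hω.1
  have hc : (2⁻¹ : ℝ) • a + (2⁻¹ : ℝ) • b ∈ K :=
    hK ha hb (by norm_num) (by norm_num) (by norm_num)
  have hint : ∀ z ∈ K, Integrable (fun ω => fbar ω z) P := fun z hz =>
    integrable_condExp.congr (h1 z hz).symm
  have hset : ∀ z ∈ K, ∫ ω in s, fbar ω z ∂P = ∫ ω in s, F t ω (diag H z) ∂P := by
    intro z hz
    rw [← setIntegral_condExp hle (hF z hz) hs]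
    exact setIntegral_congr_ae (hle _ hs) ((h1 z hz).mono fun ω hω _ => hω)
  have e1 : ∫ ω in s, (2⁻¹ * F t ω (diag H a) + 2⁻¹ * F t ω (diag H b) -
        F t ω (diag H ((2⁻¹ : ℝ) • a + (2⁻¹ : ℝ) • b))) ∂P =
      ∫ ω in s, (2⁻¹ * fbar ω a + 2⁻¹ * fbar ω b -
        fbar ω ((2⁻¹ : ℝ) • a + (2⁻¹ : ℝ) • b)) ∂P := by
    rw [integral_sub, integral_add, integral_const_mul, integral_const_mul, integral_sub,
      integral_add, integral_const_mul, integral_const_mul, hset a ha, hset b hb, hset _ hc]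
    · exact ((hint a ha).const_mul _).integrableOn
    · exact ((hint b hb).const_mul _).integrableOn
    · exact (((hint a ha).const_mul _).add ((hint b hb).const_mul _)).integrableOn
    · exact (hint _ hc).integrableOn
    · exact ((hF a ha).const_mul _).integrableOn
    · exact ((hF b hb).const_mul _).integrableOn
    · exact (((hF a ha).const_mul _).add ((hF b hb).const_mul _)).integrableOn
    · exact (hF _ hc).integrableOn
  have e2 : P.real s * (σ / 8 * ‖a - b‖ ^ 2) = ∫ _ in s, σ / 8 * ‖a - b‖ ^ 2 ∂P := by
    rw [setIntegral_const, smul_eq_mul]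
  rw [e1, e2]
  refine setIntegral_mono_ae (integrable_const _).integrableOn
    ((((hint a ha).const_mul _).add ((hint b hb).const_mul _)).sub (hint _ hc)).integrableOn ?_
  filter_upwards [h2] with ω hω
  obtain ⟨-, h3⟩ := hω
  replace h3 := @h3 a ha b hb 2⁻¹ 2⁻¹ (by norm_num) (by norm_num) (by norm_num)
  simp only [smul_eq_mul] at h3
  linarith

/-- Bounded conditionally strongly convex losses force the domain to be small. -/
theorem IsCondStronglyConvex.sigma_mul_sq_le (h : IsCondStronglyConvex P K σ u F t)
    (hle : pastSigma K u F t ≤ mΩ)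
    (hF : ∀ w ∈ histSet K H, Measurable fun ω => F t ω w)
    (h0 : ∀ ω, ∀ w ∈ histSet K H, 0 ≤ F t ω w) (hB : ∀ ω, ∀ w ∈ histSet K H, F t ω w ≤ B)
    {a b : E n} (ha : a ∈ K) (hb : b ∈ K) : σ * ‖a - b‖ ^ 2 ≤ 8 * B := by
  have hK : Convex ℝ K := by
    obtain ⟨fbar, h1, h2⟩ := h
    obtain ⟨ω, hω⟩ := h2.exists
    exact hω.1
  have hc : (2⁻¹ : ℝ) • a + (2⁻¹ : ℝ) • b ∈ K :=
    hK ha hb (by norm_num) (by norm_num) (by norm_num)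
  have hint : ∀ z ∈ K, Integrable (fun ω => F t ω (diag H z)) P := fun z hz =>
    integrable_of_abs_le (C := B) (hF _ (diag_mem hz)) fun ω => by
      rw [abs_of_nonneg (h0 ω _ (diag_mem hz))]
      exact hB ω _ (diag_mem hz)
  -- On the whole space the expected midpoint gap is at least σ/8‖a - b‖², and it is at most B for
  -- losses in [0, B].
  have h1 := h.le_setIntegral hle hint ha hb (s := univ) MeasurableSet.univ
  have h2 : ∫ ω in univ, (2⁻¹ * F t ω (diag H a) + 2⁻¹ * F t ω (diag H b) -
        F t ω (diag H ((2⁻¹ : ℝ) • a + (2⁻¹ : ℝ) • b))) ∂P ≤ ∫ _, B ∂P := by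
    rw [setIntegral_univ]
    refine integral_mono ((((hint a ha).const_mul _).add ((hint b hb).const_mul _)).sub
      (hint _ hc)) (integrable_const _) fun ω => ?_
    have h3 := hB ω _ (diag_mem ha)
    have h4 := hB ω _ (diag_mem hb)
    have h5 := h0 ω _ (diag_mem hc)
    simp only
    linarith
  simp only [probReal_univ, integral_const, smul_eq_mul, one_mul] at h1 h2
  linarith

theorem quad_second_difference {S : Hist n H →L[ℝ] Hist n H}
    (hS : ∀ v w, inner ℝ (S v) w = inner ℝ v (S w)) (b : Hist n H) (c : ℝ) (w v : Hist n H) :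
    inner ℝ v (S v) =
      2⁻¹ * quad S b c (w + v) + 2⁻¹ * quad S b c (w + -v) - quad S b c w := by
  rw [quad_add hS, quad_add hS, inner_neg_right, map_neg, inner_neg_neg]
  ring

variable {S : Ω → Hist n H →L[ℝ] Hist n H} {b : Ω → Hist n H} {c : Ω → ℝ}

/-- The midpoint gap of a quadratic along ±εv is ε² times its curvature, and its lower bound is
σ/8·(2ε)²‖v‖². Cancelling ε² makes strong convexity around one interior point a statement about
every direction. -/
theorem IsCondStronglyConvex.le_setIntegral_curvature (h : IsCondStronglyConvex P K σ u F t)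
    (hH : 1 ≤ H) (hK : (interior K).Nonempty)
    (hle : pastSigma K u F t ≤ mΩ) (hF : ∀ z ∈ K, Integrable (fun ω => F t ω (diag H z)) P)
    (hd : ∀ ω, IsLossData K L β (F t ω) (S ω) (b ω) (c ω)) (v : E n)
    {s : Set Ω} (hs : MeasurableSet[pastSigma K u F t] s) :
    P.real s * (σ / 2 * ‖v‖ ^ 2) ≤ ∫ ω in s, inner ℝ (diag H v) (S ω (diag H v)) ∂P := by
  obtain ⟨x₀, hx₀⟩ := hK
  obtain ⟨ε, hε, hmem⟩ := exists_pos_add_smul_mem hx₀ (diag H v)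
  have hmem' : ∀ r : ℝ, |r| ≤ ε → x₀ + r • v ∈ K := fun r hr => hmem r hr ⟨0, hH⟩
  have h1 := hmem' ε (by rw [abs_of_pos hε])
  have h2 := hmem' (-ε) (by rw [abs_neg, abs_of_pos hε])
  have h3 := h.le_setIntegral hle hF h1 h2 hs
  have e1 : x₀ + ε • v - (x₀ + (-ε) • v) = (2 * ε) • v := by module
  have e2 : (2⁻¹ : ℝ) • (x₀ + ε • v) + (2⁻¹ : ℝ) • (x₀ + (-ε) • v) = x₀ := by module
  rw [e1, e2, norm_smul, Real.norm_eq_abs, abs_of_pos (by positivity)] at h3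
  have e3 : ∀ ω, 2⁻¹ * F t ω (diag H (x₀ + ε • v)) + 2⁻¹ * F t ω (diag H (x₀ + (-ε) • v)) -
      F t ω (diag H x₀) = ε ^ 2 * inner ℝ (diag H v) (S ω (diag H v)) := by
    intro ω
    rw [(hd ω).eqOn (diag_mem h1), (hd ω).eqOn (diag_mem h2),
      (hd ω).eqOn (diag_mem (interior_subset hx₀))]
    have h4 := quad_second_difference (hd ω).symm (b ω) (c ω) (diag H x₀) (ε • diag H v)
    rw [map_smul, real_inner_smul_left, real_inner_smul_right] at h4
    rw [neg_smul, diag_add, diag_add, show diag H (-(ε • v)) = -(ε • diag H v) from rfl,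
      diag_smul, ← h4]
    ring
  simp only [e3] at h3
  rw [integral_const_mul] at h3
  have h5 : 0 < ε ^ 2 := by positivity
  refine le_of_mul_le_mul_left ?_ h5
  refine le_trans (le_of_eq ?_) h3
  ring

theorem continuous_curvature (S : Hist n H →L[ℝ] Hist n H) :
    Continuous fun v : E n => inner ℝ (diag H v) (S (diag H v)) := by
  have h := continuous_diag (n := n) (H := H)
  fun_prop

/-- Conditional strong convexity along directions that are known in advance. -/
theorem IsCondStronglyConvex.integral_norm_sq_le (h : IsCondStronglyConvex P K σ u F t)
    (hσ : 0 ≤ σ) (hH : 1 ≤ H) (hK : (interior K).Nonempty)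
    (hle : pastSigma K u F t ≤ mΩ) (hF : ∀ w ∈ histSet K H, Measurable fun ω => F t ω w)
    (h0 : ∀ ω, ∀ w ∈ histSet K H, 0 ≤ F t ω w) (hB : ∀ ω, ∀ w ∈ histSet K H, F t ω w ≤ B)
    (hβ : 0 ≤ β) (hd : ∀ ω, IsLossData K L β (F t ω) (S ω) (b ω) (c ω)) {X : Ω → E n}
    (hX : Measurable[pastSigma K u F t] X) {d : ℝ} (hXd : ∀ ω, ‖X ω‖ ≤ d) :
    Integrable (fun ω => inner ℝ (diag H (X ω)) (S ω (diag H (X ω)))) P ∧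
      ∫ ω, σ / 2 * ‖X ω‖ ^ 2 ∂P ≤
        ∫ ω, inner ℝ (diag H (X ω)) (S ω (diag H (X ω))) ∂P := by
  obtain ⟨ω₀, -⟩ : ∃ ω : Ω, True := by
    obtain ⟨ω, -⟩ := (ae_of_all P fun _ => trivial : ∀ᵐ _ ∂P, True).exists
    exact ⟨ω, trivial⟩
  have hd0 : 0 ≤ d := (norm_nonneg _).trans (hXd ω₀)
  have hq := EBCO.measurable_quad hK hd hF
  have hmeas : ∀ Y : Ω → E n, Measurable Y →
      Measurable fun ω => inner ℝ (diag H (Y ω)) (S ω (diag H (Y ω))) := by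
    intro Y hY
    have hD := (continuous_diag (n := n) (H := H)).measurable.comp hY
    -- The curvature is a second difference based at 0; this is legitimate because the quadratic
    -- extension is measurable at every point, not only on K^H.
    have m1 := measurable_quad_comp hq measurable_id (hD.const_add 0)
    have m2 := measurable_quad_comp hq measurable_id (hD.neg.const_add 0)
    have m3 := ((m1.const_mul 2⁻¹).add (m2.const_mul 2⁻¹)).sub (hq 0)
    have e : (fun ω => inner ℝ (diag H (Y ω)) (S ω (diag H (Y ω)))) = _ :=
      funext fun ω => quad_second_difference (hd ω).symm (b ω) (c ω) 0 (diag H (Y ω))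
    rw [e]
    exact m3
  have hbd : ∀ ω (v : E n), ‖v‖ ≤ d →
      |inner ℝ (diag H v) (S ω (diag H v))| ≤ β * (H * d ^ 2) := by
    intro ω v hv
    rw [abs_of_nonneg ((hd ω).nonneg _)]
    refine ((hd ω).le_beta _).trans ?_
    rw [norm_diag_sq]
    gcongr
  have hint : ∀ Y : Ω → E n, Measurable Y → ∀ r : ℝ, (∀ ω, ‖Y ω‖ ≤ r) →
      Integrable (fun ω => inner ℝ (diag H (Y ω)) (S ω (diag H (Y ω)))) P := by
    intro Y hY r hr
    refine integrable_of_abs_le (C := β * (H * r ^ 2)) (hmeas Y hY) fun ω => ?_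
    rw [abs_of_nonneg ((hd ω).nonneg _)]
    refine ((hd ω).le_beta _).trans ?_
    rw [norm_diag_sq]
    have := hr ω
    gcongr
  have hXm : Measurable X := hX.mono hle le_rfl
  have hN : Integrable (fun ω => σ / 2 * ‖X ω‖ ^ 2) P := by
    refine integrable_of_abs_le (C := σ / 2 * d ^ 2) ((hXm.norm.pow_const 2).const_mul _)
      fun ω => ?_
    rw [abs_of_nonneg (by positivity)]
    have := hXd ω
    gcongr
  have hFi : ∀ z ∈ K, Integrable (fun ω => F t ω (diag H z)) P := fun z hz =>
    integrable_of_abs_le (C := B) (hF _ (diag_mem hz)) fun ω => by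
      rw [abs_of_nonneg (h0 ω _ (diag_mem hz))]
      exact hB ω _ (diag_mem hz)
  refine ⟨hint X hXm d hXd, ?_⟩
  have hXs : StronglyMeasurable[pastSigma K u F t] X := hX.stronglyMeasurable
  have key := integral_section_nonneg (P := P) hle
    (G := fun ω v => inner ℝ (diag H v) (S ω (diag H v)) - σ / 2 * ‖v‖ ^ 2)
    (C := β * (H * d ^ 2) + σ / 2 * d ^ 2) (d := d) ?_ ?_ ?_ hd0 ?_
    (X := X) hXs hXd
  · rw [integral_sub (hint X hXm d hXd) hN] at key
    linarith
  · intro v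
    exact (hint (fun _ => v) measurable_const ‖v‖ fun _ => le_rfl).sub (integrable_const _)
  · intro v s hs
    have h2 := h.le_setIntegral_curvature hH hK hle hFi hd v hs
    rw [integral_sub (hint (fun _ => v) measurable_const ‖v‖ fun _ => le_rfl).integrableOn
      (integrable_const _).integrableOn, setIntegral_const, smul_eq_mul]
    linarith
  · intro ω
    exact (continuous_curvature (S ω)).sub (by fun_prop)
  · intro ω v hv
    refine (abs_sub _ _).trans (add_le_add (hbd ω v hv) ?_)
    rw [abs_of_nonneg (by positivity)]
    gcongr

/-- In a unit direction the averaged curvature is at least σ/2 and at most βH. Consequently 2Hβ/σ ≥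
1, which later absorbs the terms without β/σ. -/
theorem IsCondStronglyConvex.le_two_mul_beta (h : IsCondStronglyConvex P K σ u F t)
    (hn : 1 ≤ n) (hσ : 0 ≤ σ) (hH : 1 ≤ H) (hK : (interior K).Nonempty)
    (hle : pastSigma K u F t ≤ mΩ) (hF : ∀ w ∈ histSet K H, Measurable fun ω => F t ω w)
    (h0 : ∀ ω, ∀ w ∈ histSet K H, 0 ≤ F t ω w) (hB : ∀ ω, ∀ w ∈ histSet K H, F t ω w ≤ B)
    (hβ : 0 ≤ β) (hd : ∀ ω, IsLossData K L β (F t ω) (S ω) (b ω) (c ω)) :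
    σ ≤ 2 * (β * H) := by
  obtain ⟨v, hv⟩ : ∃ v : E n, ‖v‖ = 1 := ⟨EuclideanSpace.single ⟨0, hn⟩ 1, by simp⟩
  obtain ⟨h1, h2⟩ := h.integral_norm_sq_le hσ hH hK hle hF h0 hB hβ hd
    (X := fun _ => v) measurable_const (fun _ => hv.le)
  have h3 : ∫ ω, inner ℝ (diag H v) (S ω (diag H v)) ∂P ≤ ∫ _, β * H ∂P := by
    refine integral_mono h1 (integrable_const _) fun ω => ?_
    refine ((hd ω).le_beta _).trans (le_of_eq ?_)
    rw [norm_diag_sq, hv]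
    ring
  simp only [hv, integral_const, probReal_univ, one_smul] at h2 h3
  linarith

end CondStronglyConvex

/-! ### Expected regret for a general step size. -/

theorem sum_one_div_le_one_add_log {H T : ℕ} (hT : 1 ≤ T) (hH : 1 ≤ H) :
    ∑ t ∈ Finset.Icc H (T - H), 1 / ((t + 1 - H : ℕ) : ℝ) ≤ 1 + Real.log T := by
  have h1 : Finset.Icc H (T - H) = Finset.Ico H (T - H + 1) := by ext; simp
  have h2 : ∀ i : ℕ, ((H + i + 1 - H : ℕ) : ℝ) = i + 1 := by
    intro i
    rw [show H + i + 1 - H = i + 1 by omega]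
    push_cast
    ring
  rw [h1, Finset.sum_Ico_eq_sum_range]
  simp only [h2]
  have h3 := harmonic_le_one_add_log (T - H + 1 - H)
  rw [harmonic] at h3
  push_cast at h3
  simp only [one_div]
  refine h3.trans ?_
  have h4 : Real.log ((T - H + 1 - H : ℕ) : ℝ) ≤ Real.log T := by
    rcases Nat.eq_zero_or_pos (T - H + 1 - H) with h | h
    · rw [h, Nat.cast_zero, Real.log_zero]
      exact Real.log_nonneg (by exact_mod_cast hT)
    · exact Real.log_le_log (by exact_mod_cast h) (by exact_mod_cast (by omega))
  linarith

namespace RandomRun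

section Pathwise

variable {Ω : Type*}
    {n : ℕ} {K : Set (E n)} {ν : ℝ} {R : E n → ℝ}
    {σ η B L β : ℝ} {H T : ℕ} {F : ℕ → Ω → Hist n H → ℝ} {u : ℕ → Ω → UnitSphere n}
    {x : ℕ → Ω → E n} {A : ℕ → Ω → E n →L[ℝ] E n} {y g : ℕ → Ω → E n}
    {S : ℕ → Ω → Hist n H →L[ℝ] Hist n H} {b : ℕ → Ω → Hist n H} {c : ℕ → Ω → ℝ}

theorem norm_iterate_sub_le (hr : RandomRun K ν R σ η B L β H T F u x A y g S b c)
    {t : ℕ} (h1 : H ≤ t) (ht : t ≤ T) {z : E n} (hz : z ∈ K) (ω : Ω) :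
    ‖x t ω - z‖ ≤ Real.sqrt (8 * B / σ) := by
  have hrω := hr.run ω
  have hH := hrω.one_le_H
  refine Real.le_sqrt_of_sq_le ?_
  rw [le_div_iff₀ hrω.sigma_pos, mul_comm]
  exact hrω.sigma_diam _ (interior_subset (hrω.mem_interior (by omega) ht)) _ hz

end Pathwise

variable {Ω : Type*} [mΩ : MeasurableSpace Ω] {P : Measure Ω} [IsProbabilityMeasure P]
    {n : ℕ} {K : Set (E n)} {ν : ℝ} {R : E n → ℝ}
    {σ η B L β D : ℝ} {H T N : ℕ} {F : ℕ → Ω → Hist n H → ℝ} {u : ℕ → Ω → UnitSphere n}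
    {x : ℕ → Ω → E n} {A : ℕ → Ω → E n →L[ℝ] E n} {y g : ℕ → Ω → E n}
    {S : ℕ → Ω → Hist n H →L[ℝ] Hist n H} {b : ℕ → Ω → Hist n H} {c : ℕ → Ω → ℝ}

theorem integrable_loss_diag (hr : RandomRun K ν R σ η B L β H T F u x A y g S b c)
    (hF : ∀ t ∈ Finset.Icc H T, ∀ w ∈ histSet K H, Measurable fun ω => F t ω w)
    {t : ℕ} (h1 : H ≤ t) (ht : t ≤ T) {z : E n} (hz : z ∈ K) :
    Integrable (fun ω => F t ω (diag H z)) P := by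
  have hmem := Finset.mem_Icc.2 ⟨h1, ht⟩
  refine integrable_of_abs_le (C := B) (hF t hmem _ (diag_mem hz)) fun ω => ?_
  rw [abs_of_nonneg ((hr.run ω).loss_nonneg t hmem _ (diag_mem hz))]
  exact (hr.run ω).loss_le t hmem _ (diag_mem hz)

theorem integrable_loss_window (hr : RandomRun K ν R σ η B L β H T F u x A y g S b c)
    (hu : IsUniformNoise P N u) (hTN : T ≤ N)
    (hF : ∀ t ∈ Finset.Icc H T, ∀ w ∈ histSet K H, Measurable fun ω => F t ω w)
    {t : ℕ} (h1 : H ≤ t) (ht : t ≤ T) :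
    Integrable (fun ω => F t ω (window H (fun s => y s ω) t)) P := by
  have hmem := Finset.mem_Icc.2 ⟨h1, ht⟩
  have hle := knownSigma_le hu hTN hF h1 ht
  refine integrable_of_abs_le (C := B) ?_ fun ω => ?_
  · rcases isEmpty_or_nonempty Ω with hΩ | ⟨⟨ω₀⟩⟩
    · exact measurable_of_empty _
    have := (hr.run ω₀).one_le_H
    exact hr.measurable_loss_window h1 ht ((lossSigma_le_knownSigma t).trans hle)
      (fun s h2 h3 => hr.measurable_past hle (by omega) h3 ht)
      fun s h2 h3 => hu.measurable s (Finset.mem_Icc.2 ⟨by omega, by omega⟩)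
  · rw [abs_of_nonneg ((hr.run ω).loss_nonneg t hmem _ ((hr.run ω).window_mem h1 ht))]
    exact (hr.run ω).loss_le t hmem _ ((hr.run ω).window_mem h1 ht)

/-- The expected regret of a single round, in terms of the linearized regularized regret. -/
theorem expected_round_le (hr : RandomRun K ν R σ η B L β H T F u x A y g S b c)
    (hn : 1 ≤ n) (hβ : 0 ≤ β) (hL : 0 ≤ L) (hD0 : 0 ≤ D) (hD : ∀ a ∈ K, ∀ b ∈ K, ‖a - b‖ ≤ D)
    (hsmall : stepBound n η B H H ≤ 1 / (24 * H))
    (hu : IsUniformNoise P N u) (hTN : T ≤ N)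
    (hF : ∀ t ∈ Finset.Icc H T, ∀ w ∈ histSet K H, Measurable fun ω => F t ω w)
    (hadv : IsDelayedAdversary P K T u F) {t : ℕ} (h1 : H ≤ t) (ht : t ≤ T)
    (hconv : IsCondStronglyConvex P K σ u F t) {z : E n} (hz : z ∈ K) :
    ∫ ω, F t ω (window H (fun s => y s ω) t) ∂P - ∫ ω, F t ω (diag H z) ∂P ≤
      β * (H * (1 / (η * σ * ((t + 1 - H : ℕ) : ℝ)))) +
        (L * (H * D) + 2 * β * H ^ 2 * (8 * B / σ)) *
          ∑ s ∈ Finset.Ico (t + 1 - H) t, stepBound n η B H s +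
        ∫ ω, (inner ℝ (g t ω) (x t ω - z) - σ / 2 * ‖x t ω - z‖ ^ 2) ∂P := by
  obtain ⟨ω₀, -⟩ : ∃ ω : Ω, True := by
    obtain ⟨ω, -⟩ := (ae_of_all P fun _ => trivial : ∀ᵐ _ ∂P, True).exists
    exact ⟨ω, trivial⟩
  have hmem := Finset.mem_Icc.2 ⟨h1, ht⟩
  have hr₀ := hr.run ω₀
  have hH := hr₀.one_le_H
  have hσ := hr₀.sigma_pos
  have hB := hr₀.B_pos
  have hle := knownSigma_le hu hTN hF h1 ht
  set M := ∑ s ∈ Finset.Ico (t + 1 - H) t, stepBound n η B H s with hM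
  have hM0 : 0 ≤ M := Finset.sum_nonneg fun s _ =>
    stepBound_nonneg hr₀.eta_pos.le hr₀.B_pos.le H s
  -- This diameter bound is used where β multiplies two distances, so that their product is 8B/σ
  -- whatever the size of σ; the term with L uses D.
  set d := Real.sqrt (8 * B / σ) with hd
  have hd0 : 0 ≤ d := Real.sqrt_nonneg _
  have hdsq : d ^ 2 = 8 * B / σ := Real.sq_sqrt (by positivity)
  have hdK : ∀ a ∈ K, ∀ b ∈ K, ‖a - b‖ ≤ d := fun a ha b hb => by
    refine Real.le_sqrt_of_sq_le ?_
    rw [le_div_iff₀ hσ, mul_comm]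
    exact hr₀.sigma_diam a ha b hb
  have hv : Measurable[pastSigma K u F t] fun ω => x t ω - z :=
    (hr.measurable_iterate (by omega) ht).sub_const z
  have hv' : Measurable[knownSigma K u F t] fun ω => x t ω - z := hv.mono le_sup_left le_rfl
  have hvd : ∀ ω, ‖x t ω - z‖ ≤ d := hr.norm_iterate_sub_le h1 ht hz
  have hvm : Measurable fun ω => x t ω - z := hv'.mono hle le_rfl
  obtain ⟨hq1, hq2⟩ := hconv.integral_norm_sq_le hσ.le hH hr.nonempty
    (le_sup_left.trans hle) (hF t hmem) (fun ω => (hr.run ω).loss_nonneg t hmem)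
    (fun ω => (hr.run ω).loss_le t hmem) hβ (hr.data t hmem) hv hvd
  have hg1 := hr.integrable_inner_grad hsmall hu hTN hF h1 ht hvm hvd
  have hg2 := hr.integral_inner_grad hn hsmall hu hTN hF hadv h1 ht hv' hvd
  have hx := hr.integral_loss_window_le hn hβ hu hTN hF hadv h1 ht
  have hqw := hr.measurable_quad_window hle h1 ht
  have hiw : Integrable (fun ω => quad (S t ω) (b t ω) (c t ω) (window H (fun s => x s ω) t)) P :=
    integrable_of_abs_le hqw fun ω =>
      (hr.abs_quad_le h1 ht ω (hr.window_iterate_mem h1 ht ω)).2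
  have hiz := hr.integrable_loss_diag (P := P) hF h1 ht hz
  have hG : Integrable (fun ω => inner ℝ ((2 : ℝ) • S t ω (window H (fun s => x s ω) t) + b t ω)
      (diag H (x t ω - z))) P := by
    -- The pairing with the gradient is measurable as a difference of two values of the quadratic
    -- minus its curvature term.
    have m1 := measurable_quad_comp
      (hr.measurable_quad h1 ht ((lossSigma_le_knownSigma t).trans hle)) measurable_id
      ((hr.measurable_window_iterate hle h1 ht).add
        ((continuous_diag (n := n) (H := H)).measurable.comp hvm))
    have m2 := (m1.sub hqw).aestronglyMeasurable (μ := P) |>.sub hq1.1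
    have e : (fun ω => inner ℝ ((2 : ℝ) • S t ω (window H (fun s => x s ω) t) + b t ω)
      (diag H (x t ω - z))) = _ := funext fun ω => by
        have h2 := quad_add (hr.data t hmem ω).symm (b t ω) (c t ω) (window H (fun s => x s ω) t)
          (diag H (x t ω - z))
        exact (sub_eq_of_eq_add (sub_eq_of_eq_add' (h2.trans (add_assoc _ _ _)))).symm
    refine Integrable.of_bound (C := L * (H * d)) ?_ (ae_of_all _ fun ω => ?_)
    · rw [e]
      exact m2
    · rw [Real.norm_eq_abs]
      refine (abs_real_inner_le_norm _ _).trans (mul_le_mul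
        ((hr.data t hmem ω).norm_gradient_le _ (hr.window_iterate_mem h1 ht ω))
        ((norm_diag_le hH _).trans ?_) (norm_nonneg _) hL)
      have := hvd ω
      gcongr
  have hmain : ∫ ω, (quad (S t ω) (b t ω) (c t ω) (window H (fun s => x s ω) t) -
      F t ω (diag H z)) ∂P ≤ ∫ ω, ((L * (H * D) + 2 * β * H ^ 2 * (8 * B / σ)) * M +
        inner ℝ ((2 : ℝ) • S t ω (window H (fun s => x s ω) t) + b t ω) (diag H (x t ω - z)) -
        inner ℝ (diag H (x t ω - z)) (S t ω (diag H (x t ω - z)))) ∂P := by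
    refine integral_mono (hiw.sub hiz) (((integrable_const _).add hG).sub hq1) fun ω => ?_
    have h2 := (hr.data t hmem ω).quad_sub_le hβ (hr.window_iterate_mem h1 ht ω)
      (x := x t ω) (z := z)
    simp only
    rw [(hr.data t hmem ω).eqOn (diag_mem hz)]
    have h3 := (hr.run ω).norm_window_sub_diag_le hsmall hD0 hD h1 ht
    have h4 := (hr.run ω).norm_window_sub_diag_le hsmall hd0 hdK h1 ht
    have h5 := (norm_diag_le hH (x t ω - z)).trans
      (mul_le_mul_of_nonneg_left (hvd ω) (Nat.cast_nonneg H))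
    have h6 := mul_le_mul_of_nonneg_left h3 hL
    have h7 := mul_le_mul (mul_le_mul_of_nonneg_left h4 hβ) h5 (norm_nonneg _) (by positivity)
    rw [← hM] at h6 h7
    have h8 : (L * (H * D) + 2 * β * H ^ 2 * (8 * B / σ)) * M =
        L * (H * (D * M)) + 2 * (β * (H * (d * M)) * (H * d)) := by
      rw [← hdsq]; ring
    rw [h8]
    linarith
  have hcG : Integrable (fun ω => (L * (H * D) + 2 * β * H ^ 2 * (8 * B / σ)) * M +
      inner ℝ ((2 : ℝ) • S t ω (window H (fun s => x s ω) t) + b t ω) (diag H (x t ω - z))) P :=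
    (integrable_const _).add hG
  rw [integral_sub hiw hiz, integral_sub hcG hq1,
    integral_add (integrable_const _) hG, ← hg2] at hmain
  have hN : Integrable (fun ω => σ / 2 * ‖x t ω - z‖ ^ 2) P := by
    refine integrable_of_abs_le (C := σ / 2 * d ^ 2) ((hvm.norm.pow_const 2).const_mul _)
      fun ω => ?_
    rw [abs_of_nonneg (by positivity)]
    have := hvd ω
    gcongr
  rw [integral_sub hg1 hN]
  simp only [integral_const, probReal_univ, one_smul] at hmain
  linarith

/-- The sum of the expected linearized regularized regret. -/
theorem sum_integral_inner_grad_le (hr : RandomRun K ν R σ η B L β H T F u x A y g S b c)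
    (hsmall : stepBound n η B H H ≤ 1 / (24 * H))
    (hu : IsUniformNoise P N u) (hTN : T ≤ N)
    (hF : ∀ t ∈ Finset.Icc H T, ∀ w ∈ histSet K H, Measurable fun ω => F t ω w)
    {z : E n} (hz : z ∈ interior K) (ω₀ : Ω) :
    ∑ t ∈ Finset.Icc H (T - H),
        ∫ ω, (inner ℝ (g t ω) (x t ω - z) - σ / 2 * ‖x t ω - z‖ ^ 2) ∂P ≤
      1 / η * (R z - R (x H ω₀)) + 4 * B * H +
        2 * n * B * H ^ 3 * ∑ s ∈ Finset.Ico 1 T, stepBound n η B H s := by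
  have hH := (hr.run ω₀).one_le_H
  have hσ := (hr.run ω₀).sigma_pos
  have hint : ∀ t ∈ Finset.Icc H (T - H), Integrable (fun ω => inner ℝ (g t ω) (x t ω - z) -
      σ / 2 * ‖x t ω - z‖ ^ 2) P := by
    intro t ht
    rw [Finset.mem_Icc] at ht
    have ht' : t ≤ T := by omega
    have hvd := hr.norm_iterate_sub_le ht.1 ht' (interior_subset hz)
    have hvm : Measurable fun ω => x t ω - z :=
      (hr.measurable_past (knownSigma_le hu hTN hF ht.1 ht') (by omega) le_rfl ht').sub_const z
    refine (hr.integrable_inner_grad hsmall hu hTN hF ht.1 ht' hvm hvd).sub ?_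
    refine integrable_of_abs_le (C := σ / 2 * Real.sqrt (8 * B / σ) ^ 2)
      ((hvm.norm.pow_const 2).const_mul _) fun ω => ?_
    rw [abs_of_nonneg (by positivity)]
    have := hvd ω
    gcongr
  rw [← integral_finsetSum _ hint]
  refine (integral_mono (integrable_finsetSum _ hint) (integrable_const _) fun ω => ?_).trans
    (le_of_eq (by rw [integral_const, probReal_univ, one_smul]))
  rw [← hr.iterate_init_eq ω ω₀]
  exact (hr.run ω).sum_inner_grad_le hsmall hz

theorem integral_loss_bounds (hr : RandomRun K ν R σ η B L β H T F u x A y g S b c)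
    (hu : IsUniformNoise P N u) (hTN : T ≤ N)
    (hF : ∀ t ∈ Finset.Icc H T, ∀ w ∈ histSet K H, Measurable fun ω => F t ω w)
    {t : ℕ} (h1 : H ≤ t) (ht : t ≤ T) {z : E n} (hz : z ∈ K) :
    ∫ ω, F t ω (window H (fun s => y s ω) t) ∂P - ∫ ω, F t ω (diag H z) ∂P ≤ B := by
  have hmem := Finset.mem_Icc.2 ⟨h1, ht⟩
  have h2 : ∫ ω, F t ω (window H (fun s => y s ω) t) ∂P ≤ B :=
    (integral_mono (hr.integrable_loss_window hu hTN hF h1 ht) (integrable_const B) fun ω =>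
      (hr.run ω).loss_le t hmem _ ((hr.run ω).window_mem h1 ht)).trans
      (le_of_eq (by rw [integral_const, probReal_univ, one_smul]))
  have h3 : 0 ≤ ∫ ω, F t ω (diag H z) ∂P := integral_nonneg fun ω =>
    (hr.run ω).loss_nonneg t hmem _ (diag_mem hz)
  linarith

/-- The trivial regret bound. -/
theorem expectedRegret_le_mul (hr : RandomRun K ν R σ η B L β H T F u x A y g S b c)
    (hB : 0 ≤ B) (hH : 1 ≤ H) (hu : IsUniformNoise P N u) (hTN : T ≤ N)
    (hF : ∀ t ∈ Finset.Icc H T, ∀ w ∈ histSet K H, Measurable fun ω => F t ω w)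
    {z : E n} (hz : z ∈ K) : expectedRegret P T F y z ≤ B * T := by
  rw [expectedRegret, ← Finset.sum_sub_distrib]
  refine (Finset.sum_le_card_nsmul _ _ B fun t ht => ?_).trans ?_
  · rw [Finset.mem_Icc] at ht
    exact hr.integral_loss_bounds hu hTN hF ht.1 ht.2 hz
  · rw [Nat.card_Icc, nsmul_eq_mul, mul_comm]
    refine mul_le_mul_of_nonneg_left ?_ hB
    exact_mod_cast (by omega)

/-- Regret against a comparator in the interior. -/
theorem expectedRegret_le_interior (hr : RandomRun K ν R σ η B L β H T F u x A y g S b c)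
    (hn : 1 ≤ n) (hβ : 0 ≤ β) (hL : 0 ≤ L) (hD0 : 0 ≤ D) (hD : ∀ a ∈ K, ∀ b ∈ K, ‖a - b‖ ≤ D)
    (hsmall : stepBound n η B H H ≤ 1 / (24 * H))
    (hu : IsUniformNoise P N u) (hTN : T ≤ N)
    (hF : ∀ t ∈ Finset.Icc H T, ∀ w ∈ histSet K H, Measurable fun ω => F t ω w)
    (hadv : IsDelayedAdversary P K T u F)
    (hconv : ∀ t ∈ Finset.Icc H T, IsCondStronglyConvex P K σ u F t)
    {z : E n} (hz : z ∈ interior K) (ω₀ : Ω) :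
    expectedRegret P T F y z ≤
      β * H / (η * σ) * (1 + Real.log T) +
        (L * (H * D) + 2 * β * H ^ 2 * (8 * B / σ)) *
          (H * ∑ s ∈ Finset.Ico 1 T, stepBound n η B H s) +
        (1 / η * (R z - R (x H ω₀)) + 4 * B * H +
          2 * n * B * H ^ 3 * ∑ s ∈ Finset.Ico 1 T, stepBound n η B H s) + B * H := by
  have hr₀ := hr.run ω₀
  have hH := hr₀.one_le_H
  have hHT := hr₀.H_le_T
  have hσ := hr₀.sigma_pos
  have hη := hr₀.eta_pos
  have hB := hr₀.B_pos
  rw [expectedRegret, ← Finset.sum_sub_distrib]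
  -- The last H rounds, whose gradients reach no iterate up to x_T, are charged B each.
  have hsub : Finset.Icc H (T - H) ⊆ Finset.Icc H T := Finset.Icc_subset_Icc_right (by omega)
  rw [← Finset.sum_sdiff hsub, add_comm]
  refine add_le_add ?_ ?_
  · refine (Finset.sum_le_sum fun t ht => ?_ : _ ≤ ∑ t ∈ Finset.Icc H (T - H),
      (β * H / (η * σ) * (1 / ((t + 1 - H : ℕ) : ℝ)) +
        (L * (H * D) + 2 * β * H ^ 2 * (8 * B / σ)) *
          ∑ s ∈ Finset.Ico (t + 1 - H) t, stepBound n η B H s +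
        ∫ ω, (inner ℝ (g t ω) (x t ω - z) - σ / 2 * ‖x t ω - z‖ ^ 2) ∂P)).trans ?_
    · have ht' := Finset.mem_Icc.1 (hsub ht)
      refine (hr.expected_round_le hn hβ hL hD0 hD hsmall hu hTN hF hadv ht'.1 ht'.2
        (hconv t (hsub ht)) (interior_subset hz)).trans (le_of_eq ?_)
      congr 2
      simp only [div_eq_mul_inv, mul_inv]
      ring
    · rw [Finset.sum_add_distrib, Finset.sum_add_distrib, ← Finset.mul_sum, ← Finset.mul_sum]
      refine add_le_add (add_le_add ?_ ?_) (hr.sum_integral_inner_grad_le hsmall hu hTN hF hz ω₀)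
      · exact mul_le_mul_of_nonneg_left (sum_one_div_le_one_add_log (by omega) hH) (by positivity)
      · exact mul_le_mul_of_nonneg_left hr₀.sum_window_le (by positivity)
  · refine (Finset.sum_le_card_nsmul _ _ B fun t ht => ?_).trans ?_
    · have ht' := Finset.mem_Icc.1 (Finset.sdiff_subset ht)
      exact hr.integral_loss_bounds hu hTN hF ht'.1 ht'.2 (interior_subset hz)
    · rw [Finset.card_sdiff_of_subset hsub, Nat.card_Icc, Nat.card_Icc, nsmul_eq_mul, mul_comm]
      refine mul_le_mul_of_nonneg_left ?_ hB.le
      exact_mod_cast (by omega)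

/-- Regret against an arbitrary comparator. -/
theorem expectedRegret_le (hr : RandomRun K ν R σ η B L β H T F u x A y g S b c)
    (hn : 1 ≤ n) (hν : 0 ≤ ν) (hβ : 0 ≤ β) (hL : 0 ≤ L) (hD0 : 0 ≤ D)
    (hD : ∀ a ∈ K, ∀ b ∈ K, ‖a - b‖ ≤ D)
    (hsmall : stepBound n η B H H ≤ 1 / (24 * H))
    (hu : IsUniformNoise P N u) (hTN : T ≤ N)
    (hF : ∀ t ∈ Finset.Icc H T, ∀ w ∈ histSet K H, Measurable fun ω => F t ω w)
    (hFc : ∀ t ∈ Finset.Icc H T, ∀ ω, ConvexOn ℝ (histSet K H) (F t ω))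
    (hadv : IsDelayedAdversary P K T u F)
    (hconv : ∀ t ∈ Finset.Icc H T, IsCondStronglyConvex P K σ u F t)
    {z : E n} (hz : z ∈ K) :
    expectedRegret P T F y z ≤
      β * H / (η * σ) * (1 + Real.log T) +
        (L * (H * D) + 2 * β * H ^ 2 * (8 * B / σ)) *
          (H * ∑ s ∈ Finset.Ico 1 T, stepBound n η B H s) +
        (1 / η * (ν * Real.log T) + 4 * B * H +
          2 * n * B * H ^ 3 * ∑ s ∈ Finset.Ico 1 T, stepBound n η B H s) + B * H + B := by
  obtain ⟨ω₀, -⟩ : ∃ ω : Ω, True := by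
    obtain ⟨ω, -⟩ := (ae_of_all P fun _ => trivial : ∀ᵐ _ ∂P, True).exists
    exact ⟨ω, trivial⟩
  have hr₀ := hr.run ω₀
  have hH := hr₀.one_le_H
  have hHT := hr₀.H_le_T
  have hη := hr₀.eta_pos
  have hB := hr₀.B_pos
  have hT : (1 : ℝ) ≤ T := by exact_mod_cast hH.trans hHT
  have hx := hr₀.mem_interior hH hHT
  -- Moving z by a fraction 1/T towards x_H keeps the barrier within ν log T of its minimum and, by
  -- convexity, costs at most B/T per round.
  set r : ℝ := 1 - 1 / T with hr_def
  have hrI : r ∈ Ico (0 : ℝ) 1 := by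
    have h2 : (1 : ℝ) / T ≤ 1 := by rw [div_le_one (by linarith)]; exact hT
    have h3 : (0 : ℝ) < 1 / T := by positivity
    constructor <;> linarith
  set w := x H ω₀ + r • (z - x H ω₀) with hw
  have hwi : w ∈ interior K := add_smul_mem_interior_of_lt_one hr₀.convex hx hz hrI
  have h1 := hr.expectedRegret_le_interior hn hβ hL hD0 hD hsmall hu hTN hF hadv hconv hwi ω₀
  have h2 : R w - R (x H ω₀) ≤ ν * Real.log T := by
    have h3 := barrier_le_add_log hr₀.barrier hr₀.convex hν hr₀.bounded hx hz hrI
    rw [← hw, show 1 - r = (T : ℝ)⁻¹ by rw [hr_def]; ring, Real.log_inv] at h3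
    linarith
  have h3 := mul_le_mul_of_nonneg_left h2 (show 0 ≤ 1 / η by positivity)
  have h4 : expectedRegret P T F y z ≤ expectedRegret P T F y w + B := by
    have h5 : ∑ t ∈ Finset.Icc H T, ∫ ω, F t ω (diag H w) ∂P ≤
        ∑ t ∈ Finset.Icc H T, (∫ ω, F t ω (diag H z) ∂P + B / T) := by
      refine Finset.sum_le_sum fun t ht => ?_
      have ht' := Finset.mem_Icc.1 ht
      have h6 : ∫ ω, (F t ω (diag H z) + B / T) ∂P = ∫ ω, F t ω (diag H z) ∂P + B / T := by
        rw [integral_add (hr.integrable_loss_diag hF ht'.1 ht'.2 hz) (integrable_const _),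
          integral_const, probReal_univ, one_smul]
      rw [← h6]
      refine integral_mono (hr.integrable_loss_diag hF ht'.1 ht'.2 (interior_subset hwi))
        ((hr.integrable_loss_diag hF ht'.1 ht'.2 hz).add (integrable_const _)) fun ω => ?_
      have hxm := diag_mem (H := H) (interior_subset hx)
      have hzm := diag_mem (H := H) hz
      obtain ⟨-, h7⟩ := hFc t ht ω
      replace h7 := @h7 _ hxm _ hzm (1 - r) r (by linarith [hrI.2]) hrI.1 (by ring)
      have h8 : (1 - r) • diag H (x H ω₀) + r • diag H z = diag H w := by
        rw [hw, ← diag_smul, ← diag_smul, ← diag_add]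
        congr 1
        module
      rw [h8] at h7
      simp only [smul_eq_mul] at h7 ⊢
      have h9 := (hr.run ω).loss_le t ht _ hxm
      have h10 := (hr.run ω).loss_nonneg t ht _ hzm
      have e : 1 - r = 1 / T := by rw [hr_def]; ring
      have h11 : (1 - r) * F t ω (diag H (x H ω₀)) ≤ (1 - r) * B :=
        mul_le_mul_of_nonneg_left h9 (by linarith [hrI.2])
      have h12 : r * F t ω (diag H z) ≤ 1 * F t ω (diag H z) :=
        mul_le_mul_of_nonneg_right hrI.2.le h10
      rw [e] at h7 h11
      simp only [div_mul_eq_mul_div, one_mul] at h7 h11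
      linarith
    rw [Finset.sum_add_distrib] at h5
    have h6 : ∑ t ∈ Finset.Icc H T, B / (T : ℝ) ≤ B := by
      rw [Finset.sum_const, Nat.card_Icc, nsmul_eq_mul, mul_div_assoc', div_le_iff₀ (by linarith),
        mul_comm]
      refine mul_le_mul_of_nonneg_left ?_ hB.le
      exact_mod_cast (by omega)
    rw [expectedRegret, expectedRegret]
    linarith
  linarith

end RandomRun

/-! ### Tuning the step size and collecting the constants. -/

/-- The step size of the algorithm. -/
def stepSize (κ B : ℝ) (n H T : ℕ) : ℝ := κ / (n * B * H * (1 + Real.log H) * Real.sqrt T)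

section StepSize

variable {κ B : ℝ} {n H T : ℕ}

theorem one_le_one_add_log (hH : 1 ≤ H) : 1 ≤ 1 + Real.log H := by
  have := Real.log_nonneg (show (1 : ℝ) ≤ H by exact_mod_cast hH)
  linarith

theorem one_add_log_le (hH : 1 ≤ H) : 1 + Real.log H ≤ H := by
  have := Real.log_le_sub_one_of_pos (show (0 : ℝ) < H by exact_mod_cast hH)
  linarith

theorem stepSize_pos (hκ : 0 < κ) (hB : 0 < B) (hn : 1 ≤ n) (hH : 1 ≤ H) (hT : 1 ≤ T) :
    0 < stepSize κ B n H T := by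
  have h1 := one_le_one_add_log hH
  have h2 : (0 : ℝ) < n := by exact_mod_cast hn
  have h3 : (0 : ℝ) < H := by exact_mod_cast hH
  have h4 : (0 : ℝ) < T := by exact_mod_cast hT
  rw [stepSize]
  positivity

theorem stepSize_mul_le (hκ : 0 < κ) (hB : 0 < B) (hn : 1 ≤ n) (hH : 1 ≤ H) (hT : 1 ≤ T) :
    stepSize κ B n H T * n * B * H ≤ κ / Real.sqrt T := by
  have h1 := one_le_one_add_log hH
  have h2 : (0 : ℝ) < n := by exact_mod_cast hn
  have h3 : (0 : ℝ) < H := by exact_mod_cast hH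
  have h4 : (0 : ℝ) < T := by exact_mod_cast hT
  have h5 : 0 < Real.sqrt T := Real.sqrt_pos.2 h4
  have h6 : stepSize κ B n H T * n * B * H = κ / Real.sqrt T / (1 + Real.log H) := by
    rw [stepSize]
    field_simp
  rw [h6]
  exact div_le_self (by positivity) h1

theorem mul_stepSize_le (hκ : 0 < κ) (hB : 0 < B) (hn : 1 ≤ n) (hH : 1 ≤ H) (hT : 1 ≤ T) :
    B * stepSize κ B n H T ≤ κ / Real.sqrt T := by
  have h1 := stepSize_pos hκ hB hn hH hT
  have h2 : (1 : ℝ) ≤ n := by exact_mod_cast hn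
  have h3 : (1 : ℝ) ≤ H := by exact_mod_cast hH
  refine le_trans ?_ (stepSize_mul_le hκ hB hn hH hT)
  have h4 : 1 * 1 ≤ (n : ℝ) * H := mul_le_mul h2 h3 zero_le_one (by linarith)
  have h5 := mul_le_mul_of_nonneg_left h4 (mul_pos hB h1).le
  linarith

/-- The factor 1 + log H is at most H and is traded for one more power of H. -/
theorem one_div_stepSize_le (hκ : 0 < κ) (hB : 0 < B) (hH : 1 ≤ H) :
    1 / stepSize κ B n H T ≤ B / κ * (n * H ^ 2 * Real.sqrt T) := by
  have h1 := one_add_log_le hH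
  rw [stepSize, one_div_div]
  calc n * B * H * (1 + Real.log H) * Real.sqrt T / κ ≤ n * B * H * H * Real.sqrt T / κ := by
        gcongr
    _ = B / κ * (n * H ^ 2 * Real.sqrt T) := by ring

theorem sqrt_mul_stepSize_le (hκ : 0 < κ) (hB : 0 < B) (hn : 1 ≤ n) (hH : 1 ≤ H) (hT : 1 ≤ T) :
    Real.sqrt (8 * B * stepSize κ B n H T) ≤ Real.sqrt (8 * κ) / Real.sqrt (Real.sqrt T) := by
  rw [← Real.sqrt_div (by positivity)]
  refine Real.sqrt_le_sqrt ?_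
  have := mul_stepSize_le hκ hB hn hH hT
  rw [mul_div_assoc, mul_assoc]
  linarith

theorem one_le_sqrt_cast (hT : 1 ≤ T) : 1 ≤ Real.sqrt T :=
  Real.one_le_sqrt.2 (by exact_mod_cast hT)

theorem sum_stepBound_stepSize_le (hκ : 0 < κ) (hB : 0 < B) (hn : 1 ≤ n) (hH : 1 ≤ H)
    (hT : 1 ≤ T) : ∑ s ∈ Finset.Ico 1 T, stepBound n (stepSize κ B n H T) B H s ≤
      (4 * κ + 4 * Real.sqrt (8 * κ)) * Real.sqrt T := by
  have h1 := one_le_sqrt_cast hT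
  have h2 : Real.sqrt T * Real.sqrt T = T := Real.mul_self_sqrt (Nat.cast_nonneg T)
  refine (sum_stepBound_le (stepSize_pos hκ hB hn hH hT).le hB.le hH).trans ?_
  have h3 : stepSize κ B n H T * n * B * H * T ≤ κ * Real.sqrt T := by
    have := mul_le_mul_of_nonneg_right (stepSize_mul_le hκ hB hn hH hT) (Nat.cast_nonneg T)
    refine this.trans (le_of_eq ?_)
    rw [div_mul_eq_mul_div, div_eq_iff (by positivity), mul_assoc, h2]
  have h4 : Real.sqrt (8 * B * stepSize κ B n H T) ≤ Real.sqrt (8 * κ) :=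
    (sqrt_mul_stepSize_le hκ hB hn hH hT).trans
      (div_le_self (Real.sqrt_nonneg _) (Real.one_le_sqrt.2 h1))
  have h5 := mul_le_mul_of_nonneg_right h4 (Real.sqrt_nonneg T)
  linarith

/-- If the steps are not small, then the horizon is short. -/
theorem le_of_lt_stepBound (hκ : 0 < κ) (hB : 0 < B) (hn : 1 ≤ n) (hH : 1 ≤ H) (hT : 1 ≤ T)
    (h : 1 / (24 * (H : ℝ)) < stepBound n (stepSize κ B n H T) B H H) :
    (T : ℝ) ≤ (48 * (2 * κ + Real.sqrt (8 * κ))) ^ 2 * (H ^ 2 * Real.sqrt T) := by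
  have h1 := one_le_sqrt_cast hT
  have h2 : Real.sqrt T * Real.sqrt T = T := Real.mul_self_sqrt (Nat.cast_nonneg T)
  have hH0 : (0 : ℝ) < H := by exact_mod_cast hH
  -- The largest step is at most a constant times T^{-1/4}. If it exceeds 1/(24H), then T^{1/4} is
  -- at most a constant times H; squaring and multiplying by √T gives the claim.
  set r := Real.sqrt (Real.sqrt T) with hr
  have hr1 : 1 ≤ r := Real.one_le_sqrt.2 h1
  have hr2 : r * r = Real.sqrt T := Real.mul_self_sqrt (by linarith)
  have h3 : stepBound n (stepSize κ B n H T) B H H ≤ 2 * (2 * κ + Real.sqrt (8 * κ)) / r := by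
    rw [stepBound, Nat.add_sub_cancel_left, Nat.cast_one, div_one, mul_div_assoc, add_div]
    refine mul_le_mul_of_nonneg_left (add_le_add ?_ (sqrt_mul_stepSize_le hκ hB hn hH hT))
      zero_le_two
    rw [mul_div_assoc]
    refine mul_le_mul_of_nonneg_left ((stepSize_mul_le hκ hB hn hH hT).trans ?_) zero_le_two
    exact div_le_div_of_nonneg_left hκ.le (by linarith) (by rw [← hr2]; nlinarith)
  have h4 := h.trans_le h3
  rw [div_lt_div_iff₀ (by positivity) (by linarith)] at h4
  have h5 : r ≤ 48 * (2 * κ + Real.sqrt (8 * κ)) * H := by linarith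
  have h6 : r * r ≤
      (48 * (2 * κ + Real.sqrt (8 * κ)) * H) * (48 * (2 * κ + Real.sqrt (8 * κ)) * H) :=
    mul_le_mul h5 h5 (by linarith) (by linarith)
  have h7 := mul_le_mul_of_nonneg_right h6 (Real.sqrt_nonneg T)
  rw [hr2, h2] at h7
  refine h7.trans (le_of_eq ?_)
  ring

end StepSize

/-- The constant multiplying `(1 + ν) H⁴ (1 + log T) (β n / σ) √T` in the regret bound. -/
def regretConst (B D L κ : ℝ) : ℝ :=
  3 * (B / κ) + (2 * L * D + 20 * B) * (4 * κ + 4 * Real.sqrt (8 * κ)) + 12 * B +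
    2 * B * (48 * (2 * κ + Real.sqrt (8 * κ))) ^ 2

section Arithmetic

variable {B D L κ : ℝ}

theorem regretConst_pos (hB : 0 < B) (hD : 0 < D) (hL : 0 < L) (hκ : 0 < κ) :
    0 < regretConst B D L κ := by
  rw [regretConst]
  positivity

/-- Here s, l and M stand for √T, log T and the total movement. Every term is brought to the form of
a constant times H^j (β/σ) n s with j ≤ 4; those without β/σ are first multiplied by 2Hβ/σ ≥ 1. -/
theorem stable_bound_le (hB : 0 < B) (hD : 0 < D) (hL : 0 < L) (hκ : 0 < κ)
    {n H s l ν β σ η M : ℝ} (hn : 1 ≤ n) (hH : 1 ≤ H) (hs : 1 ≤ s) (hl : 0 ≤ l) (hν : 0 ≤ ν)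
    (hβ : 0 < β) (hσ : 0 < σ) (hσβ : σ ≤ 2 * (β * H))
    (hη' : 1 / η ≤ B / κ * (n * H ^ 2 * s))
    (hM : M ≤ (4 * κ + 4 * Real.sqrt (8 * κ)) * s) :
    β * H / (η * σ) * (1 + l) + (L * (H * D) + 2 * β * H ^ 2 * (8 * B / σ)) * (H * M) +
        (1 / η * (ν * l) + 4 * B * H + 2 * n * B * H ^ 3 * M) + B * H + B ≤
      regretConst B D L κ * ((1 + ν) * (H ^ 4 * (1 + l)) * ((β * n / σ) * s)) := by
  set k := 4 * κ + 4 * Real.sqrt (8 * κ) with hk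
  have hk0 : 0 < k := by positivity
  set ρ := β / σ with hρ
  have hρ0 : 0 < ρ := by positivity
  have hρ1 : 1 ≤ 2 * H * ρ := by
    rw [hρ, mul_div_assoc', one_le_div hσ]
    linarith
  have hX : β * n / σ * s = ρ * n * s := by rw [hρ]; ring
  set Z := (1 + ν) * (H ^ 4 * (1 + l)) * (ρ * n * s) with hZ
  have base : ∀ a : ℝ, a ≤ (1 + ν) * (1 + l) → ∀ j : ℕ, j ≤ 4 →
      a * (H ^ j * (ρ * n * s)) ≤ Z := by
    intro a ha j hj
    have h1 : H ^ j ≤ H ^ 4 := pow_le_pow_right₀ hH hj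
    calc a * (H ^ j * (ρ * n * s)) ≤ (1 + ν) * (1 + l) * (H ^ 4 * (ρ * n * s)) := by gcongr
      _ = Z := by rw [hZ]; ring
  have hνl : 0 ≤ ν * l := mul_nonneg hν hl
  have z1 := base (1 + l) (by linarith) 3 (by norm_num)
  have z2 := base 1 (by linarith) 3 (by norm_num)
  have z3 := base (ν * l) (by linarith) 3 (by norm_num)
  have z4 := base 1 (by linarith) 2 (by norm_num)
  have z5 := base 1 (by linarith) 4 (by norm_num)
  have absorb : ∀ a : ℝ, 0 ≤ a → a ≤ a * (2 * H * ρ) := fun a ha =>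
    le_mul_of_one_le_right ha hρ1
  have t1 : β * H / (η * σ) * (1 + l) ≤ B / κ * Z := by
    have e : β * H / (η * σ) * (1 + l) = ρ * H * (1 + l) * (1 / η) := by
      rw [hρ]; simp only [div_eq_mul_inv, mul_inv]; ring
    rw [e]
    calc ρ * H * (1 + l) * (1 / η) ≤ ρ * H * (1 + l) * (B / κ * (n * H ^ 2 * s)) := by gcongr
      _ = B / κ * ((1 + l) * (H ^ 3 * (ρ * n * s))) := by ring
      _ ≤ _ := by gcongr
  have t2 : L * (H * D) * (H * M) ≤ 2 * L * D * k * Z := by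
    calc L * (H * D) * (H * M) ≤ L * (H * D) * (H * (k * s)) := by gcongr
      _ ≤ L * (H * D) * (H * (k * s)) * (2 * H * ρ) := absorb _ (by positivity)
      _ = 2 * L * D * k * (H ^ 3 * (ρ * 1 * s)) := by ring
      _ ≤ 2 * L * D * k * (H ^ 3 * (ρ * n * s)) := by gcongr
      _ = 2 * L * D * k * (1 * (H ^ 3 * (ρ * n * s))) := by ring
      _ ≤ _ := by gcongr
  have t3 : 2 * β * H ^ 2 * (8 * B / σ) * (H * M) ≤ 16 * B * k * Z := by
    calc 2 * β * H ^ 2 * (8 * B / σ) * (H * M) ≤ 2 * β * H ^ 2 * (8 * B / σ) * (H * (k * s)) := by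
          gcongr
      _ = 16 * B * k * (H ^ 3 * (ρ * 1 * s)) := by rw [hρ]; ring
      _ ≤ 16 * B * k * (H ^ 3 * (ρ * n * s)) := by gcongr
      _ = 16 * B * k * (1 * (H ^ 3 * (ρ * n * s))) := by ring
      _ ≤ _ := by gcongr
  have t4 : 1 / η * (ν * l) ≤ 2 * (B / κ) * Z := by
    calc 1 / η * (ν * l) ≤ B / κ * (n * H ^ 2 * s) * (ν * l) := by gcongr
      _ ≤ B / κ * (n * H ^ 2 * s) * (ν * l) * (2 * H * ρ) := absorb _ (by positivity)
      _ = 2 * (B / κ) * ((ν * l) * (H ^ 3 * (ρ * n * s))) := by ring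
      _ ≤ _ := by gcongr
  have t5 : 4 * B * H + B * H + B ≤ 12 * B * Z := by
    calc 4 * B * H + B * H + B ≤ 6 * B * H := by nlinarith
      _ ≤ 6 * B * H * (2 * H * ρ) := absorb _ (by positivity)
      _ = 12 * B * (H ^ 2 * (ρ * 1 * 1)) := by ring
      _ ≤ 12 * B * (H ^ 2 * (ρ * n * s)) := by gcongr
      _ = 12 * B * (1 * (H ^ 2 * (ρ * n * s))) := by ring
      _ ≤ _ := by gcongr
  have t6 : 2 * n * B * H ^ 3 * M ≤ 4 * B * k * Z := by
    calc 2 * n * B * H ^ 3 * M ≤ 2 * n * B * H ^ 3 * (k * s) := by gcongr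
      _ ≤ 2 * n * B * H ^ 3 * (k * s) * (2 * H * ρ) := absorb _ (by positivity)
      _ = 4 * B * k * (1 * (H ^ 4 * (ρ * n * s))) := by ring
      _ ≤ _ := by gcongr
  have hZ0 : 0 ≤ Z := by positivity
  have t7 : 0 ≤ 2 * B * (48 * (2 * κ + Real.sqrt (8 * κ))) ^ 2 * Z := by positivity
  rw [hX, ← hZ, regretConst, ← hk]
  linarith

/-- A short horizon turns BT into a multiple of H²√T, and 2Hβ/σ ≥ 1 supplies the missing ratio. -/
theorem unstable_bound_le (hB : 0 < B) (hD : 0 < D) (hL : 0 < L) (hκ : 0 < κ)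
    {n H s l ν β σ T : ℝ} (hn : 1 ≤ n) (hH : 1 ≤ H) (hs : 1 ≤ s) (hl : 0 ≤ l) (hν : 0 ≤ ν)
    (hβ : 0 < β) (hσ : 0 < σ) (hσβ : σ ≤ 2 * (β * H))
    (hT : T ≤ (48 * (2 * κ + Real.sqrt (8 * κ))) ^ 2 * (H ^ 2 * s)) :
    B * T ≤ regretConst B D L κ * ((1 + ν) * (H ^ 4 * (1 + l)) * ((β * n / σ) * s)) := by
  set k := (48 * (2 * κ + Real.sqrt (8 * κ))) ^ 2 with hk
  have hk0 : 0 < k := by positivity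
  have hρ1 : 1 ≤ 2 * H * (β / σ) := by
    rw [mul_div_assoc', one_le_div hσ]
    linarith
  calc B * T ≤ B * (k * (H ^ 2 * s)) := by gcongr
    _ ≤ B * (k * (H ^ 2 * s)) * (2 * H * (β / σ)) := le_mul_of_one_le_right (by positivity) hρ1
    _ = 2 * B * k * ((1 + 0) * (H ^ 3 * (1 + 0)) * ((β * 1 / σ) * s)) := by ring
    _ ≤ regretConst B D L κ * ((1 + ν) * (H ^ 4 * (1 + l)) * ((β * n / σ) * s)) := by
        have h1 : 2 * B * k ≤ regretConst B D L κ := by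
          rw [regretConst, ← hk]
          have : 0 ≤ 3 * (B / κ) + (2 * L * D + 20 * B) * (4 * κ + 4 * Real.sqrt (8 * κ)) +
            12 * B := by positivity
          linarith
        have h2 : H ^ 3 ≤ H ^ 4 := pow_le_pow_right₀ hH (by norm_num)
        have := regretConst_pos hB hD hL hκ
        gcongr

theorem polylog_bound_le {p : ℕ} {H c l : ℝ} (hH : 0 ≤ H) (hl : 1 / 2 ≤ l)
    (h : H ≤ c * l ^ p) : H ^ 4 * (1 + l) ≤ 3 * c ^ 4 * l ^ (4 * p + 1) := by
  have h1 : H ^ 4 ≤ (c * l ^ p) ^ 4 := pow_le_pow_left₀ hH h 4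
  calc H ^ 4 * (1 + l) ≤ (c * l ^ p) ^ 4 * (3 * l) := by
        refine mul_le_mul h1 (by linarith) (by linarith) (by positivity)
    _ = 3 * c ^ 4 * l ^ (4 * p + 1) := by
        rw [mul_pow, ← pow_mul, pow_succ l (4 * p), mul_comm p 4]; ring

end Arithmetic

/-! ### Assembly of the regret bound. -/

/-- The regret bound up to the polylogarithmic factor. -/
theorem expectedRegret_stepSize_le {n H T : ℕ} {B D L κ σ β ν : ℝ} (hB : 0 < B) (hD : 0 < D)
    (hL : 0 < L) (hκ : 0 < κ) (hn : 1 ≤ n) (hH : 1 ≤ H) (hHT : H ≤ T)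
    (hσ : 0 < σ) (hβ : 0 < β) (hν : 0 ≤ ν)
    {K : Set (E n)} (hK : Convex ℝ K) (hKc : IsClosed K) (hKb : Bornology.IsBounded K)
    (hKi : (interior K).Nonempty) (hKD : Metric.diam K ≤ D)
    {R : E n → ℝ} (hR : IsSelfConcordantBarrier K ν R)
    {Ω : Type*} [MeasurableSpace Ω] {P : Measure Ω} [IsProbabilityMeasure P]
    {u : ℕ → Ω → UnitSphere n} {F : ℕ → Ω → Hist n H → ℝ}
    {x : ℕ → Ω → E n} {A : ℕ → Ω → E n →L[ℝ] E n} {y g : ℕ → Ω → E n}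
    (hu : IsUniformNoise P (max H T) u)
    (hF : ∀ t ∈ Finset.Icc H T, ∀ w ∈ histSet K H, Measurable (fun ω => F t ω w))
    (hadm : ∀ t ∈ Finset.Icc H T, ∀ ω, IsAdmissibleLoss K B L β (F t ω))
    (hadv : IsDelayedAdversary P K T u F)
    (hconv : ∀ t ∈ Finset.Icc H T, IsCondStronglyConvex P K σ u F t)
    (hrun : ∀ ω, IsRun K R σ (stepSize κ B n H T) H T (fun t => F t ω) (fun t => u t ω)
      (fun t => x t ω) (fun t => A t ω) (fun t => y t ω) (fun t => g t ω)) :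
    (∀ t ∈ Finset.Icc H T, Integrable (fun ω => F t ω (window H (fun s => y s ω) t)) P) ∧
      ∀ z ∈ K, expectedRegret P T F y z ≤ regretConst B D L κ *
        ((1 + ν) * ((H : ℝ) ^ 4 * (1 + Real.log T)) * ((β * n / σ) * Real.sqrt T)) := by
  have hT : 1 ≤ T := hH.trans hHT
  have hTN : T ≤ max H T := le_max_right _ _
  have hmemH : H ∈ Finset.Icc H T := Finset.mem_Icc.2 ⟨le_rfl, hHT⟩
  have hle : pastSigma K u F H ≤ ‹MeasurableSpace Ω› :=
    le_sup_left.trans (RandomRun.knownSigma_le hu hTN hF le_rfl hHT)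
  have hdiam : ∀ a ∈ K, ∀ b ∈ K, σ * ‖a - b‖ ^ 2 ≤ 8 * B := fun a ha b hb =>
    (hconv H hmemH).sigma_mul_sq_le hle (hF H hmemH)
      (fun ω => (hadm H hmemH ω).nonneg) (fun ω => (hadm H hmemH ω).le_bound) ha hb
  -- Putting the implication inside the existential lets one choice of data serve all t, with
  -- arbitrary values outside the horizon.
  have hdata : ∀ t ω, ∃ q : (Hist n H →L[ℝ] Hist n H) × Hist n H × ℝ, t ∈ Finset.Icc H T →
      IsLossData K L β (F t ω) q.1 q.2.1 q.2.2 := by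
    intro t ω
    by_cases ht : t ∈ Finset.Icc H T
    · obtain ⟨S, b, c, h⟩ := (hadm t ht ω).exists_lossData hKi
      exact ⟨(S, b, c), fun _ => h⟩
    · exact ⟨0, fun h => (ht h).elim⟩
  choose q hq using hdata
  have hr : RandomRun K ν R σ (stepSize κ B n H T) B L β H T F u x A y g
      (fun t ω => (q t ω).1) (fun t ω => (q t ω).2.1) (fun t ω => (q t ω).2.2) :=
    { run := fun ω =>
        { convex := hK
          closed := hKc
          bounded := hKb
          barrier := hR
          sigma_pos := hσ
          eta_pos := stepSize_pos hκ hB hn hH hT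
          B_pos := hB
          one_le_H := hH
          H_le_T := hHT
          run := hrun ω
          loss_nonneg := fun t ht => (hadm t ht ω).nonneg
          loss_le := fun t ht => (hadm t ht ω).le_bound
          sigma_diam := hdiam }
      data := fun t ht ω => hq t ω ht
      nonempty := hKi }
  have hσβ : σ ≤ 2 * (β * H) :=
    (hconv H hmemH).le_two_mul_beta hn hσ.le hH hKi hle (hF H hmemH)
      (fun ω => (hadm H hmemH ω).nonneg) (fun ω => (hadm H hmemH ω).le_bound) hβ.le
      (hr.data H hmemH)
  have hn' : (1 : ℝ) ≤ n := by exact_mod_cast hn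
  have hH' : (1 : ℝ) ≤ H := by exact_mod_cast hH
  have hl : 0 ≤ Real.log T := Real.log_nonneg (by exact_mod_cast hT)
  refine ⟨fun t ht => ?_, fun z hz => ?_⟩
  · rw [Finset.mem_Icc] at ht
    exact hr.integrable_loss_window hu hTN hF ht.1 ht.2
  -- Either the stability argument applies, or the horizon is so short that the trivial bound is
  -- good enough.
  · rcases le_or_gt (stepBound n (stepSize κ B n H T) B H H) (1 / (24 * H)) with hsmall | hlarge
    · refine (hr.expectedRegret_le hn hν hβ.le hL.le hD.le (fun a ha b hb => ?_) hsmall hu hTN hF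
        (fun t ht ω => (hadm t ht ω).convexOn) hadv hconv hz).trans
        (stable_bound_le hB hD hL hκ hn' hH' (one_le_sqrt_cast hT) hl hν hβ hσ hσβ
          (one_div_stepSize_le hκ hB hH) (sum_stepBound_stepSize_le hκ hB hn hH hT))
      rw [← dist_eq_norm]
      exact (Metric.dist_le_diam_of_mem hKb ha hb).trans hKD
    · exact (hr.expectedRegret_le_mul hB.le hH hu hTN hF hz).trans
        (unstable_bound_le hB hD hL hκ hn' hH' (one_le_sqrt_cast hT) hl hν hβ hσ hσβ
          (le_of_lt_stepBound hκ hB hn hH hT hlarge))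

end EBCO

end

theorem corollary2 (p : ℕ) :
    ∃ q : ℕ, ∀ B D L κ cH : ℝ, 0 < B → 0 < D → 0 < L → 0 < κ → 0 < cH →
    ∃ C : ℝ, 0 < C ∧
    ∀ (n H T : ℕ), 1 ≤ n → 1 ≤ H → 2 ≤ T → (H : ℝ) ≤ cH * Real.log T ^ p →
    ∀ (σ β ν : ℝ), 0 < σ → 0 < β → 0 ≤ ν →
    ∀ (K : Set (EBCO.E n)), Convex ℝ K → IsClosed K → Bornology.IsBounded K →
      (interior K).Nonempty → Metric.diam K ≤ D →
    ∀ (R : EBCO.E n → ℝ), EBCO.IsSelfConcordantBarrier K ν R →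
    ∀ (Ω : Type*) [MeasurableSpace Ω] (P : Measure Ω) [IsProbabilityMeasure P]
      (u : ℕ → Ω → EBCO.UnitSphere n) (F : ℕ → Ω → EBCO.Hist n H → ℝ)
      (x : ℕ → Ω → EBCO.E n) (A : ℕ → Ω → EBCO.E n →L[ℝ] EBCO.E n) (y g : ℕ → Ω → EBCO.E n),
      EBCO.IsUniformNoise P (max H T) u →
      (∀ t ∈ Finset.Icc H T, ∀ w ∈ EBCO.histSet K H, Measurable (fun ω => F t ω w)) →
      (∀ t ∈ Finset.Icc H T, ∀ ω, EBCO.IsAdmissibleLoss K B L β (F t ω)) →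
      EBCO.IsDelayedAdversary P K T u F →
      (∀ t ∈ Finset.Icc H T, EBCO.IsCondStronglyConvex P K σ u F t) →
      (∀ ω, EBCO.IsRun K R σ (κ / (n * B * H * (1 + Real.log H) * Real.sqrt T)) H T
        (fun t => F t ω) (fun t => u t ω)
        (fun t => x t ω) (fun t => A t ω) (fun t => y t ω) (fun t => g t ω)) →
      (∀ t ∈ Finset.Icc H T,
        Integrable (fun ω => F t ω (EBCO.window H (fun s => y s ω) t)) P) ∧
      ∀ z ∈ K, EBCO.expectedRegret P T F y z ≤
        C * (1 + ν) * Real.log T ^ q * (β * n / σ) * Real.sqrt T := by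
  -- The bound carries H⁴(1 + log T): four powers of H contribute (log T)^{4p}, and the last factor
  -- one more logarithm.
  refine ⟨4 * p + 1, fun B D L κ cH hB hD hL hκ hcH => ?_⟩
  have hC := EBCO.regretConst_pos hB hD hL hκ
  refine ⟨EBCO.regretConst B D L κ * (3 * cH ^ 4), by positivity, ?_⟩
  intro n H T hn hH hT hHp σ β ν hσ hβ hν K hK hKc hKb hKi hKD R hR Ω _ P _ u F x A y g
    hu hF hadm hadv hconv hrun
  -- Only T ≥ 2 is given, so log T may be below 1; from log T ≥ 1/2 one still gets 1 + log T ≤ 3 log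
  -- T.
  have hlog : 1 / 2 ≤ Real.log T := by
    have h1 := Real.log_two_gt_d9
    have h2 := Real.log_le_log (by norm_num) (show (2 : ℝ) ≤ T by exact_mod_cast hT)
    linarith
  rcases le_or_gt H T with hHT | hHT
  · obtain ⟨h1, h2⟩ := EBCO.expectedRegret_stepSize_le hB hD hL hκ hn hH hHT hσ hβ hν hK hKc hKb
      hKi hKD hR hu hF hadm hadv hconv hrun
    refine ⟨h1, fun z hz => (h2 z hz).trans ?_⟩
    have h3 := EBCO.polylog_bound_le (Nat.cast_nonneg H) hlog hHp
    calc _ ≤ EBCO.regretConst B D L κ * ((1 + ν) * (3 * cH ^ 4 * Real.log T ^ (4 * p + 1)) *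
          ((β * n / σ) * Real.sqrt T)) := by gcongr
      _ = _ := by ring
  -- When H > T no loss is ever incurred and both sums are empty.
  · have hempty : Finset.Icc H T = ∅ := Finset.Icc_eq_empty (by omega)
    refine ⟨fun t ht => by simp [hempty] at ht, fun z _ => ?_⟩
    rw [EBCO.expectedRegret, hempty, Finset.sum_empty, Finset.sum_empty, sub_zero]
    positivity
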